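/- Let $(\mathcal S,\mathcal A,P)$ be a probability space with expectation $E$, and let $c=\{c(t,x):t\ge 0,\ x\in\mathbb R\}$ be a (jointly measurable) strictly stationary random field on it, uniformly bounded, with $E\,c(t,x)=0$. Let $\Phi(t,x)=E[c(s,y)c(s+t,y+x)]$ be its correlation function, and assume $\Phi\in L^1(\mathbb R^2)$. For $A\subset\mathbb R_+\times\mathbb R$ let $\mathcal F_A=\sigma\{c(t,x):(t,x)\in A\}$, let $$\alpha_{\rm um}(r)=\sup_{\mathrm{dist}(A_1,A_2)\ge r}\ \sup_{S_1\in\mathcal F_{A_1},\,S_2\in\mathcal F_{A_2},\,P(S_2)\neq0}|P(S_1\mid S_2)-P(S_1)|,$$ and assume that $\alpha_{\rm um}(r)\le C(1+r)^{-(2+\delta)}$ for all $r\ge0$, for some constants $C,\delta>0$. Let $B$ be a standard Brownian motion on another probability space $(\Omega,\mathcal F,\mathbb P)$ with expectation $\mathbb E$ (so that $B$ and $c$ are independent on the product space), and let $g\in L^2(\mathbb R)\cap C(\mathbb R)$. For $\varepsilon>0$, $t\ge0$, $x\in\mathbb R$ put $$Y^{\varepsilon,x}_t=\frac1\varepsilon\int_0^t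 c\Big(\frac{r}{\varepsilon^2},\frac{x+B_r}{\varepsilon}\Big)dr,\qquad \Sigma=\int_0^\infty\mathbb E\,\Phi(r,B_r)\,dr,\qquad u(t,x)=\mathbb E[g(x+B_t)]\,e^{t\Sigma}.$$ Then: 1. $\int_0^\infty\mathbb E|\Phi(r,B_r)|\,dr<\infty$, and for all $t\ge0$, $x\in\mathbb R$, $$E\Big(\big(\mathbb E\big(g(x+B_t)[e^{Y^{\varepsilon,x}_t}-e^{t\Sigma}]\big)\big)^2\Big)\to0\qquad(\varepsilon\to0),$$ where for every $\varepsilon>0$ the inner expectation is well defined and square integrable. 2. For all $t\ge0$, $x\in\mathbb R$, the Feynman–Kac expression $\mathbb E[g(x+B_t)e^{Y^{\varepsilon,x}_t}]$ is in $L^2(P)$ and converges to $u(t,x)$ in $L^2(P)$ as $\varepsilon\to0$. 3. For every $\varepsilon>0$ and every realization of $c$, the problem $$\partial_t u^\varepsilon=\tfrac12\partial_x^2u^\varepsilon+\tfrac1\varepsilon c\Big(\frac t{\varepsilon^2},\frac x\varepsilon\Big)u^\varepsilon,\qquad u^\varepsilon(0,x)=g(x),$$ has a mild solution, i.e. a measurable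 function on $[0,\infty)\times\mathbb R$ with value $g$ at $t=0$, bounded in $L^2(\mathbb R)$ on bounded time intervals, that satisfies the Duhamel formula for the heat semigroup of $\frac12\partial_x^2$ at every $t>0$, $x\in\mathbb R$. If for every $\varepsilon>0$, $u^\varepsilon$ is $P$-a.s. such a solution, then for all $t\ge0$, $x\in\mathbb R$, $u^\varepsilon(t,x)\in L^2(P)$ and $u^\varepsilon(t,x)\to u(t,x)$ in $L^2(P)$ as $\varepsilon\to0$. 4. The deterministic function $u$ is continuous on $[0,\infty)\times\mathbb R$, satisfies $u(0,x)=g(x)$, and for $t>0$ it is $C^2$ in $x$, differentiable in $t$, and solves $$\partial_tu=\tfrac12\,\partial_x^2u+\Sigma\,u .$$ -/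

import Mathlib

open MeasureTheory ProbabilityTheory Set Filter Topology
open scoped NNReal ENNReal

noncomputable section

/-- A random field `c` on `ℝ₊ × ℝ` is (strictly) stationary: its law as a family indexed by
`ℝ₊ × ℝ` is invariant under all shifts `(h, y)`, `h ≥ 0`, `y ∈ ℝ`. -/
def IsStationaryField {S : Type*} [MeasurableSpace S] (P : Measure S)
    (c : ℝ≥0 → ℝ → S → ℝ) : Prop :=
  ∀ (h : ℝ≥0) (y : ℝ),
    IdentDistrib (fun s (p : ℝ≥0 × ℝ) => c (p.1 + h) (p.2 + y) s)
      (fun s (p : ℝ≥0 × ℝ) => c p.1 p.2 s) P P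

/-- The correlation function `Φ(t, x) = E[c(s, y) c(s + t, y + x)]` of a stationary field,
for every real `t`; the base point is `y = 0` and `s = max (-t) 0`, so that `s, s + t ≥ 0`. -/
def fieldCorrelation {S : Type*} [MeasurableSpace S] (P : Measure S)
    (c : ℝ≥0 → ℝ → S → ℝ) (t x : ℝ) : ℝ :=
  ∫ s, c (-t).toNNReal 0 s * c t.toNNReal x s ∂P

/-- The `σ`-algebra generated by `c(t, x)`, `(t, x) ∈ A`. -/
abbrev fieldSigma {S : Type*} (c : ℝ≥0 → ℝ → S → ℝ) (A : Set (ℝ≥0 × ℝ)) : MeasurableSpace S :=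
  ⨆ p ∈ A, MeasurableSpace.comap (c p.1 p.2) inferInstance

/-- The uniform mixing coefficient: the supremum of `|P(S₁ | S₂) - P(S₁)|` over sets
`A₁, A₂` at Euclidean distance at least `r` and events `S₁`, `S₂` of the `σ`-algebras
generated by the field on `A₁`, `A₂`, with `P(S₂) ≠ 0`. -/
def alphaUM {S : Type*} [MeasurableSpace S] (P : Measure S)
    (c : ℝ≥0 → ℝ → S → ℝ) (r : ℝ) : ℝ :=
  sSup {a : ℝ | ∃ A₁ A₂ : Set (ℝ≥0 × ℝ),
    (∀ p ∈ A₁, ∀ q ∈ A₂, r ≤ √(((p.1 : ℝ) - q.1) ^ 2 + (p.2 - q.2) ^ 2)) ∧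
    ∃ S₁ S₂ : Set S, MeasurableSet[fieldSigma c A₁] S₁ ∧ MeasurableSet[fieldSigma c A₂] S₂ ∧
      P S₂ ≠ 0 ∧ a = |(ProbabilityTheory.cond P S₂).real S₁ - P.real S₁|}

/-- The uniform mixing hypothesis: `α_um(r) ≤ C (1 + r)^{-(2 + δ)}` for some `C, δ > 0`. -/
def UniformMixing {S : Type*} [MeasurableSpace S] (P : Measure S)
    (c : ℝ≥0 → ℝ → S → ℝ) : Prop :=
  ∃ C > (0 : ℝ), ∃ δ > (0 : ℝ), ∀ r ≥ (0 : ℝ), alphaUM P c r ≤ C * (1 + r) ^ (-(2 + δ))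

/-- The rescaled potential `ε⁻¹ c(t/ε², x/ε)`. -/
def scaledPotential {S : Type*} (c : ℝ≥0 → ℝ → S → ℝ) (ε : ℝ) (s : S) (t x : ℝ) : ℝ :=
  ε⁻¹ * c (t / ε ^ 2).toNNReal (x / ε) s

/-- `Y^{ε,x}_t = ε⁻¹ ∫₀ᵗ c(r/ε², (x + B_r)/ε) dr`. -/
def expoY {S Ω : Type*} (c : ℝ≥0 → ℝ → S → ℝ) (B : ℝ≥0 → Ω → ℝ)
    (ε t x : ℝ) (s : S) (ω : Ω) : ℝ :=
  ∫ r in (0 : ℝ)..t, scaledPotential c ε s r (x + B r.toNNReal ω)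

/-- The Feynman–Kac functional `𝔼[g(x + B_t) exp(Y^{ε,x}_t)]`, a random variable on `S`. -/
def feynmanKac {S Ω : Type*} [MeasurableSpace Ω] (PB : Measure Ω) (c : ℝ≥0 → ℝ → S → ℝ)
    (B : ℝ≥0 → Ω → ℝ) (g : ℝ → ℝ) (ε t x : ℝ) (s : S) : ℝ :=
  ∫ ω, g (x + B t.toNNReal ω) * Real.exp (expoY c B ε t x s ω) ∂PB

/-- The effective constant `Σ = ∫₀^∞ 𝔼 Φ(r, B_r) dr`. -/
def effectiveConst {S Ω : Type*} [MeasurableSpace S] [MeasurableSpace Ω] (P : Measure S)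
    (PB : Measure Ω) (c : ℝ≥0 → ℝ → S → ℝ) (B : ℝ≥0 → Ω → ℝ) : ℝ :=
  ∫ r in Ioi (0 : ℝ), ∫ ω, fieldCorrelation P c r (B r.toNNReal ω) ∂PB

/-- The limit `u(t, x) = 𝔼[g(x + B_t)] exp(t Σ)`. -/
def limitU {S Ω : Type*} [MeasurableSpace S] [MeasurableSpace Ω] (P : Measure S)
    (PB : Measure Ω) (c : ℝ≥0 → ℝ → S → ℝ) (B : ℝ≥0 → Ω → ℝ) (g : ℝ → ℝ) (t x : ℝ) : ℝ :=
  (∫ ω, g (x + B t.toNNReal ω) ∂PB) * Real.exp (t * effectiveConst P PB c B)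

/-- `v` is a mild (Duhamel) solution on `[0, ∞) × ℝ` of
`∂ₜ v = ½ ∂ₓ² v + V v`, `v(0, ·) = g`, bounded in `L²(ℝ)` on bounded time intervals.
`gaussianPDFReal x t.toNNReal` is the heat kernel of `½ ∂ₓ²` at time `t` started from `x`.
Only the values `v t x` with `t ≥ 0` matter. For bounded measurable `V` and `g ∈ L²` the integrals
in `duhamel` converge absolutely. -/
structure IsMildSolution (V : ℝ → ℝ → ℝ) (g : ℝ → ℝ) (v : ℝ → ℝ → ℝ) : Prop where
  measurable : Measurable (fun p : ℝ≥0 × ℝ => v p.1 p.2)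
  bounded : ∀ T : ℝ, ∃ K : ℝ≥0, ∀ t ∈ Icc 0 T, eLpNorm (v t) 2 volume ≤ K
  initial : ∀ x, v 0 x = g x
  duhamel : ∀ t > 0, ∀ x, v t x =
    (∫ y, gaussianPDFReal x t.toNNReal y * g y) +
      ∫ r in (0 : ℝ)..t, ∫ y, gaussianPDFReal x (t - r).toNNReal y * (V r y * v r y)

end

/-! The proof is a second moment computation. Put γ = g(x + B_t) and a = e^{tΣ}. The square of
𝔼[γ(e^Y - a)] is a double expectation over two independent Brownian paths, so by Fubini its P-mean
involves only the moments E e^{θ₁Y + θ₂Y'} with θ₁, θ₂ ∈ {0, 1}, taken over the field with both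
paths frozen (`integral_sq_eq_pairMoments`). Once these converge in mean square over the paths to
e^{(θ₁² + θ₂²)tΣ}, the four terms cancel in the limit: a² - 2a² + a² = 0.

Frozen paths. Let ξ be the combination of the field values along the two paths, I_r = ε⁻¹∫₀ʳ ξ and
f(r) = E e^{I_r}. Then f' = ε⁻¹ E[ξ_r e^{I_r}], and e^{I_r} is expanded over a window of length ε²L.
The remote part E[ξ_r e^{I_{r-ε²L}}] is small by mixing and centering. In the double integral of ξ_r
ξ_u e^{I_u} the exponential is moved back by one more window and then decoupled. This gives f' = f
(Q + small), where Q(r) = ε⁻²∫₀ʳ E[ξ_r ξ_u] du, hence log f(T) = ∫₀ᵀ Q + o(1) uniformly in the paths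
(`abs_deriv_expMoment_sub_le`, `abs_log_expMoment_sub_le`). All errors have to be relative to f, for
which the trivial bound is only e^{O(1/ε)}. Uniform mixing supplies exactly that: in
`abs_integral_mul_sub_le_alphaUM` the error is proportional to the mean of the nonnegative factor,
not to its supremum. The two demands εL² → 0 and ε⁻¹α(L) → 0 are compatible because the mixing
exponent exceeds 2 (`tendsto_expErr`).

Averaging over the paths. In the lag variable v = (r - u)/ε² the integral of Q consists of time
averages of Φ(v, ·) along rescaled Brownian increments. Along a single path these increments are
independent at times ε²v apart and have the law of B_v, so the averages converge to their mean
(`tendsto_lag_diagonal`). Along two independent paths the difference of positions has a bounded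
density at the macroscopic scale, while Φ(v, ·) lives at scale ε, so the mixed terms vanish
(`tendsto_lag_cross`); this is where Φ ∈ L¹ enters. The decay (1 + v)⁻² dominates the sum over lags.

The equation. The Feynman–Kac solution of the oscillating problem evaluates the potential at time t
- r. The whole argument is therefore written for an abstract clock (`IsClock`) and applied both
forwards and backwards; reversal only reflects Φ in space, which does not change Σ because B is
symmetric. The Markov property gives Duhamel's formula (`fkSol_duhamel`), and a Picard iteration
gives uniqueness (`IsMildSolution.unique`), so every mild solution is the Feynman–Kac one. The
regularity of the limit is that of Gaussian averages of L² functions (`heat_smooth`,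
`continuous_integral_comp_brownian`). -/

noncomputable section


/-! ### Covariance inequalities from uniform mixing, with relative error. -/

section Mixing

variable {S : Type*} [mS : MeasurableSpace S] {P : Measure S} [IsProbabilityMeasure P]

/-- If a set function comparison `|P(S₁ ∩ S₂) - P(S₁) P(S₂)| ≤ a P(S₂)` holds on a sub-σ-algebra,
it passes to nonnegative functions. -/
lemma abs_setIntegral_sub_le {m : MeasurableSpace S} (hm : m ≤ mS) {a : ℝ} (ha : 0 ≤ a)
    {S₁ : Set S}
    (h : ∀ S₂, MeasurableSet[m] S₂ → |P.real (S₁ ∩ S₂) - P.real S₁ * P.real S₂| ≤ a * P.real S₂)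
    {F : S → ℝ} (hF : StronglyMeasurable[m] F) (hFi : Integrable F P) (h0 : ∀ s, 0 ≤ F s) :
    |∫ s in S₁, F s ∂P - P.real S₁ * ∫ s, F s ∂P| ≤ a * ∫ s, F s ∂P := by
  have hFr : Integrable F (P.restrict S₁) := hFi.restrict
  have e1 : ∫ s in S₁, F s ∂P = ∫ s, F s ∂((P.restrict S₁).trim hm) := integral_trim hm hF
  have e2 : ∫ s, F s ∂P = ∫ s, F s ∂(P.trim hm) := integral_trim hm hF
  have hFt := hFi.trim hm hF
  have hFrt := hFr.trim hm hF
  have real_eq : ∀ S₂, MeasurableSet[m] S₂ → (P.restrict S₁) S₂ = ENNReal.ofReal (P.real (S₁ ∩ S₂)) := by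
    intro S₂ hS
    rw [Measure.restrict_apply (hm _ hS), inter_comm, ofReal_measureReal]
  -- The hypothesis is a two-sided comparison of measures on `m`, and such comparisons integrate
  -- against `F ≥ 0`. In the lower one the term with `a` is moved to the right side, since `P.real
  -- S₁ - a` may be negative.
  have key1 : (P.restrict S₁).trim hm ≤ ENNReal.ofReal (P.real S₁ + a) • (P.trim hm) := by
    rw [Measure.le_iff]
    intro S₂ hS
    rw [trim_measurableSet_eq hm hS, real_eq _ hS, Measure.smul_apply, trim_measurableSet_eq hm hS,
      smul_eq_mul, ← ofReal_measureReal (μ := P) (s := S₂), ← ENNReal.ofReal_mul (by positivity)]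
    apply ENNReal.ofReal_le_ofReal
    have := (abs_le.1 (h S₂ hS)).2
    linarith
  have key2 : ENNReal.ofReal (P.real S₁) • (P.trim hm) ≤
      (P.restrict S₁).trim hm + ENNReal.ofReal a • (P.trim hm) := by
    rw [Measure.le_iff]
    intro S₂ hS
    rw [Measure.add_apply, trim_measurableSet_eq hm hS, real_eq _ hS, Measure.smul_apply,
      Measure.smul_apply, trim_measurableSet_eq hm hS,
      smul_eq_mul, smul_eq_mul, ← ofReal_measureReal (μ := P) (s := S₂),
      ← ENNReal.ofReal_mul (by positivity), ← ENNReal.ofReal_mul (by positivity),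
      ← ENNReal.ofReal_add (by positivity) (by positivity)]
    apply ENNReal.ofReal_le_ofReal
    have := (abs_le.1 (h S₂ hS)).1
    linarith
  have i1 := integral_mono_measure key1 (ae_of_all _ h0) (hFt.smul_measure ENNReal.ofReal_ne_top)
  have i2 := integral_mono_measure key2 (ae_of_all _ h0)
    (hFrt.add_measure (hFt.smul_measure ENNReal.ofReal_ne_top))
  rw [integral_smul_measure, ENNReal.toReal_ofReal (by positivity), smul_eq_mul] at i1
  rw [integral_add_measure hFrt (hFt.smul_measure ENNReal.ofReal_ne_top), integral_smul_measure,
    integral_smul_measure, ENNReal.toReal_ofReal (by positivity),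
    ENNReal.toReal_ofReal (by positivity), smul_eq_mul, smul_eq_mul] at i2
  rw [e1, e2, abs_le]
  constructor <;> linarith

/-- From set-wise comparison to bounded functions, by the layer cake formula. -/
lemma abs_integral_mul_sub_le {G F : S → ℝ} {a M : ℝ} (hG : Measurable G)
    (hGM : ∀ s, |G s| ≤ M) (hFi : Integrable F P) (h0 : ∀ s, 0 ≤ F s)
    (h : ∀ t : ℝ, |∫ s in {s | t ≤ G s}, F s ∂P - P.real {s | t ≤ G s} * ∫ s, F s ∂P|
      ≤ a * ∫ s, F s ∂P) :
    |∫ s, G s * F s ∂P - (∫ s, G s ∂P) * ∫ s, F s ∂P| ≤ 2 * M * a * ∫ s, F s ∂P := by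
  have hM : 0 ≤ M := by
    obtain ⟨s⟩ : Nonempty S := nonempty_of_isProbabilityMeasure P
    exact (abs_nonneg _).trans (hGM s)
  -- The shift by `M` gives values in `[0, 2M]`, as the layer cake formula requires, and leaves the
  -- covariance unchanged.
  set G' : S → ℝ := fun s => G s + M with hG'
  have hG'm : Measurable G' := hG.add_const M
  have hG'0 : ∀ s, 0 ≤ G' s := fun s => by have := (abs_le.1 (hGM s)).1; simp only [hG']; linarith
  have hG'M : ∀ s, G' s ≤ 2 * M := fun s => by
    have := (abs_le.1 (hGM s)).2; simp only [hG']; linarith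
  have hG'i : Integrable G' P := Integrable.of_bound hG'm.aestronglyMeasurable (2 * M)
    (ae_of_all _ fun s => by rw [Real.norm_eq_abs, abs_of_nonneg (hG'0 s)]; exact hG'M s)
  have hGi : Integrable G P := Integrable.of_bound hG.aestronglyMeasurable M
    (ae_of_all _ fun s => by rw [Real.norm_eq_abs]; exact hGM s)
  have hGFi : Integrable (fun s => G s * F s) P := hFi.bdd_mul hG.aestronglyMeasurable
    (ae_of_all _ fun s => by rw [Real.norm_eq_abs]; exact hGM s)
  have hG'Fi : Integrable (fun s => G' s * F s) P := hFi.bdd_mul hG'm.aestronglyMeasurable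
    (ae_of_all _ fun s => by rw [Real.norm_eq_abs, abs_of_nonneg (hG'0 s)]; exact hG'M s)
  -- With `F` absorbed into a measure, `∫ G F` has a layer cake formula too, and the two can be
  -- compared level by level.
  let ν : Measure S := P.withDensity fun s => ENNReal.ofReal (F s)
  have hFae : AEMeasurable (fun s => ENNReal.ofReal (F s)) P := hFi.1.aemeasurable.ennreal_ofReal
  have hν : ∀ f : S → ℝ, ∫ s, f s ∂ν = ∫ s, f s * F s ∂P := by
    intro f
    rw [integral_withDensity_eq_integral_toReal_smul₀ hFae (ae_of_all _ fun _ => ENNReal.ofReal_lt_top)]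
    congr 1; ext s
    rw [ENNReal.toReal_ofReal (h0 s), smul_eq_mul, mul_comm]
  have : IsFiniteMeasure ν := isFiniteMeasure_withDensity_ofReal hFi.2
  have hνr : ∀ A, MeasurableSet A → ν.real A = ∫ s in A, F s ∂P := by
    intro A hA
    rw [Measure.real, withDensity_apply _ hA, ← integral_eq_lintegral_of_nonneg_ae
      (ae_of_all _ h0) hFi.1.restrict]
  have hG'ν : Integrable G' ν := Integrable.of_bound hG'm.aestronglyMeasurable (2 * M)
    (ae_of_all _ fun s => by rw [Real.norm_eq_abs, abs_of_nonneg (hG'0 s)]; exact hG'M s)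
  have l1 := hG'i.integral_eq_integral_Ioc_meas_le (ae_of_all _ hG'0) (ae_of_all _ hG'M)
  have l2 := hG'ν.integral_eq_integral_Ioc_meas_le (ae_of_all _ hG'0) (ae_of_all _ hG'M)
  have hset : ∀ t, {s | t ≤ G' s} = {s | t - M ≤ G s} := by
    intro t; ext s; simp [hG']
  have meas_anti : ∀ (μ : Measure S) [IsFiniteMeasure μ],
      IntervalIntegrable (fun t => μ.real {s | t ≤ G' s}) volume 0 (2 * M) := by
    intro μ _
    apply AntitoneOn.intervalIntegrable
    intro t _ t' _ htt'
    exact measureReal_mono (fun s hs => le_trans htt' hs) 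
  have j1 := (intervalIntegrable_iff_integrableOn_Ioc_of_le (by linarith)).1 (meas_anti P)
  have j2 := (intervalIntegrable_iff_integrableOn_Ioc_of_le (by linarith)).1 (meas_anti ν)
  have expand : ∫ s, G s * F s ∂P - (∫ s, G s ∂P) * ∫ s, F s ∂P
      = ∫ s, G' s * F s ∂P - (∫ s, G' s ∂P) * ∫ s, F s ∂P := by
    have e1 : ∫ s, G' s * F s ∂P = ∫ s, G s * F s ∂P + M * ∫ s, F s ∂P := by
      rw [← integral_const_mul, ← integral_add hGFi (hFi.const_mul M)]
      congr 1; ext s; simp only [hG']; ring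
    have e2 : ∫ s, G' s ∂P = ∫ s, G s ∂P + M := by
      simp only [hG']
      rw [integral_add hGi (integrable_const _)]; simp
    rw [e1, e2]; ring
  have j3 : IntegrableOn (fun t => P.real {s | t ≤ G' s} * ∫ s, F s ∂P) (Ioc 0 (2 * M)) :=
    j1.mul_const _
  rw [expand, ← hν, l2, l1, ← integral_mul_const, ← integral_sub j2 j3]
  have := norm_setIntegral_le_of_norm_le_const (μ := volume) (s := Ioc 0 (2 * M))
    (f := fun t => ν.real {s | t ≤ G' s} - P.real {s | t ≤ G' s} * ∫ s, F s ∂P)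
    (C := a * ∫ s, F s ∂P) measure_Ioc_lt_top (fun t _ => by
      rw [Real.norm_eq_abs, hνr _ (measurableSet_le measurable_const hG'm), hset t]
      exact h _)
  rw [Real.norm_eq_abs, Real.volume_real_Ioc_of_le (by linarith)] at this
  refine this.trans (le_of_eq ?_)
  ring

/-- The real `sSup` of an unbounded set is `0`; boundedness is what makes a bound on `alphaUM` say
something about each individual pair of events. -/
lemma alphaUM_bddAbove (c : ℝ≥0 → ℝ → S → ℝ) (r : ℝ) :
    BddAbove {a : ℝ | ∃ A₁ A₂ : Set (ℝ≥0 × ℝ),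
    (∀ p ∈ A₁, ∀ q ∈ A₂, r ≤ √(((p.1 : ℝ) - q.1) ^ 2 + (p.2 - q.2) ^ 2)) ∧
    ∃ S₁ S₂ : Set S, MeasurableSet[fieldSigma c A₁] S₁ ∧ MeasurableSet[fieldSigma c A₂] S₂ ∧
      P S₂ ≠ 0 ∧ a = |(ProbabilityTheory.cond P S₂).real S₁ - P.real S₁|} := by
  refine ⟨1, ?_⟩
  rintro a ⟨A₁, A₂, -, S₁, S₂, -, -, h, rfl⟩
  have := cond_isProbabilityMeasure h
  rw [abs_le]
  constructor <;>
  linarith [measureReal_nonneg (μ := ProbabilityTheory.cond P S₂) (s := S₁),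
    measureReal_nonneg (μ := P) (s := S₁), measureReal_le_one (μ := P) (s := S₁),
    measureReal_le_one (μ := ProbabilityTheory.cond P S₂) (s := S₁)]

lemma alphaUM_nonneg (c : ℝ≥0 → ℝ → S → ℝ) (r : ℝ) : 0 ≤ alphaUM P c r := by
  apply Real.sSup_nonneg
  rintro a ⟨A₁, A₂, -, S₁, S₂, -, -, h, rfl⟩
  positivity

lemma fieldSigma_le {c : ℝ≥0 → ℝ → S → ℝ} (hc : ∀ t x, Measurable (c t x)) (A : Set (ℝ≥0 × ℝ)) :
    fieldSigma c A ≤ mS := iSup₂_le fun p _ => (hc p.1 p.2).comap_le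

lemma measurable_fieldSigma (c : ℝ≥0 → ℝ → S → ℝ) {A : Set (ℝ≥0 × ℝ)} {p : ℝ≥0 × ℝ}
    (hp : p ∈ A) : Measurable[fieldSigma c A] (c p.1 p.2) := by
  refine Measurable.mono (comap_measurable _) ?_ le_rfl
  exact le_iSup₂ (f := fun (p : ℝ≥0 × ℝ) (_ : p ∈ A) =>
    MeasurableSpace.comap (c p.1 p.2) (inferInstance : MeasurableSpace ℝ)) p hp

/-- Multiplying by `P S₂` removes the conditioning and lets null events in. The error stays
proportional to `P S₂`, which is the source of all relative errors below. -/
lemma abs_measureReal_inter_sub_le {c : ℝ≥0 → ℝ → S → ℝ} (hc : ∀ t x, Measurable (c t x))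
    {r : ℝ} {A₁ A₂ : Set (ℝ≥0 × ℝ)}
    (hA : ∀ p ∈ A₁, ∀ q ∈ A₂, r ≤ √(((p.1 : ℝ) - q.1) ^ 2 + (p.2 - q.2) ^ 2))
    {S₁ S₂ : Set S} (h₁ : MeasurableSet[fieldSigma c A₁] S₁)
    (h₂ : MeasurableSet[fieldSigma c A₂] S₂) :
    |P.real (S₁ ∩ S₂) - P.real S₁ * P.real S₂| ≤ alphaUM P c r * P.real S₂ := by
  have h₂' := fieldSigma_le hc _ _ h₂
  by_cases h0 : P S₂ = 0
  · have e1 : P.real S₂ = 0 := by simp [Measure.real, h0]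
    have e2 : P.real (S₁ ∩ S₂) = 0 := by
      have : P (S₁ ∩ S₂) = 0 := measure_mono_null inter_subset_right h0
      simp [Measure.real, this]
    simp [e1, e2]
  · have hle : |(ProbabilityTheory.cond P S₂).real S₁ - P.real S₁| ≤ alphaUM P c r :=
      le_csSup (alphaUM_bddAbove c r) ⟨A₁, A₂, hA, S₁, S₂, h₁, h₂, h0, rfl⟩
    have e : P.real (S₁ ∩ S₂) = (ProbabilityTheory.cond P S₂).real S₁ * P.real S₂ := by
      rw [inter_comm, Measure.real, Measure.real, Measure.real, ← ENNReal.toReal_mul,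
        cond_mul_eq_inter h₂']
    rw [e, ← sub_mul, abs_mul, abs_of_nonneg (measureReal_nonneg (s := S₂))]
    gcongr

/-- Covariance inequality for a bounded `G` and a nonnegative `F` measurable with respect to the
field on sets at distance at least `r`. -/
lemma abs_integral_mul_sub_le_alphaUM {c : ℝ≥0 → ℝ → S → ℝ} (hc : ∀ t x, Measurable (c t x))
    {r : ℝ} {A₁ A₂ : Set (ℝ≥0 × ℝ)}
    (hA : ∀ p ∈ A₁, ∀ q ∈ A₂, r ≤ √(((p.1 : ℝ) - q.1) ^ 2 + (p.2 - q.2) ^ 2))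
    {G F : S → ℝ} {M : ℝ} (hG : Measurable[fieldSigma c A₁] G) (hGM : ∀ s, |G s| ≤ M)
    (hF : AEStronglyMeasurable[fieldSigma c A₂] F P) (hFi : Integrable F P) (h0 : ∀ s, 0 ≤ F s) :
    |∫ s, G s * F s ∂P - (∫ s, G s ∂P) * ∫ s, F s ∂P| ≤ 2 * M * alphaUM P c r * ∫ s, F s ∂P := by
  obtain ⟨F', hF', hFF'⟩ := hF
  -- The measurable version of `F` is nonnegative only almost everywhere; its absolute value is so
  -- everywhere.
  set F'' : S → ℝ := fun s => |F' s| with hF''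
  have hF''m : StronglyMeasurable[fieldSigma c A₂] F'' := hF'.norm
  have hFF'' : F =ᵐ[P] F'' := by
    filter_upwards [hFF'] with s hs
    simp only [hF'']
    rw [← hs, abs_of_nonneg (h0 s)]
  have e1 : ∫ s, G s * F s ∂P = ∫ s, G s * F'' s ∂P := by
    apply integral_congr_ae
    filter_upwards [hFF''] with s hs
    rw [hs]
  have e2 : ∫ s, F s ∂P = ∫ s, F'' s ∂P := integral_congr_ae hFF''
  rw [e1, e2]
  refine abs_integral_mul_sub_le (hG.mono (fieldSigma_le hc _) le_rfl) hGM (hFi.congr hFF'')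
    (fun s => abs_nonneg _) fun t => ?_
  refine abs_setIntegral_sub_le (fieldSigma_le hc A₂) (alphaUM_nonneg c r) (fun S₂ hS₂ => ?_)
    hF''m (hFi.congr hFF'') (fun s => abs_nonneg _)
  exact abs_measureReal_inter_sub_le hc hA (measurableSet_le measurable_const hG) hS₂

/-- The time integral of a bounded jointly measurable process is a.e. measurable with respect to
any σ-algebra making the process measurable at each time. -/
lemma aestronglyMeasurable_integral_process {S : Type*} {m mS : MeasurableSpace S} {P : Measure S}
    [IsProbabilityMeasure P] (hm : m ≤ mS)
    {X : ℝ → S → ℝ} (hX : Measurable (Function.uncurry X)) {K : ℝ} (hK : ∀ r s, |X r s| ≤ K)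
    {a b : ℝ} (hab : a ≤ b) (hXm : ∀ r ∈ Icc a b, StronglyMeasurable[m] (X r)) :
    AEStronglyMeasurable[m] (fun s => ∫ r in a..b, X r s) P := by
  have hK0 : 0 ≤ K := by
    obtain ⟨s⟩ : Nonempty S := nonempty_of_isProbabilityMeasure P
    exact (abs_nonneg _).trans (hK 0 s)
  simp_rw [intervalIntegral.integral_of_le hab]
  set Z : S → ℝ := fun s => ∫ r in Ioc a b, X r s with hZ
  have hZm : StronglyMeasurable Z :=
    (hX.comp measurable_swap).stronglyMeasurable.integral_prod_right' (ν := volume.restrict (Ioc a b))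
  have hZb : ∀ s, ‖Z s‖ ≤ K * volume.real (Ioc a b) := fun s =>
    norm_setIntegral_le_of_norm_le_const (by simp) fun r _ => hK r s
  have hZi : Integrable Z P := Integrable.of_bound hZm.aestronglyMeasurable _ (ae_of_all _ hZb)
  -- Joint measurability holds only for the full σ-algebra, so Fubini does not give
  -- `m`-measurability. Instead the integral is shown to equal its conditional expectation almost
  -- surely: the difference `D` has mean square zero.
  set Z' : S → ℝ := P[Z|m] with hZ'
  have hZ'm : StronglyMeasurable[m] Z' := stronglyMeasurable_condExp
  have hZ'b : ∀ᵐ s ∂P, ‖Z' s‖ ≤ K * volume.real (Ioc a b) := by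
    exact ae_bdd_norm_condExp_of_ae_bdd_norm (ae_of_all _ hZb)
  set D : S → ℝ := Z - Z' with hD
  have hDi : Integrable D P := hZi.sub integrable_condExp
  have hD0 : P[D|m] =ᵐ[P] 0 := by
    have h1 := condExp_sub hZi (integrable_condExp (m := m) (f := Z) (μ := P)) m
    have h2 : P[Z'|m] = Z' := condExp_of_stronglyMeasurable hm hZ'm integrable_condExp
    filter_upwards [h1] with s hs
    rw [hs, Pi.sub_apply, h2]
    simp [hZ']
  have orth : ∀ W : S → ℝ, StronglyMeasurable[m] W → (∃ C, ∀ᵐ s ∂P, ‖W s‖ ≤ C) →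
      ∫ s, W s * D s ∂P = 0 := by
    rintro W hW ⟨C, hC⟩
    have hWi : Integrable (W * D) P :=
      hDi.bdd_mul (hW.mono hm).aestronglyMeasurable hC
    have := condExp_mul_of_stronglyMeasurable_left hW hWi hDi
    have h3 : ∫ s, W s * D s ∂P = ∫ s, (P[W * D|m]) s ∂P := (integral_condExp hm).symm
    rw [h3, integral_congr_ae this]
    rw [show (0:ℝ) = ∫ s, (0:ℝ) ∂P by simp]
    apply integral_congr_ae
    filter_upwards [hD0] with s hs
    simp [hs]
  have hDD : ∫ s, D s * D s ∂P = 0 := by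
    have hZDi : Integrable (fun s => Z s * D s) P :=
      hDi.bdd_mul hZm.aestronglyMeasurable (ae_of_all _ hZb)
    have hZ'Di : Integrable (fun s => Z' s * D s) P :=
      hDi.bdd_mul (hZ'm.mono hm).aestronglyMeasurable hZ'b
    have e1 : ∫ s, D s * D s ∂P = ∫ s, Z s * D s ∂P - ∫ s, Z' s * D s ∂P := by
      rw [← integral_sub hZDi hZ'Di]
      congr 1; ext s; simp [hD]; ring
    -- After Fubini, `D` is tested against each `X r`, which is bounded and `m`-measurable.
    have e2 : ∫ s, Z s * D s ∂P = 0 := by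
      simp only [hZ, ← integral_mul_const]
      rw [integral_integral_swap]
      · rw [show (0:ℝ) = ∫ r in Ioc a b, (0:ℝ) by simp]
        apply setIntegral_congr_fun measurableSet_Ioc
        intro r hr
        exact orth _ (hXm r (Ioc_subset_Icc_self hr)) ⟨K, ae_of_all _ (hK r)⟩
      · have hDp : Integrable (fun z : S × ℝ => D z.1) (P.prod (volume.restrict (Ioc a b))) :=
          hDi.comp_fst _
        refine hDp.bdd_mul (c := K) ?_ (ae_of_all _ fun z => hK _ _)
        exact (hX.comp measurable_swap).aestronglyMeasurable
    rw [e1, e2, orth _ hZ'm ⟨_, hZ'b⟩, sub_zero]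
  have hDDi : Integrable (fun s => D s * D s) P := by
    refine hDi.bdd_mul (c := K * volume.real (Ioc a b) + K * volume.real (Ioc a b)) hDi.1 ?_
    filter_upwards [hZ'b] with s hs
    exact (norm_sub_le _ _).trans (add_le_add (hZb s) hs)
  have hDz := (integral_eq_zero_iff_of_nonneg (fun s => mul_self_nonneg (D s)) hDDi).1 hDD
  refine ⟨Z', hZ'm, ?_⟩
  filter_upwards [hDz] with s hs
  have : D s = 0 := mul_self_eq_zero.1 hs
  simpa [hD, sub_eq_zero] using this

end Mixing


/-! ### Chain rules for Lipschitz primitives and elementary estimates. -/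

section Calculus

/-- The chain rule in integrated form for an indefinite integral of a bounded function. -/
lemma comp_integral_sub {v I φ φ' : ℝ → ℝ} {a b K C : ℝ} {J : Set ℝ} (hab : a ≤ b)
    (hv : IntervalIntegrable v volume a b) (hK : ∀ u ∈ Icc a b, |v u| ≤ K)
    (hI : ∀ x ∈ Icc a b, I x = I a + ∫ u in a..x, v u) (hJ : Convex ℝ J)
    (hIJ : ∀ x ∈ Icc a b, I x ∈ J) (hφ : ∀ y ∈ J, HasDerivAt φ (φ' y) y)
    (hC : ∀ y ∈ J, |φ' y| ≤ C) :
    φ (I b) - φ (I a) = ∫ u in a..b, φ' (I u) * v u := by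
  have hK0 : 0 ≤ K := (abs_nonneg _).trans (hK a (left_mem_Icc.2 hab))
  have hC0 : 0 ≤ C := (abs_nonneg _).trans (hC _ (hIJ a (left_mem_Icc.2 hab)))
  have hsub : ∀ x ∈ Icc a b, IntervalIntegrable v volume a x := fun x hx =>
    hv.mono_set (by rw [uIcc_of_le hx.1, uIcc_of_le hab]; exact Icc_subset_Icc_right hx.2)
  have lipI : LipschitzOnWith K.toNNReal I (Icc a b) := by
    refine LipschitzOnWith.of_dist_le_mul fun x hx y hy => ?_
    rw [Real.dist_eq, Real.dist_eq, Real.coe_toNNReal _ hK0, hI x hx, hI y hy,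
      add_sub_add_left_eq_sub, intervalIntegral.integral_interval_sub_left (hsub x hx) (hsub y hy)]
    refine intervalIntegral.norm_integral_le_of_norm_le_const (E := ℝ) (f := v) (C := K)
      fun u hu => hK u ?_
    rcases le_total y x with h | h
    · rw [uIoc_of_le h] at hu; exact ⟨hy.1.trans hu.1.le, hu.2.trans hx.2⟩
    · rw [uIoc_of_ge h] at hu; exact ⟨hx.1.trans hu.1.le, hu.2.trans hy.2⟩
  have lipφ : LipschitzOnWith C.toNNReal φ J := by
    refine hJ.lipschitzOnWith_of_nnnorm_hasDerivWithin_le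
      (fun y hy => (hφ y hy).hasDerivWithinAt) fun y hy => ?_
    rw [← NNReal.coe_le_coe, coe_nnnorm, Real.coe_toNNReal _ hC0]
    exact hC y hy
  -- Since `v` is merely bounded, `I` is differentiable only almost everywhere; Lipschitz continuity
  -- still gives the fundamental theorem of calculus for `φ ∘ I`.
  have lip : LipschitzOnWith (C.toNNReal * K.toNNReal) (φ ∘ I) (uIcc a b) := by
    rw [uIcc_of_le hab]
    exact lipφ.comp lipI hIJ
  have ftc := lip.absolutelyContinuousOnInterval.integral_deriv_eq_sub
  simp only [Function.comp_apply] at ftc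
  rw [← ftc]
  apply intervalIntegral.integral_congr_ae
  -- The formula for `I` is known only on `[a, b]`, so a two-sided derivative is available in the
  -- interior only.
  have hne : ∀ᵐ x : ℝ, x ≠ b := by simp [ae_iff]
  filter_upwards [hv.ae_hasDerivAt_integral, hne] with x hx hxb hxab
  rw [uIoc_of_le hab] at hxab
  have hx' : x ∈ Icc a b := Ioc_subset_Icc_self hxab
  have d1 := (hx (by rwa [uIcc_of_le hab]) a (by simp)).const_add (I a)
  have d2 : HasDerivAt I (v x) x := by
    refine d1.congr_of_eventuallyEq ?_
    filter_upwards [Ioo_mem_nhds hxab.1 (lt_of_le_of_ne hxab.2 hxb)] with y hy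
    exact hI y (Ioo_subset_Icc_self hy)
  exact ((hφ _ (hIJ x hx')).comp x d2).deriv

/-- `exp (∫ₐᵇ v) - 1 = ∫ₐᵇ exp (∫ₐᵘ v) v(u) du`, with an arbitrary base point. -/
lemma exp_integral_sub_exp {v : ℝ → ℝ} {a b K : ℝ} (o : ℝ) (hv : Measurable v)
    (hK : ∀ u, |v u| ≤ K) (hab : a ≤ b) :
    Real.exp (∫ u in o..b, v u) - Real.exp (∫ u in o..a, v u)
      = ∫ u in a..b, Real.exp (∫ w in o..u, v w) * v u := by
  have hK0 : 0 ≤ K := (abs_nonneg _).trans (hK 0)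
  have hvi : ∀ x y, IntervalIntegrable v volume x y := fun x y =>
    (intervalIntegrable_const (c := K)).mono_fun hv.aestronglyMeasurable (ae_of_all _ fun u => by
      exact (hK u).trans (le_abs_self K))
  -- An upper bound is enough: the exponential is Lipschitz on a left half-line.
  obtain ⟨M, hM⟩ : ∃ M, ∀ x ∈ Icc a b, (∫ u in o..x, v u) ∈ Iic M := by
    have hcont : ContinuousOn (fun x => ∫ u in o..x, v u) (Icc a b) :=
      (intervalIntegral.continuous_primitive hvi o).continuousOn
    obtain ⟨M, hM⟩ := (isCompact_Icc.image_of_continuousOn hcont).bddAbove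
    exact ⟨M, fun x hx => hM ⟨x, hx, rfl⟩⟩
  refine comp_integral_sub (I := fun x => ∫ u in o..x, v u) (φ := Real.exp) (φ' := Real.exp)
    (J := Iic M) (C := Real.exp M) hab (hvi a b) (fun u _ => hK u) (fun x _ => ?_) (convex_Iic M) hM
    (fun y _ => Real.hasDerivAt_exp y) (fun y hy => ?_)
  · exact (intervalIntegral.integral_add_adjacent_intervals (hvi o a) (hvi a x)).symm
  · rw [abs_of_pos (Real.exp_pos y)]; exact Real.exp_le_exp.2 hy

/-- A logarithmic Grönwall estimate for `f(r) = f(0) + ∫₀ʳ h`, with `|h - Q f| ≤ η f`. -/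
lemma abs_log_sub_integral_le {f h Q : ℝ → ℝ} {T η m K : ℝ} (hT : 0 ≤ T) (hm : 0 < m)
    (hfm : ∀ r ∈ Icc 0 T, m ≤ f r) (hf0 : f 0 = 1) (hh : Measurable h)
    (hK : ∀ r ∈ Icc 0 T, |h r| ≤ K) (hf : ∀ r ∈ Icc 0 T, f r = f 0 + ∫ u in (0:ℝ)..r, h u)
    (hfme : Measurable f) (hQ : IntervalIntegrable Q volume 0 T)
    (hQf : ∀ r ∈ Icc 0 T, |h r - f r * Q r| ≤ η * f r) :
    |Real.log (f T) - ∫ r in (0:ℝ)..T, Q r| ≤ η * T := by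
  have hhi : IntervalIntegrable h volume 0 T := by
    refine (intervalIntegrable_const (c := K)).mono_fun hh.aestronglyMeasurable ?_
    rw [uIoc_of_le hT]
    filter_upwards [ae_restrict_mem measurableSet_Ioc] with u hu
    rw [Real.norm_eq_abs, Real.norm_eq_abs]
    exact (hK u (Ioc_subset_Icc_self hu)).trans (le_abs_self _)
  have key := comp_integral_sub (I := f) (φ := Real.log) (φ' := fun y => y⁻¹) (J := Ici m)
    (C := m⁻¹) hT hhi hK hf (convex_Ici m) hfm
    (fun y hy => Real.hasDerivAt_log (hm.trans_le hy).ne') (fun y hy => by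
      have hy' : m ≤ y := hy
      rw [abs_of_nonneg (inv_nonneg.2 (hm.le.trans hy'))]
      gcongr)
  rw [hf0, Real.log_one, sub_zero] at key
  have hwi : IntervalIntegrable (fun u => (f u)⁻¹ * h u) volume 0 T := by
    refine (intervalIntegrable_const (c := m⁻¹ * K)).mono_fun
      (hfme.inv.mul hh).aestronglyMeasurable ?_
    rw [uIoc_of_le hT]
    filter_upwards [ae_restrict_mem measurableSet_Ioc] with u hu
    have hu' := Ioc_subset_Icc_self hu
    rw [Real.norm_eq_abs, Real.norm_eq_abs, abs_mul, abs_inv]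
    refine le_trans ?_ (le_abs_self _)
    have h1 := hfm u hu'
    rw [abs_of_pos (hm.trans_le h1)]
    have := hK u hu'
    gcongr
  rw [key, ← intervalIntegral.integral_sub hwi hQ]
  have := intervalIntegral.norm_integral_le_of_norm_le_const (a := 0) (b := T) (C := η)
    (f := fun u => (f u)⁻¹ * h u - Q u) (fun u hu => by
      rw [uIoc_of_le hT] at hu
      have hu' := Ioc_subset_Icc_self hu
      have hfp : 0 < f u := hm.trans_le (hfm u hu')
      -- The relative error `η f` becomes the absolute error `η` for the logarithm, so the lower
      -- bound `m` drops out of the conclusion.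
      have e : (f u)⁻¹ * h u - Q u = (f u)⁻¹ * (h u - f u * Q u) := by field_simp
      rw [e, norm_mul, Real.norm_eq_abs, abs_of_pos (inv_pos.2 hfp), Real.norm_eq_abs]
      calc (f u)⁻¹ * |h u - f u * Q u| ≤ (f u)⁻¹ * (η * f u) := by
            gcongr; exact hQf u hu'
        _ = η := by field_simp)
  rwa [sub_zero, abs_of_nonneg hT] at this

/-- Measurability of an interval integral with a parameter in the integrand and the endpoints. -/
lemma measurable_intervalIntegral_param {α : Type*} [MeasurableSpace α] {X : ℝ → α → ℝ}
    (hX : Measurable (Function.uncurry X)) {a b : α → ℝ} (ha : Measurable a) (hb : Measurable b) :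
    Measurable fun p => ∫ u in a p..b p, X u p := by
  have aux : ∀ {a b : α → ℝ}, Measurable a → Measurable b →
      Measurable fun p => ∫ u in Ioc (a p) (b p), X u p := by
    intro a b ha hb
    have e : ∀ p, ∫ u in Ioc (a p) (b p), X u p
        = ∫ u, {q : α × ℝ | a q.1 < q.2 ∧ q.2 ≤ b q.1}.indicator (fun q => X q.2 q.1) (p, u) := by
      intro p
      rw [← integral_indicator measurableSet_Ioc]
      rfl
    simp_rw [e]
    refine StronglyMeasurable.measurable (StronglyMeasurable.integral_prod_right' (ν := volume)
      (f := {q : α × ℝ | a q.1 < q.2 ∧ q.2 ≤ b q.1}.indicator (fun q => X q.2 q.1)) ?_)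
    refine ((hX.comp measurable_swap).indicator ?_).stronglyMeasurable
    exact (measurableSet_lt (ha.comp measurable_fst) measurable_snd).inter
      (measurableSet_le measurable_snd (hb.comp measurable_fst))
  exact (aux ha hb).sub (aux hb ha)

/-- An explicit primitive exists. With `e = ε²` the integral is at most `ε²`, which compensates the
prefactor `ε⁻²` of the covariances, uniformly in `ε`. -/
lemma inv_sq_integral {e r a b : ℝ} (he : 0 < e) (hab : a ≤ b) (hbr : b ≤ r) :
    ∫ u in a..b, ((1 + (r - u) / e) ^ 2)⁻¹
      = e * ((1 + (r - b) / e)⁻¹ - (1 + (r - a) / e)⁻¹) := by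
  have hpos : ∀ u ∈ uIcc a b, 0 < 1 + (r - u) / e := fun u hu => by
    rw [uIcc_of_le hab] at hu
    have : 0 ≤ (r - u) / e := div_nonneg (by linarith [hu.2]) he.le
    linarith
  have hd : ∀ u ∈ uIcc a b, HasDerivAt (fun u => e * (1 + (r - u) / e)⁻¹)
      (((1 + (r - u) / e) ^ 2)⁻¹) u := fun u hu => by
    have h1 : HasDerivAt (fun u => 1 + (r - u) / e) (-1 / e) u :=
      (((hasDerivAt_id u).const_sub r).div_const e).const_add 1
    refine ((h1.inv (hpos u hu).ne').const_mul e).congr_deriv ?_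
    have h2 : ∀ w : ℝ, e * (-(-1 / e) / w ^ 2) = (w ^ 2)⁻¹ := fun w => by field_simp
    exact h2 _
  rw [intervalIntegral.integral_eq_sub_of_hasDerivAt hd]
  · ring
  · refine ContinuousOn.intervalIntegrable ?_
    refine ContinuousOn.inv₀ (by fun_prop) fun u hu => (pow_pos (hpos u hu) 2).ne'

/-- Factoring out `exp b` leaves `|e^d - 1| ≤ e^{|d|} - 1`; for negative `d` this is `cosh ≥ 1`. The
factor `exp b` keeps the error relative. -/
lemma abs_exp_sub_exp_le (a b : ℝ) : |Real.exp a - Real.exp b| ≤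
    (Real.exp |a - b| - 1) * Real.exp b := by
  have e : Real.exp a = Real.exp (a - b) * Real.exp b := by rw [← Real.exp_add]; simp
  rw [e, ← sub_one_mul, abs_mul, abs_of_pos (Real.exp_pos b)]
  gcongr
  rw [abs_le]
  constructor
  · have h1 : Real.exp (-|a - b|) ≤ Real.exp (a - b) := Real.exp_le_exp.2 (neg_abs_le _)
    have h2 := Real.add_one_le_exp (-|a-b|)
    have h3 : 2 ≤ Real.exp |a-b| + Real.exp (-|a-b|) := by
      have := Real.one_le_cosh |a - b|
      rw [Real.cosh_eq] at this; linarith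
    linarith
  · have : Real.exp (a - b) ≤ Real.exp |a - b| := Real.exp_le_exp.2 (le_abs_self _)
    linarith

end Calculus


/-! ### The differential equation for the exponential moment of a mixing process. -/

section ExponentialMoment

/-- The error rate in the expansion of the exponential moment of a mixing process. -/
def expErr (K D aL ε L : ℝ) : ℝ :=
  Real.exp (2 * (ε * K * L)) * (ε⁻¹ * aL + L * (K ^ 2 * (Real.exp (ε * K * L) - 1) + aL))
    + D * (Real.exp (2 * (ε * K * L)) - 1) + D / (1 + L)

variable {S : Type*} [mS : MeasurableSpace S] {P : Measure S} [IsProbabilityMeasure P]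

lemma integrable_of_measurable_bdd {S : Type*} [MeasurableSpace S] {P : Measure S}
    [IsFiniteMeasure P] {f : S → ℝ} (hf : Measurable f) {C : ℝ}
    (hC : ∀ s, |f s| ≤ C) : Integrable f P :=
  Integrable.of_bound hf.aestronglyMeasurable C (ae_of_all _ hC)

/-- The rescaled integral `ε⁻¹ ∫₀ʳ ξ`. -/
def scaledInt (ε : ℝ) (ξ : ℝ → S → ℝ) (r : ℝ) (s : S) : ℝ := ε⁻¹ * ∫ u in (0:ℝ)..r, ξ u s

variable {ε K : ℝ} {ξ : ℝ → S → ℝ}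

omit mS in
lemma scaledInt_zero (ε : ℝ) (ξ : ℝ → S → ℝ) (s : S) : scaledInt ε ξ 0 s = 0 := by
  simp [scaledInt]

lemma measurable_scaledInt (hξ : Measurable (Function.uncurry ξ)) :
    Measurable fun p : ℝ × S => scaledInt ε ξ p.1 p.2 := by
  unfold scaledInt
  refine Measurable.const_mul ?_ _
  refine measurable_intervalIntegral_param (X := fun u (p : ℝ × S) => ξ u p.2) ?_
    measurable_const measurable_fst
  exact hξ.comp (measurable_fst.prodMk (measurable_snd.comp measurable_snd))

lemma intervalIntegrable_of_measurable_bdd {v : ℝ → ℝ} (hv : Measurable v)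
    (hK : ∀ u, |v u| ≤ K) (a b : ℝ) : IntervalIntegrable v volume a b :=
  (intervalIntegrable_const (c := K)).mono_fun hv.aestronglyMeasurable (ae_of_all _ fun u =>
    (hK u).trans (le_abs_self K))

lemma abs_scaledInt_sub_le (hε : 0 < ε) (hξ : Measurable (Function.uncurry ξ))
    (hK : ∀ r s, |ξ r s| ≤ K) (r q : ℝ) (s : S) :
    |scaledInt ε ξ r s - scaledInt ε ξ q s| ≤ ε⁻¹ * K * |r - q| := by
  have hi : ∀ a b, IntervalIntegrable (fun u => ξ u s) volume a b := fun a b =>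
    intervalIntegrable_of_measurable_bdd (hξ.comp (measurable_id.prodMk measurable_const)) (hK · s) a b
  unfold scaledInt
  rw [← mul_sub, intervalIntegral.integral_interval_sub_left (hi _ _) (hi _ _), abs_mul,
    abs_of_pos (inv_pos.2 hε), mul_assoc]
  gcongr
  exact intervalIntegral.norm_integral_le_of_norm_le_const (E := ℝ) (f := fun u => ξ u s) (C := K)
      fun u _ => hK u s

lemma abs_scaledInt_le (hε : 0 < ε) (hξ : Measurable (Function.uncurry ξ))
    (hK : ∀ r s, |ξ r s| ≤ K) (r : ℝ) (s : S) :
    |scaledInt ε ξ r s| ≤ ε⁻¹ * K * |r| := by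
  simpa [scaledInt_zero] using abs_scaledInt_sub_le hε hξ hK r 0 s

/-- One expansion step over a window `[p, r]`. Multiplied by another `ε⁻¹ ξ`, it produces the
quadratic term that survives in the limit. -/
lemma exp_scaledInt_sub (hξ : Measurable (Function.uncurry ξ))
    (hK : ∀ r s, |ξ r s| ≤ K) {p r : ℝ} (hpr : p ≤ r) (s : S) :
    Real.exp (scaledInt ε ξ r s) - Real.exp (scaledInt ε ξ p s)
      = ε⁻¹ * ∫ u in p..r, ξ u s * Real.exp (scaledInt ε ξ u s) := by
  have hm : Measurable fun u => ε⁻¹ * ξ u s :=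
    (hξ.comp (measurable_id.prodMk measurable_const)).const_mul _
  have := exp_integral_sub_exp (v := fun u => ε⁻¹ * ξ u s) (a := p) (b := r) (K := |ε⁻¹| * K) 0 hm
    (fun u => by rw [abs_mul]; gcongr; exact hK u s) hpr
  simp only [intervalIntegral.integral_const_mul] at this
  simp only [scaledInt]
  rw [this, ← intervalIntegral.integral_const_mul]
  congr 1; ext u; ring

lemma measurable_exp_scaledInt (hξ : Measurable (Function.uncurry ξ)) (r : ℝ) :
    Measurable fun s => Real.exp (scaledInt ε ξ r s) :=
  Real.measurable_exp.comp ((measurable_scaledInt hξ).comp (measurable_const.prodMk measurable_id))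

lemma exp_scaledInt_le (hε : 0 < ε) (hξ : Measurable (Function.uncurry ξ))
    (hK : ∀ r s, |ξ r s| ≤ K) {r T : ℝ} (hr : |r| ≤ T) (s : S) :
    |Real.exp (scaledInt ε ξ r s)| ≤ Real.exp (ε⁻¹ * K * T) := by
  have hK0 : 0 ≤ K := (abs_nonneg _).trans (hK 0 s)
  rw [abs_of_pos (Real.exp_pos _)]
  apply Real.exp_le_exp.2
  refine (le_abs_self _).trans ((abs_scaledInt_le hε hξ hK r s).trans ?_)
  gcongr

lemma integrable_mul_exp_scaledInt (hε : 0 < ε) (hξ : Measurable (Function.uncurry ξ))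
    (hK : ∀ r s, |ξ r s| ≤ K) (r : ℝ) {G : S → ℝ} (hG : Measurable G) {C : ℝ}
    (hC : ∀ s, |G s| ≤ C) : Integrable (fun s => G s * Real.exp (scaledInt ε ξ r s)) P := by
  refine integrable_of_measurable_bdd (hG.mul (measurable_exp_scaledInt hξ r))
    (C := C * Real.exp (ε⁻¹ * K * |r|)) fun s => ?_
  rw [abs_mul]
  exact mul_le_mul (hC s) (exp_scaledInt_le hε hξ hK le_rfl s) (abs_nonneg _)
    ((abs_nonneg _).trans (hC s))

lemma integrable_exp_scaledInt (hε : 0 < ε) (hξ : Measurable (Function.uncurry ξ))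
    (hK : ∀ r s, |ξ r s| ≤ K) (r : ℝ) :
    Integrable (fun s => Real.exp (scaledInt ε ξ r s)) P := by
  simpa using integrable_mul_exp_scaledInt (P := P) hε hξ hK r (G := fun _ => 1) measurable_const
    (C := 1) (by simp)

/-- Fubini for the expanded exponential. -/
lemma integral_mul_exp_scaledInt_sub (hε : 0 < ε) (hξ : Measurable (Function.uncurry ξ))
    (hK : ∀ r s, |ξ r s| ≤ K) {p r : ℝ} (hp : 0 ≤ p) (hpr : p ≤ r) {G : S → ℝ} (hG : Measurable G)
    {C : ℝ} (hC : ∀ s, |G s| ≤ C) :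
    ∫ s, G s * Real.exp (scaledInt ε ξ r s) ∂P - ∫ s, G s * Real.exp (scaledInt ε ξ p s) ∂P
      = ε⁻¹ * ∫ u in p..r, ∫ s, G s * ξ u s * Real.exp (scaledInt ε ξ u s) ∂P := by
  rw [← integral_sub (integrable_mul_exp_scaledInt hε hξ hK r hG hC)
    (integrable_mul_exp_scaledInt hε hξ hK p hG hC)]
  have hm : Measurable (Function.uncurry fun (u : ℝ) (s : S) =>
      G s * ξ u s * Real.exp (scaledInt ε ξ u s)) :=
    ((hG.comp measurable_snd).mul hξ).mul (Real.measurable_exp.comp (measurable_scaledInt hξ))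
  rw [intervalIntegral_integral_swap]
  · rw [← integral_const_mul]
    congr 1; ext s
    rw [← mul_sub, exp_scaledInt_sub hξ hK hpr, mul_left_comm,
      ← intervalIntegral.integral_const_mul]
    simp only [mul_assoc]
  · rw [uIoc_of_le hpr]
    refine Integrable.of_bound hm.aestronglyMeasurable (C * K * Real.exp (ε⁻¹ * K * r)) ?_
    have h1 : ∀ᵐ z ∂((volume.restrict (Ioc p r)).prod P), z.1 ∈ Ioc p r :=
      (Measure.quasiMeasurePreserving_fst (μ := volume.restrict (Ioc p r)) (ν := P)).ae
        (ae_restrict_mem measurableSet_Ioc)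
    filter_upwards [h1] with z hz
    simp only [Function.uncurry]
    rw [Real.norm_eq_abs, abs_mul, abs_mul]
    have hC0 := (abs_nonneg _).trans (hC z.2)
    have hK0 := (abs_nonneg _).trans (hK z.1 z.2)
    have h2 := exp_scaledInt_le (r := z.1) (T := r) hε hξ hK
      (by rw [abs_of_nonneg (hp.trans hz.1.le)]; exact hz.2) z.2
    exact mul_le_mul (mul_le_mul (hC _) (hK _ _) (abs_nonneg _) hC0) h2 (abs_nonneg _)
      (by positivity)

/-- Comparison of exponential moments at different times. -/
lemma integral_abs_exp_scaledInt_sub_le (hε : 0 < ε) (hξ : Measurable (Function.uncurry ξ))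
    (hK : ∀ r s, |ξ r s| ≤ K) {r q κ : ℝ} (hκ : ε⁻¹ * K * |r - q| ≤ κ) :
    ∫ s, |Real.exp (scaledInt ε ξ r s) - Real.exp (scaledInt ε ξ q s)| ∂P
      ≤ (Real.exp κ - 1) * ∫ s, Real.exp (scaledInt ε ξ q s) ∂P := by
  rw [← integral_const_mul]
  refine integral_mono ((integrable_exp_scaledInt hε hξ hK r).sub
    (integrable_exp_scaledInt hε hξ hK q)).abs
    ((integrable_exp_scaledInt hε hξ hK q).const_mul _) fun s => ?_
  refine (abs_exp_sub_exp_le _ _).trans ?_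
  have := (abs_scaledInt_sub_le hε hξ hK r q s).trans hκ
  gcongr

/-- The exponent changes by at most `κ` for every realization, so exponential moments at nearby
times are comparable. This allows every error to be measured against the moment at the single time
`r`. -/
lemma integral_exp_scaledInt_le (hε : 0 < ε) (hξ : Measurable (Function.uncurry ξ))
    (hK : ∀ r s, |ξ r s| ≤ K) {r q κ : ℝ} (hκ : ε⁻¹ * K * |r - q| ≤ κ) :
    ∫ s, Real.exp (scaledInt ε ξ r s) ∂P ≤ Real.exp κ * ∫ s, Real.exp (scaledInt ε ξ q s) ∂P := by
  rw [← integral_const_mul]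
  refine integral_mono (integrable_exp_scaledInt hε hξ hK r)
    ((integrable_exp_scaledInt hε hξ hK q).const_mul _) fun s => ?_
  have := (le_abs_self _).trans ((abs_scaledInt_sub_le hε hξ hK r q s).trans hκ)
  dsimp only
  rw [← Real.exp_add]
  apply Real.exp_le_exp.2
  linarith

variable {D aL L T : ℝ}

/-- The main estimate: the derivative of the exponential moment of `ε⁻¹ ∫ ξ` is its own multiple
by the integrated covariance, up to a small relative error. -/
lemma abs_deriv_expMoment_sub_le (hε : 0 < ε) (hL : 0 < L) (haL : 0 ≤ aL) (hD : 0 ≤ D)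
    (hξ : Measurable (Function.uncurry ξ)) (hK : ∀ r s, |ξ r s| ≤ K)
    (H0 : ∀ r ∈ Icc 0 T, ∫ s, ξ r s ∂P = 0)
    (H1 : ∀ p ≥ 0, p + ε ^ 2 * L ≤ T →
      |∫ s, ξ (p + ε ^ 2 * L) s * Real.exp (scaledInt ε ξ p s) ∂P|
        ≤ aL * ∫ s, Real.exp (scaledInt ε ξ p s) ∂P)
    (H2 : ∀ p ≥ 0, ∀ r ≤ T, p + ε ^ 2 * L ≤ r →
      |∫ s, ξ r s * ξ (p + ε ^ 2 * L) s * Real.exp (scaledInt ε ξ p s) ∂P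
        - (∫ s, ξ r s * ξ (p + ε ^ 2 * L) s ∂P) * ∫ s, Real.exp (scaledInt ε ξ p s) ∂P|
        ≤ aL * ∫ s, Real.exp (scaledInt ε ξ p s) ∂P)
    (H3 : ∀ u ≥ 0, ∀ r ≤ T, u ≤ r →
      |∫ s, ξ r s * ξ u s ∂P| ≤ D * ((1 + (r - u) / ε ^ 2) ^ 2)⁻¹)
    {r : ℝ} (hr : r ∈ Icc 0 T) :
    |ε⁻¹ * ∫ s, ξ r s * Real.exp (scaledInt ε ξ r s) ∂P
      - (∫ s, Real.exp (scaledInt ε ξ r s) ∂P) * ((ε ^ 2)⁻¹ * ∫ u in (0:ℝ)..r, ∫ s, ξ r s * ξ u s ∂P)|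
      ≤ expErr K D aL ε L * ∫ s, Real.exp (scaledInt ε ξ r s) ∂P := by
  obtain ⟨s₀⟩ : Nonempty S := nonempty_of_isProbabilityMeasure P
  have hK0 : 0 ≤ K := (abs_nonneg _).trans (hK 0 s₀)
  set f : ℝ → ℝ := fun r => ∫ s, Real.exp (scaledInt ε ξ r s) ∂P with hf
  -- `l` is the window in macroscopic time, `L` its length on the time scale of the field, and `κ`
  -- bounds the change of the exponent over one window.
  set l : ℝ := ε ^ 2 * L with hl
  set κ : ℝ := ε * K * L with hκ
  have hl0 : 0 < l := by positivity
  have hκ0 : 0 ≤ κ := by positivity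
  have hκl : ε⁻¹ * K * l = κ := by rw [hl, hκ]; field_simp
  have hf0 : ∀ r, 0 < f r := fun r =>
    integral_exp_pos (integrable_exp_scaledInt hε hξ hK r)
  have fle : ∀ q : ℝ, |q - r| ≤ 2 * l → f q ≤ Real.exp (2 * κ) * f r := fun q hq =>
    integral_exp_scaledInt_le hε hξ hK (by
      calc ε⁻¹ * K * |q - r| ≤ ε⁻¹ * K * (2 * l) := by gcongr
        _ = 2 * κ := by rw [← hκl]; ring)
  have hξm : ∀ r, Measurable (ξ r) := fun r => hξ.comp (measurable_const.prodMk measurable_id)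
  have hξξ : ∀ u s, |ξ r s * ξ u s| ≤ K ^ 2 := fun u s => by
    rw [abs_mul, sq]
    exact mul_le_mul (hK _ _) (hK _ _) (abs_nonneg _) hK0
  -- Near time zero the window is truncated. The exponential at `p = 0` is then `1`, and centering
  -- replaces mixing.
  set p : ℝ := max (r - l) 0 with hp
  have hp0 : 0 ≤ p := le_max_right _ _
  have hpr : p ≤ r := max_le (by linarith) hr.1
  have hrp : r - p ≤ l := by have := le_max_left (r - l) 0; rw [← hp] at this; linarith
  have hbound1 := integral_mul_exp_scaledInt_sub (P := P) hε hξ hK hp0 hpr (hξm r) (hK r)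
  -- the remote past
  have hbound2 : |∫ s, ξ r s * Real.exp (scaledInt ε ξ p s) ∂P| ≤ aL * (Real.exp (2 * κ) * f r) := by
    rcases le_total (r - l) 0 with h | h
    · have hp' : p = 0 := max_eq_right h
      rw [hp']
      simp only [scaledInt_zero, Real.exp_zero, mul_one]
      rw [H0 r hr, abs_zero]
      have := hf0 r
      positivity
    · have hp' : p = r - l := max_eq_left h
      have hr' : r = p + l := by linarith
      have := H1 p hp0 (by rw [← hr']; exact hr.2)
      rw [← hr'] at this
      refine this.trans ?_
      gcongr
      exact fle p (by rw [abs_le]; constructor <;> linarith)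
  -- Three replacements: the exponential at `u` by that at `q`, one window earlier; the mean of the
  -- product by the product of means; and `f q` by `f r`. As `q` lies within two windows of `r`, the
  -- constants contain `2 * κ`.
  have hbound3 : ∀ u ∈ Icc p r,
      |∫ s, ξ r s * ξ u s * Real.exp (scaledInt ε ξ u s) ∂P - f r * ∫ s, ξ r s * ξ u s ∂P|
      ≤ (Real.exp (2 * κ) * (K ^ 2 * (Real.exp κ - 1) + aL)
        + D * ((1 + (r - u) / ε ^ 2) ^ 2)⁻¹ * (Real.exp (2 * κ) - 1)) * f r := by
    intro u hu
    set q : ℝ := max (u - l) 0 with hq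
    have hu0 : 0 ≤ u := hp0.trans hu.1
    have hq0 : 0 ≤ q := le_max_right _ _
    have hqu : q ≤ u := max_le (by linarith) hu0
    have huq : u - q ≤ l := by have := le_max_left (u - l) 0; rw [← hq] at this; linarith
    have hqr : |q - r| ≤ 2 * l := by rw [abs_le]; constructor <;> linarith [hu.1, hu.2]
    have fq := fle q hqr
    have hGm : Measurable fun s => ξ r s * ξ u s := (hξm r).mul (hξm u)
    have b1 : |∫ s, ξ r s * ξ u s * Real.exp (scaledInt ε ξ u s) ∂P
        - ∫ s, ξ r s * ξ u s * Real.exp (scaledInt ε ξ q s) ∂P| ≤ K ^ 2 * ((Real.exp κ - 1) * f q) := by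
      rw [← integral_sub (integrable_mul_exp_scaledInt hε hξ hK u hGm (hξξ u))
        (integrable_mul_exp_scaledInt hε hξ hK q hGm (hξξ u))]
      refine (abs_integral_le_integral_abs).trans ?_
      have b := integral_abs_exp_scaledInt_sub_le (P := P) (r := u) (q := q) (κ := κ) hε hξ hK (by
        rw [← hκl, abs_of_nonneg (by linarith)]; gcongr)
      refine le_trans ?_ (mul_le_mul_of_nonneg_left b (sq_nonneg K))
      rw [← integral_const_mul]
      refine integral_mono ?_ ?_ fun s => ?_
      · exact ((integrable_mul_exp_scaledInt hε hξ hK u hGm (hξξ u)).sub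
          (integrable_mul_exp_scaledInt hε hξ hK q hGm (hξξ u))).abs
      · exact (((integrable_exp_scaledInt hε hξ hK u).sub
          (integrable_exp_scaledInt hε hξ hK q)).abs).const_mul _
      · dsimp only
        rw [← mul_sub, abs_mul]
        gcongr
        exact hξξ u s
    have b2 : |∫ s, ξ r s * ξ u s * Real.exp (scaledInt ε ξ q s) ∂P
        - (∫ s, ξ r s * ξ u s ∂P) * f q| ≤ aL * f q := by
      rcases le_total (u - l) 0 with h | h
      · have hq' : q = 0 := max_eq_right h
        have : f 0 = 1 := by simp [hf, scaledInt_zero]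
        rw [hq', this]
        simp only [scaledInt_zero, Real.exp_zero, mul_one, sub_self, abs_zero]
        exact haL
      · have hq' : q = u - l := max_eq_left h
        have hu' : u = q + l := by linarith
        have := H2 q hq0 r hr.2 (by rw [← hu']; exact hu.2)
        rwa [← hu'] at this
    have b3 : |f q - f r| ≤ (Real.exp (2 * κ) - 1) * f r := by
      simp only [hf]
      rw [← integral_sub (integrable_exp_scaledInt hε hξ hK q) (integrable_exp_scaledInt hε hξ hK r)]
      refine (abs_integral_le_integral_abs).trans ?_
      exact integral_abs_exp_scaledInt_sub_le hε hξ hK (by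
        calc ε⁻¹ * K * |q - r| ≤ ε⁻¹ * K * (2 * l) := by gcongr
        _ = 2 * κ := by rw [← hκl]; ring)
    have b4 := H3 u hu0 r hr.2 hu.2
    set E := ∫ s, ξ r s * ξ u s ∂P
    set X := ∫ s, ξ r s * ξ u s * Real.exp (scaledInt ε ξ u s) ∂P
    set Y := ∫ s, ξ r s * ξ u s * Real.exp (scaledInt ε ξ q s) ∂P
    have hexp : 0 ≤ Real.exp κ - 1 := by have := Real.add_one_le_exp κ; linarith
    have hexp2 : 0 ≤ Real.exp (2 * κ) - 1 := by have := Real.add_one_le_exp (2 * κ); linarith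
    have b5 : |E * (f q - f r)| ≤ D * ((1 + (r - u) / ε ^ 2) ^ 2)⁻¹ * ((Real.exp (2 * κ) - 1) * f r) := by
      rw [abs_mul]
      exact mul_le_mul b4 b3 (abs_nonneg _) ((abs_nonneg _).trans b4)
    have e : X - f r * E = (X - Y) + (Y - E * f q) + E * (f q - f r) := by ring
    rw [e]
    calc _ ≤ |X - Y| + |Y - E * f q| + |E * (f q - f r)| := abs_add_three _ _ _
      _ ≤ K ^ 2 * ((Real.exp κ - 1) * f q) + aL * f q
          + D * ((1 + (r - u) / ε ^ 2) ^ 2)⁻¹ * ((Real.exp (2 * κ) - 1) * f r) := by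
        gcongr
      _ ≤ K ^ 2 * ((Real.exp κ - 1) * (Real.exp (2 * κ) * f r)) + aL * (Real.exp (2 * κ) * f r)
          + D * ((1 + (r - u) / ε ^ 2) ^ 2)⁻¹ * ((Real.exp (2 * κ) - 1) * f r) := by
        gcongr
      _ = _ := by ring
  -- measurability of the integrands
  have m1 : Measurable fun u => ∫ s, ξ r s * ξ u s ∂P := by
    refine StronglyMeasurable.measurable (StronglyMeasurable.integral_prod_right'
      (f := fun z : ℝ × S => ξ r z.2 * ξ z.1 z.2) ?_)
    exact (((hξm r).comp measurable_snd).mul hξ).stronglyMeasurable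
  have m1b : ∀ u, |∫ s, ξ r s * ξ u s ∂P| ≤ K ^ 2 := fun u => by
    have := norm_integral_le_of_norm_le_const (μ := P) (f := fun s => ξ r s * ξ u s) (C := K ^ 2)
      (ae_of_all _ (hξξ u))
    simpa using this
  have i1 : ∀ a b, IntervalIntegrable (fun u => ∫ s, ξ r s * ξ u s ∂P) volume a b :=
    intervalIntegrable_of_measurable_bdd m1 m1b
  have m2 : Measurable fun u => ∫ s, ξ r s * ξ u s * Real.exp (scaledInt ε ξ u s) ∂P := by
    refine StronglyMeasurable.measurable (StronglyMeasurable.integral_prod_right'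
      (f := fun z : ℝ × S => ξ r z.2 * ξ z.1 z.2 * Real.exp (scaledInt ε ξ z.1 z.2)) ?_)
    exact ((((hξm r).comp measurable_snd).mul hξ).mul
      (Real.measurable_exp.comp (measurable_scaledInt hξ))).stronglyMeasurable
  have i2 : IntervalIntegrable (fun u => ∫ s, ξ r s * ξ u s * Real.exp (scaledInt ε ξ u s) ∂P)
      volume p r := by
    refine (intervalIntegrable_const (c := K ^ 2 * Real.exp (ε⁻¹ * K * r))).mono_fun
      m2.aestronglyMeasurable ?_
    rw [uIoc_of_le hpr]
    filter_upwards [ae_restrict_mem measurableSet_Ioc] with u hu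
    rw [Real.norm_of_nonneg (by positivity : 0 ≤ K ^ 2 * Real.exp (ε⁻¹ * K * r))]
    have := norm_integral_le_of_norm_le_const (μ := P)
      (f := fun s => ξ r s * ξ u s * Real.exp (scaledInt ε ξ u s))
      (C := K ^ 2 * Real.exp (ε⁻¹ * K * r)) (ae_of_all _ fun s => by
        rw [norm_mul]
        exact mul_le_mul (hξξ u s) (exp_scaledInt_le hε hξ hK (by
          rw [abs_of_nonneg (hp0.trans hu.1.le)]; exact hu.2) s) (norm_nonneg _) (by positivity))
    simpa using this
  have hfr := hf0 r
  have hε2 : 0 < ε ^ 2 := by positivity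
  have kint : IntervalIntegrable (fun u => ((1 + (r - u) / ε ^ 2) ^ 2)⁻¹) volume p r := by
    refine ContinuousOn.intervalIntegrable (ContinuousOn.inv₀ (by fun_prop) fun u hu => ?_)
    rw [uIcc_of_le hpr] at hu
    have : 0 ≤ (r - u) / ε ^ 2 := div_nonneg (by linarith [hu.2]) hε2.le
    positivity
  -- Of the errors in `hbound3`, the constant ones pick up the window length `ε² L`. The one
  -- carrying the covariance picks up only `ε²`, by the decay in the lag, so no factor `L` appears
  -- there.
  have hbound4 : |(∫ u in p..r, ∫ s, ξ r s * ξ u s * Real.exp (scaledInt ε ξ u s) ∂P)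
      - f r * ∫ u in p..r, ∫ s, ξ r s * ξ u s ∂P|
      ≤ ε ^ 2 * ((L * (Real.exp (2 * κ) * (K ^ 2 * (Real.exp κ - 1) + aL))
        + D * (Real.exp (2 * κ) - 1)) * f r) := by
    rw [← intervalIntegral.integral_const_mul, ← intervalIntegral.integral_sub i2
      ((i1 p r).const_mul _)]
    have hexp : 0 ≤ Real.exp κ - 1 := by have := Real.add_one_le_exp κ; linarith
    have hexp2 : 0 ≤ Real.exp (2 * κ) - 1 := by have := Real.add_one_le_exp (2 * κ); linarith
    have hconst : IntervalIntegrable (fun _ : ℝ =>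
        Real.exp (2 * κ) * (K ^ 2 * (Real.exp κ - 1) + aL) * f r) volume p r :=
      intervalIntegrable_const
    have bnd := intervalIntegral.norm_integral_le_of_norm_le (μ := volume) hpr
      (f := fun u => ∫ s, ξ r s * ξ u s * Real.exp (scaledInt ε ξ u s) ∂P
        - f r * ∫ s, ξ r s * ξ u s ∂P)
      (g := fun u => Real.exp (2 * κ) * (K ^ 2 * (Real.exp κ - 1) + aL) * f r
        + D * (Real.exp (2 * κ) - 1) * f r * ((1 + (r - u) / ε ^ 2) ^ 2)⁻¹)
      (ae_of_all _ fun u hu => by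
        refine (hbound3 u (Ioc_subset_Icc_self hu)).trans (le_of_eq ?_)
        ring)
      (hconst.add (kint.const_mul _))
    refine bnd.trans ?_
    rw [intervalIntegral.integral_add hconst (kint.const_mul _),
      intervalIntegral.integral_const, smul_eq_mul,
      intervalIntegral.integral_const_mul, inv_sq_integral hε2 hpr le_rfl]
    have h1 : 0 ≤ (1 + (r - p) / ε ^ 2)⁻¹ := by
      have : 0 ≤ (r - p) / ε ^ 2 := div_nonneg (by linarith) hε2.le
      positivity
    have h2 : (1 + (r - r) / ε ^ 2)⁻¹ - (1 + (r - p) / ε ^ 2)⁻¹ ≤ 1 := by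
      simp only [sub_self, zero_div, add_zero, inv_one]; linarith
    calc _ ≤ l * (Real.exp (2 * κ) * (K ^ 2 * (Real.exp κ - 1) + aL) * f r)
          + D * (Real.exp (2 * κ) - 1) * f r * (ε ^ 2 * 1) := by gcongr
      _ = _ := by rw [hl]; ring
  -- The full covariance integral starts at `0`; what lies outside the window is the tail of the
  -- inverse square beyond lag `L`.
  have hbound5 : |∫ u in (0:ℝ)..p, ∫ s, ξ r s * ξ u s ∂P| ≤ ε ^ 2 * (D / (1 + L)) := by
    rcases le_total (r - l) 0 with h | h
    · have hp' : p = 0 := max_eq_right h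
      rw [hp', intervalIntegral.integral_same, abs_zero]
      positivity
    · have hp' : p = r - l := max_eq_left h
      have kint' : IntervalIntegrable (fun u => ((1 + (r - u) / ε ^ 2) ^ 2)⁻¹) volume 0 p := by
        refine ContinuousOn.intervalIntegrable (ContinuousOn.inv₀ (by fun_prop) fun u hu => ?_)
        rw [uIcc_of_le hp0] at hu
        have : 0 ≤ (r - u) / ε ^ 2 := div_nonneg (by linarith [hu.2]) hε2.le
        positivity
      have bnd := intervalIntegral.norm_integral_le_of_norm_le (μ := volume) hp0
        (f := fun u => ∫ s, ξ r s * ξ u s ∂P)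
        (g := fun u => D * ((1 + (r - u) / ε ^ 2) ^ 2)⁻¹)
        (ae_of_all _ fun u hu => H3 u hu.1.le r hr.2 (hu.2.trans hpr)) (kint'.const_mul _)
      refine bnd.trans ?_
      rw [intervalIntegral.integral_const_mul, inv_sq_integral hε2 hp0 hpr]
      have h1 : 0 ≤ (1 + (r - 0) / ε ^ 2)⁻¹ := by
        have : 0 ≤ (r - 0) / ε ^ 2 := div_nonneg (by linarith [hr.1]) hε2.le
        positivity
      have h2 : (r - p) / ε ^ 2 = L := by rw [hp', hl]; field_simp; ring
      rw [h2]
      calc D * (ε ^ 2 * ((1 + L)⁻¹ - (1 + (r - 0) / ε ^ 2)⁻¹)) ≤ D * (ε ^ 2 * ((1 + L)⁻¹)) := by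
            gcongr; linarith
        _ = _ := by ring
  rw [sub_eq_iff_eq_add] at hbound1
  rw [hbound1, ← intervalIntegral.integral_add_adjacent_intervals (i1 0 p) (i1 p r)]
  set A := ∫ u in p..r, ∫ s, ξ r s * ξ u s * Real.exp (scaledInt ε ξ u s) ∂P
  set A' := ∫ u in p..r, ∫ s, ξ r s * ξ u s ∂P
  set A0 := ∫ u in (0:ℝ)..p, ∫ s, ξ r s * ξ u s ∂P
  set Z := ∫ s, ξ r s * Real.exp (scaledInt ε ξ p s) ∂P
  -- The three error sources: the remote past, the decoupling inside the window, and the covariance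
  -- outside it.
  have e : ε⁻¹ * (ε⁻¹ * A + Z) - f r * ((ε ^ 2)⁻¹ * (A0 + A'))
      = ε⁻¹ * Z + (ε ^ 2)⁻¹ * (A - f r * A') - f r * ((ε ^ 2)⁻¹ * A0) := by
    field_simp; ring
  change |ε⁻¹ * (ε⁻¹ * A + Z) - f r * ((ε ^ 2)⁻¹ * (A0 + A'))| ≤ expErr K D aL ε L * f r
  rw [e]
  have c1 : |ε⁻¹ * Z| ≤ ε⁻¹ * (aL * (Real.exp (2 * κ) * f r)) := by
    rw [abs_mul, abs_of_pos (inv_pos.2 hε)]; gcongr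
  have c2 : |(ε ^ 2)⁻¹ * (A - f r * A')| ≤ (ε ^ 2)⁻¹ * (ε ^ 2 *
      ((L * (Real.exp (2 * κ) * (K ^ 2 * (Real.exp κ - 1) + aL))
        + D * (Real.exp (2 * κ) - 1)) * f r)) := by
    rw [abs_mul, abs_of_pos (inv_pos.2 hε2)]; gcongr
  have c3 : |f r * ((ε ^ 2)⁻¹ * A0)| ≤ f r * ((ε ^ 2)⁻¹ * (ε ^ 2 * (D / (1 + L)))) := by
    rw [abs_mul, abs_mul, abs_of_pos (inv_pos.2 hε2), abs_of_pos hfr]; gcongr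
  rw [inv_mul_cancel_left₀ hε2.ne'] at c2 c3
  calc _ ≤ |ε⁻¹ * Z| + |(ε ^ 2)⁻¹ * (A - f r * A')| + |f r * ((ε ^ 2)⁻¹ * A0)| := by
        refine (abs_sub _ _).trans ?_
        gcongr
        exact abs_add_le _ _
    _ ≤ _ := add_le_add (add_le_add c1 c2) c3
    _ = _ := by unfold expErr; rw [← hκ]; ring

end ExponentialMoment


/-! ### The log-moment along two fixed paths and the choice of the window. -/

section LogExpMoment

variable {S : Type*} [mS : MeasurableSpace S] {P : Measure S} [IsProbabilityMeasure P]
variable {ε K : ℝ} {ξ : ℝ → S → ℝ} {D aL L T : ℝ}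

/-- The logarithm of the exponential moment is the integrated covariance, up to a small error. -/
lemma abs_log_expMoment_sub_le (hε : 0 < ε) (hL : 0 < L) (haL : 0 ≤ aL) (hD : 0 ≤ D) (hT : 0 ≤ T)
    (hξ : Measurable (Function.uncurry ξ)) (hK : ∀ r s, |ξ r s| ≤ K)
    (H0 : ∀ r ∈ Icc 0 T, ∫ s, ξ r s ∂P = 0)
    (H1 : ∀ p ≥ 0, p + ε ^ 2 * L ≤ T →
      |∫ s, ξ (p + ε ^ 2 * L) s * Real.exp (scaledInt ε ξ p s) ∂P|
        ≤ aL * ∫ s, Real.exp (scaledInt ε ξ p s) ∂P)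
    (H2 : ∀ p ≥ 0, ∀ r ≤ T, p + ε ^ 2 * L ≤ r →
      |∫ s, ξ r s * ξ (p + ε ^ 2 * L) s * Real.exp (scaledInt ε ξ p s) ∂P
        - (∫ s, ξ r s * ξ (p + ε ^ 2 * L) s ∂P) * ∫ s, Real.exp (scaledInt ε ξ p s) ∂P|
        ≤ aL * ∫ s, Real.exp (scaledInt ε ξ p s) ∂P)
    (H3 : ∀ u ≥ 0, ∀ r ≤ T, u ≤ r →
      |∫ s, ξ r s * ξ u s ∂P| ≤ D * ((1 + (r - u) / ε ^ 2) ^ 2)⁻¹) :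
    |Real.log (∫ s, Real.exp (scaledInt ε ξ T s) ∂P)
      - ∫ r in (0:ℝ)..T, (ε ^ 2)⁻¹ * ∫ u in (0:ℝ)..r, ∫ s, ξ r s * ξ u s ∂P|
      ≤ expErr K D aL ε L * T := by
  obtain ⟨s₀⟩ : Nonempty S := nonempty_of_isProbabilityMeasure P
  have hK0 : 0 ≤ K := (abs_nonneg _).trans (hK 0 s₀)
  have hξm : ∀ r, Measurable (ξ r) := fun r => hξ.comp (measurable_const.prodMk measurable_id)
  have mexp : Measurable fun z : ℝ × S => Real.exp (scaledInt ε ξ z.1 z.2) :=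
    Real.measurable_exp.comp (measurable_scaledInt hξ)
  have mE : Measurable fun q : ℝ × ℝ => ∫ s, ξ q.1 s * ξ q.2 s ∂P := by
    refine StronglyMeasurable.measurable (StronglyMeasurable.integral_prod_right'
      (f := fun z : (ℝ × ℝ) × S => ξ z.1.1 z.2 * ξ z.1.2 z.2) ?_)
    refine Measurable.stronglyMeasurable (Measurable.mul ?_ ?_)
    · exact hξ.comp ((measurable_fst.comp measurable_fst).prodMk measurable_snd)
    · exact hξ.comp ((measurable_snd.comp measurable_fst).prodMk measurable_snd)
  have bE : ∀ r u, |∫ s, ξ r s * ξ u s ∂P| ≤ K ^ 2 := fun r u => by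
    have := norm_integral_le_of_norm_le_const (μ := P) (f := fun s => ξ r s * ξ u s) (C := K ^ 2)
      (ae_of_all _ fun s => by
        rw [norm_mul, sq]
        exact mul_le_mul (hK _ _) (hK _ _) (norm_nonneg _) hK0)
    simpa using this
  have hexpK : ∀ r ∈ Icc 0 T, ∀ s, |scaledInt ε ξ r s| ≤ ε⁻¹ * K * T := fun r hr s =>
    (abs_scaledInt_le hε hξ hK r s).trans (by
      rw [abs_of_nonneg hr.1]; have := hr.2; gcongr)
  -- The constants `m` and `K` degenerate as `ε → 0`. This is harmless, since the logarithmic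
  -- estimate needs them to exist but does not contain them.
  refine abs_log_sub_integral_le (f := fun r => ∫ s, Real.exp (scaledInt ε ξ r s) ∂P)
    (h := fun r => ε⁻¹ * ∫ s, ξ r s * Real.exp (scaledInt ε ξ r s) ∂P)
    (m := Real.exp (-(ε⁻¹ * K * T))) (K := ε⁻¹ * (K * Real.exp (ε⁻¹ * K * T)))
    hT (Real.exp_pos _) ?_ ?_ ?_ ?_ ?_ ?_ ?_ ?_
  · intro r hr
    have := integral_mono (μ := P) (integrable_const (Real.exp (-(ε⁻¹ * K * T))))
      (integrable_exp_scaledInt hε hξ hK r) (fun s =>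
        Real.exp_le_exp.2 (neg_le_of_abs_le (hexpK r hr s)))
    simpa using this
  · simp [scaledInt_zero]
  · refine Measurable.const_mul (StronglyMeasurable.measurable
      (StronglyMeasurable.integral_prod_right'
      (f := fun z : ℝ × S => ξ z.1 z.2 * Real.exp (scaledInt ε ξ z.1 z.2)) ?_)) _
    exact (hξ.mul mexp).stronglyMeasurable
  · intro r hr
    rw [abs_mul, abs_of_pos (inv_pos.2 hε)]
    gcongr
    have := norm_integral_le_of_norm_le_const (μ := P)
      (f := fun s => ξ r s * Real.exp (scaledInt ε ξ r s))
      (C := K * Real.exp (ε⁻¹ * K * T)) (ae_of_all _ fun s => by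
        rw [norm_mul]
        exact mul_le_mul (hK _ _) (exp_scaledInt_le hε hξ hK (by
          rw [abs_of_nonneg hr.1]; exact hr.2) s) (norm_nonneg _) hK0)
    simpa using this
  · intro r hr
    have := integral_mul_exp_scaledInt_sub (P := P) hε hξ hK le_rfl hr.1 (G := fun _ => 1)
      measurable_const (C := 1) (by simp)
    simp only [one_mul] at this
    rw [intervalIntegral.integral_const_mul]
    linarith
  · exact StronglyMeasurable.measurable (StronglyMeasurable.integral_prod_right'
      (f := fun z : ℝ × S => Real.exp (scaledInt ε ξ z.1 z.2)) mexp.stronglyMeasurable)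
  · have mQ : Measurable fun r => (ε ^ 2)⁻¹ * ∫ u in (0:ℝ)..r, ∫ s, ξ r s * ξ u s ∂P := by
      refine Measurable.const_mul ?_ _
      exact measurable_intervalIntegral_param (X := fun u r => ∫ s, ξ r s * ξ u s ∂P)
        (mE.comp measurable_swap) measurable_const measurable_id
    refine (intervalIntegrable_const (c := (ε ^ 2)⁻¹ * (K ^ 2 * T))).mono_fun
      mQ.aestronglyMeasurable ?_
    rw [uIoc_of_le hT]
    filter_upwards [ae_restrict_mem measurableSet_Ioc] with r hr
    have hr0 : 0 ≤ r := hr.1.le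
    rw [Real.norm_of_nonneg (by positivity : 0 ≤ (ε ^ 2)⁻¹ * (K ^ 2 * T)), norm_mul,
      Real.norm_of_nonneg (by positivity : 0 ≤ (ε ^ 2)⁻¹)]
    gcongr
    refine (intervalIntegral.norm_integral_le_of_norm_le_const (C := K ^ 2)
      (fun u _ => bE r u)).trans ?_
    rw [sub_zero, abs_of_nonneg hr0]
    have := hr.2
    gcongr
  · intro r hr
    exact abs_deriv_expMoment_sub_le hε hL haL hD hξ hK H0 H1 H2 H3 hr

/-- The window length used for the field with mixing exponent `2 + δ`. -/
def window (δ ε : ℝ) : ℝ := ε⁻¹ ^ (2 + δ / 2)⁻¹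

lemma window_pos {δ ε : ℝ} (hε : 0 < ε) : 0 < window δ ε := by
  unfold window; positivity

/-- With `W` the window, `ε = W^{-(2 + δ/2)}`. The critical quantities are `ε W²`, from replacing
exponentials inside the window, and `ε⁻¹ W^{-(2+δ)}`, from the remote past. The exponent `2 + δ/2`
makes both equal to `W^{-δ/2}`; mixing faster than `r⁻²` is needed exactly here. -/
lemma tendsto_expErr {δ : ℝ} (hδ : 0 < δ) (K D C : ℝ) :
    Tendsto (fun ε => expErr K D (C * (1 + window δ ε) ^ (-(2 + δ))) ε (window δ ε))
      (𝓝[>] 0) (𝓝 0) := by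
  set W := window δ with hW
  have hWt : Tendsto W (𝓝[>] 0) atTop :=
    (tendsto_rpow_atTop (by positivity : 0 < (2 + δ / 2)⁻¹)).comp tendsto_inv_nhdsGT_zero
  have hWinv : ∀ ε > 0, ε⁻¹ = W ε ^ (2 + δ / 2) := fun ε hε => by
    rw [hW, window, ← Real.rpow_mul (by positivity), inv_mul_cancel₀ (by positivity), Real.rpow_one]
  have hWinv' : ∀ ε > 0, ε = W ε ^ (-(2 + δ / 2)) := fun ε hε => by
    rw [Real.rpow_neg (window_pos hε).le, ← hWinv ε hε, inv_inv]
  have hneg : ∀ p > (0:ℝ), Tendsto (fun ε => W ε ^ (-p)) (𝓝[>] 0) (𝓝 0) := fun p hp =>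
    Tendsto.comp (tendsto_rpow_neg_atTop hp) hWt
  have hpow : ∀ ε > 0, ∀ p : ℝ, ε * W ε ^ p = W ε ^ (p - (2 + δ / 2)) := fun ε hε p => by
    nth_rewrite 1 [hWinv' ε hε]
    rw [← Real.rpow_add (window_pos hε)]
    congr 1; ring
  have t2 : Tendsto (fun ε => ε * W ε ^ (2:ℝ)) (𝓝[>] 0) (𝓝 0) := by
    refine (hneg (δ / 2) (by positivity)).congr' ?_
    filter_upwards [self_mem_nhdsWithin] with ε hε
    rw [hpow ε hε]; congr 1; ring
  have t1 : Tendsto (fun ε => ε * W ε) (𝓝[>] 0) (𝓝 0) := by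
    refine (hneg (1 + δ / 2) (by positivity)).congr' ?_
    filter_upwards [self_mem_nhdsWithin] with ε hε
    have := hpow ε hε 1
    rw [Real.rpow_one] at this
    rw [this]; congr 1; ring
  have hle : ∀ ε > 0, (1 + W ε) ^ (-(2 + δ)) ≤ W ε ^ (-(2 + δ)) := fun ε hε =>
    Real.rpow_le_rpow_of_nonpos (window_pos hε) (by linarith) (by linarith)
  have hnn : ∀ ε > 0, 0 ≤ (1 + W ε) ^ (-(2 + δ)) := fun ε hε =>
    Real.rpow_nonneg (by linarith [window_pos (δ := δ) hε]) _
  have t3 : Tendsto (fun ε => ε⁻¹ * (1 + W ε) ^ (-(2 + δ))) (𝓝[>] 0) (𝓝 0) := by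
    refine squeeze_zero' ?_ ?_ (hneg (δ / 2) (by positivity))
    · filter_upwards [self_mem_nhdsWithin] with ε hε
      exact mul_nonneg (inv_nonneg.2 (le_of_lt hε)) (hnn ε hε)
    · filter_upwards [self_mem_nhdsWithin] with ε hε
      have hw := window_pos (δ := δ) hε
      calc ε⁻¹ * (1 + W ε) ^ (-(2 + δ)) ≤ W ε ^ (2 + δ / 2) * W ε ^ (-(2 + δ)) := by
            rw [hWinv ε hε]; exact mul_le_mul_of_nonneg_left (hle ε hε) (by positivity)
        _ = _ := by rw [← Real.rpow_add hw]; congr 1; ring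
  have t4 : Tendsto (fun ε => W ε * (1 + W ε) ^ (-(2 + δ))) (𝓝[>] 0) (𝓝 0) := by
    refine squeeze_zero' ?_ ?_ (hneg (1 + δ) (by positivity))
    · filter_upwards [self_mem_nhdsWithin] with ε hε
      exact mul_nonneg (window_pos hε).le (hnn ε hε)
    · filter_upwards [self_mem_nhdsWithin] with ε hε
      have hw := window_pos (δ := δ) hε
      calc W ε * (1 + W ε) ^ (-(2 + δ)) ≤ W ε ^ (1:ℝ) * W ε ^ (-(2 + δ)) := by
            rw [Real.rpow_one]; exact mul_le_mul_of_nonneg_left (hle ε hε) hw.le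
        _ = _ := by rw [← Real.rpow_add hw]; congr 1; ring
  have tκ : Tendsto (fun ε => ε * K * W ε) (𝓝[>] 0) (𝓝 0) := by
    simpa [mul_comm, mul_left_comm, mul_assoc] using t1.const_mul K
  have tE : Tendsto (fun ε => Real.exp (2 * (ε * K * W ε))) (𝓝[>] 0) (𝓝 1) := by
    have := (Real.continuous_exp.tendsto (2 * 0)).comp (tκ.const_mul 2)
    rw [mul_zero, Real.exp_zero] at this
    exact this
  -- To first order this is `K ε W²`, which decays more slowly than `ε W`.
  have t5 : Tendsto (fun ε => W ε * (Real.exp (ε * K * W ε) - 1)) (𝓝[>] 0) (𝓝 0) := by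
    refine squeeze_zero_norm' ?_ (by simpa only [mul_zero] using t2.const_mul (2 * |K|))
    have h1 : ∀ᶠ ε in 𝓝[>] (0:ℝ), |ε * K * W ε| ≤ 1 := by
      have := (tendsto_order.1 (tendsto_zero_iff_abs_tendsto_zero _ |>.1 tκ)).2 1 one_pos
      filter_upwards [this] with ε hε using le_of_lt hε
    filter_upwards [self_mem_nhdsWithin, h1] with ε hε h1
    have hε' : 0 < ε := hε
    have hw := window_pos (δ := δ) hε
    have := Real.abs_exp_sub_one_le h1
    rw [norm_mul, Real.norm_of_nonneg hw.le, Real.norm_eq_abs]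
    calc W ε * |Real.exp (ε * K * W ε) - 1| ≤ W ε * (2 * |ε * K * W ε|) := by gcongr
      _ = 2 * |K| * (ε * W ε ^ (2:ℝ)) := by
        rw [abs_mul, abs_mul, abs_of_pos hε', abs_of_pos hw, Real.rpow_two]; ring
  have t6 : Tendsto (fun ε => D / (1 + W ε)) (𝓝[>] 0) (𝓝 0) :=
    (tendsto_const_nhds (x := D)).div_atTop (tendsto_atTop_add_const_left _ 1 hWt)
  have tot := ((tE.mul ((t3.const_mul C).add ((t5.const_mul (K ^ 2)).add (t4.const_mul C)))).add
    ((tE.sub_const 1).const_mul D)).add t6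
  simp only [mul_zero, add_zero, sub_self, mul_zero] at tot
  refine tot.congr fun ε => ?_
  unfold expErr
  ring

/-- For the decay of covariances the surplus `δ` is not needed, and the plain inverse square has an
explicit primitive. -/
lemma rpow_neg_le_inv_sq {x δ : ℝ} (hx : 1 ≤ x) (hδ : 0 < δ) : x ^ (-(2 + δ)) ≤ (x ^ 2)⁻¹ := by
  rw [← Real.rpow_natCast, ← Real.rpow_neg (by linarith)]
  exact Real.rpow_le_rpow_of_exponent_le hx (by push_cast; linarith)

/-- The process seen along two paths. -/
def pathField (c : ℝ≥0 → ℝ → S → ℝ) (τ : ℝ → ℝ≥0) (z₁ z₂ : ℝ → ℝ) (θ₁ θ₂ : ℝ) (r : ℝ) (s : S) : ℝ :=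
  θ₁ * c (τ r) (z₁ r) s + θ₂ * c (τ r) (z₂ r) s

variable {c : ℝ≥0 → ℝ → S → ℝ} {τ : ℝ → ℝ≥0} {z₁ z₂ : ℝ → ℝ} {θ₁ θ₂ : ℝ}

lemma measurable_field_comp (hc : Measurable (fun q : ℝ≥0 × ℝ × S => c q.1 q.2.1 q.2.2))
    {α : Type*} [MeasurableSpace α] {t : α → ℝ≥0} {x : α → ℝ} {s : α → S} (ht : Measurable t)
    (hx : Measurable x) (hs : Measurable s) : Measurable fun a => c (t a) (x a) (s a) :=
  hc.comp (ht.prodMk (hx.prodMk hs))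

lemma measurable_pathField (hc : Measurable (fun q : ℝ≥0 × ℝ × S => c q.1 q.2.1 q.2.2))
    (hτ : Measurable τ) (h₁ : Measurable z₁) (h₂ : Measurable z₂) :
    Measurable (Function.uncurry (pathField c τ z₁ z₂ θ₁ θ₂)) := by
  have a1 := measurable_field_comp hc (hτ.comp (measurable_fst (β := S)))
    (h₁.comp measurable_fst) measurable_snd
  have a2 := measurable_field_comp hc (hτ.comp (measurable_fst (β := S)))
    (h₂.comp measurable_fst) measurable_snd
  exact (a1.const_mul θ₁).add (a2.const_mul θ₂)

omit mS in
lemma abs_pathField_le (hK : ∀ t x s, |c t x s| ≤ K) (hθ₁ : |θ₁| ≤ 1) (hθ₂ : |θ₂| ≤ 1)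
    (r : ℝ) (s : S) : |pathField c τ z₁ z₂ θ₁ θ₂ r s| ≤ 2 * K := by
  unfold pathField
  refine (abs_add_le _ _).trans ?_
  rw [abs_mul, abs_mul]
  have h1 := hK (τ r) (z₁ r) s
  have h2 := hK (τ r) (z₂ r) s
  nlinarith [abs_nonneg (c (τ r) (z₁ r) s), abs_nonneg (c (τ r) (z₂ r) s)]

/-- The points of space-time visited by the two paths at times in `I`. -/
def visited (τ : ℝ → ℝ≥0) (z₁ z₂ : ℝ → ℝ) (I : Set ℝ) : Set (ℝ≥0 × ℝ) :=
  ((fun r => (τ r, z₁ r)) '' I) ∪ ((fun r => (τ r, z₂ r)) '' I)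

omit mS in
lemma measurable_pathField_fieldSigma {I : Set ℝ} {r : ℝ} (hr : r ∈ I) :
    Measurable[fieldSigma c (visited τ z₁ z₂ I)] (pathField c τ z₁ z₂ θ₁ θ₂ r) := by
  have h1 : (τ r, z₁ r) ∈ visited τ z₁ z₂ I := Or.inl ⟨r, hr, rfl⟩
  have h2 : (τ r, z₂ r) ∈ visited τ z₁ z₂ I := Or.inr ⟨r, hr, rfl⟩
  let _ : MeasurableSpace S := fieldSigma c (visited τ z₁ z₂ I)
  exact ((measurable_fieldSigma c h1).const_mul θ₁).add ((measurable_fieldSigma c h2).const_mul θ₂)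

/-- Euclidean distance in space-time dominates the difference in time, so separation in time gives
mixing wherever the paths are. Hence the estimates are uniform in the paths. -/
lemma visited_dist {I J : Set ℝ} {d : ℝ} (h : ∀ r ∈ I, ∀ u ∈ J, d ≤ |(τ r : ℝ) - τ u|) :
    ∀ p ∈ visited τ z₁ z₂ I, ∀ q ∈ visited τ z₁ z₂ J,
      d ≤ √(((p.1 : ℝ) - q.1) ^ 2 + (p.2 - q.2) ^ 2) := by
  have key : ∀ r ∈ I, ∀ u ∈ J, ∀ a b : ℝ, d ≤ √(((τ r : ℝ) - τ u) ^ 2 + (a - b) ^ 2) := by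
    intro r hr u hu a b
    refine (h r hr u hu).trans ?_
    rw [← Real.sqrt_sq_eq_abs]
    exact Real.sqrt_le_sqrt (by nlinarith [sq_nonneg (a - b)])
  rintro p (⟨r, hr, rfl⟩ | ⟨r, hr, rfl⟩) q (⟨u, hu, rfl⟩ | ⟨u, hu, rfl⟩) <;> exact key r hr u hu _ _

/-- The exponential moment of the field along two fixed paths. -/
lemma abs_log_expMoment_pathField_sub_le {C δ : ℝ} (hε : 0 < ε) (hT : 0 ≤ T) (hδ : 0 < δ)
    (hc : Measurable (fun q : ℝ≥0 × ℝ × S => c q.1 q.2.1 q.2.2))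
    (hK : ∀ t x s, |c t x s| ≤ K) (hc0 : ∀ t x, ∫ s, c t x s ∂P = 0)
    (hmix : ∀ r ≥ (0 : ℝ), alphaUM P c r ≤ C * (1 + r) ^ (-(2 + δ)))
    (hτ : Measurable τ) (hτd : ∀ r ∈ Icc 0 T, ∀ u ∈ Icc 0 T, |(τ r : ℝ) - τ u| = |r - u| / ε ^ 2)
    (h₁ : Measurable z₁) (h₂ : Measurable z₂) (hθ₁ : |θ₁| ≤ 1) (hθ₂ : |θ₂| ≤ 1) :
    |Real.log (∫ s, Real.exp (scaledInt ε (pathField c τ z₁ z₂ θ₁ θ₂) T s) ∂P)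
      - ∫ r in (0:ℝ)..T, (ε ^ 2)⁻¹ * ∫ u in (0:ℝ)..r,
        ∫ s, pathField c τ z₁ z₂ θ₁ θ₂ r s * pathField c τ z₁ z₂ θ₁ θ₂ u s ∂P|
      ≤ expErr (2 * K) (8 * K ^ 2 * C) ((4 * K + 8 * K ^ 2) * C * (1 + window δ ε) ^ (-(2 + δ)))
          ε (window δ ε) * T := by
  obtain ⟨s₀⟩ : Nonempty S := nonempty_of_isProbabilityMeasure P
  have hK0 : 0 ≤ K := (abs_nonneg _).trans (hK 0 0 s₀)
  have hC0 : 0 ≤ C := by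
    have := (alphaUM_nonneg (P := P) c 0).trans (hmix 0 le_rfl)
    simpa using this
  have hcm : ∀ t x, Measurable (c t x) := fun t x =>
    measurable_field_comp hc measurable_const measurable_const measurable_id
  have hci : ∀ t x, Integrable (c t x) P := fun t x =>
    integrable_of_measurable_bdd (hcm t x) (hK t x)
  set ξ := pathField c τ z₁ z₂ θ₁ θ₂ with hξdef
  have hξ : Measurable (Function.uncurry ξ) := measurable_pathField hc hτ h₁ h₂
  have hξK : ∀ r s, |ξ r s| ≤ 2 * K := abs_pathField_le hK hθ₁ hθ₂
  have hξm : ∀ r, Measurable (ξ r) := fun r => hξ.comp (measurable_const.prodMk measurable_id)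
  have hξ0 : ∀ r, ∫ s, ξ r s ∂P = 0 := fun r => by
    simp only [hξdef, pathField]
    rw [integral_add ((hci _ _).const_mul _) ((hci _ _).const_mul _), integral_const_mul,
      integral_const_mul, hc0, hc0]
    simp
  have hξi : ∀ r, Integrable (ξ r) P := fun r => integrable_of_measurable_bdd (hξm r) (hξK r)
  set L := window δ ε with hL
  have hLpos : 0 < L := window_pos hε
  have hε2 : 0 < ε ^ 2 := by positivity
  set w := (1 + L) ^ (-(2 + δ)) with hw
  have hw0 : 0 ≤ w := by positivity
  have hα0 := fun r => alphaUM_nonneg (P := P) c r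
  have hαL : alphaUM P c L ≤ C * w := hmix L hLpos.le
  -- the past is measurable
  have past : ∀ p ≥ 0, AEStronglyMeasurable[fieldSigma c (visited τ z₁ z₂ (Icc 0 p))]
      (fun s => Real.exp (scaledInt ε ξ p s)) P := fun p hp => by
    have h1 := aestronglyMeasurable_integral_process (P := P)
      (fieldSigma_le hcm (visited τ z₁ z₂ (Icc 0 p))) hξ hξK hp
      (fun r hr => (measurable_pathField_fieldSigma hr).stronglyMeasurable)
    exact Real.continuous_exp.comp_aestronglyMeasurable (h1.const_mul ε⁻¹)
  -- The clock runs at speed `ε⁻²`, so the macroscopic gap `ε² L` is a gap `L` for the field.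
  have gap : ∀ p ≥ 0, ∀ r ≤ T, ∀ v ∈ Icc (p + ε ^ 2 * L) r, ∀ u ∈ Icc 0 p,
      L ≤ |(τ v : ℝ) - τ u| := by
    intro p hp r hr v hv u hu
    have hl : 0 < ε ^ 2 * L := by positivity
    rw [hτd v ⟨by linarith [hv.1], hv.2.trans hr⟩ u ⟨hu.1, by linarith [hv.1, hv.2, hu.2]⟩,
      le_div_iff₀ hε2, abs_of_nonneg (by linarith [hv.1, hu.2])]
    linarith [hv.1, hu.2]
  have hpast0 : ∀ p, 0 ≤ ∫ s, Real.exp (scaledInt ε ξ p s) ∂P := fun p =>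
    integral_nonneg fun s => (Real.exp_pos _).le
  -- The factor `4K + 8K²` covers both `2 · 2K`, for a single value of `ξ`, and `2 · 4K²`, for a
  -- product of two. The constant `8K²` in front of the covariance decay is `2 · 2K · 2K`.
  refine abs_log_expMoment_sub_le hε hLpos (by positivity) (by positivity) hT hξ hξK
    (fun r _ => hξ0 r) ?_ ?_ ?_
  · intro p hp hpT
    have := abs_integral_mul_sub_le_alphaUM (P := P) hcm
      (visited_dist (z₁ := z₁) (z₂ := z₂) (I := {p + ε ^ 2 * L}) (J := Icc 0 p) (d := L) (τ := τ)
        (by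
          rintro r rfl u hu
          exact gap p hp _ hpT _ ⟨le_rfl, le_rfl⟩ u hu))
      (measurable_pathField_fieldSigma (θ₁ := θ₁) (θ₂ := θ₂) (mem_singleton _)) (hξK _) (past p hp)
      (integrable_exp_scaledInt hε hξ hξK p) (fun s => (Real.exp_pos _).le)
    rw [← hξdef, hξ0, zero_mul, sub_zero] at this
    refine this.trans (mul_le_mul_of_nonneg_right ?_ (hpast0 p))
    nlinarith [mul_nonneg (sq_nonneg K) (mul_nonneg hC0 hw0), mul_le_mul_of_nonneg_left hαL hK0]
  · intro p hp r hr hpr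
    have hG : Measurable[fieldSigma c (visited τ z₁ z₂ (Icc (p + ε ^ 2 * L) r))]
        (fun s => ξ r s * ξ (p + ε ^ 2 * L) s) := by
      let _ : MeasurableSpace S := fieldSigma c (visited τ z₁ z₂ (Icc (p + ε ^ 2 * L) r))
      exact (measurable_pathField_fieldSigma (right_mem_Icc.2 hpr)).mul
        (measurable_pathField_fieldSigma (left_mem_Icc.2 hpr))
    have := abs_integral_mul_sub_le_alphaUM (P := P) hcm
      (visited_dist (z₁ := z₁) (z₂ := z₂) (I := Icc (p + ε ^ 2 * L) r) (J := Icc 0 p) (d := L)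
        (τ := τ) (fun v hv u hu => gap p hp r hr v hv u hu))
      hG (M := 4 * K ^ 2) (fun s => by
        rw [abs_mul]
        have := mul_le_mul (hξK r s) (hξK (p + ε ^ 2 * L) s) (abs_nonneg _) (by positivity)
        linarith) (past p hp)
      (integrable_exp_scaledInt hε hξ hξK p) (fun s => (Real.exp_pos _).le)
    refine this.trans (mul_le_mul_of_nonneg_right ?_ (hpast0 p))
    nlinarith [mul_nonneg hK0 (mul_nonneg hC0 hw0), mul_le_mul_of_nonneg_left hαL (sq_nonneg K)]
  · intro u hu r hr hur
    -- The covariance inequality wants a nonnegative factor. Adding a constant to `ξ u` changes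
    -- nothing, because `ξ r` is centered.
    have hF0 : ∀ s, 0 ≤ ξ u s + 2 * K := fun s => by linarith [(abs_le.1 (hξK u s)).1]
    have hFi : Integrable (fun s => ξ u s + 2 * K) P := (hξi u).add (integrable_const _)
    have hF : Measurable[fieldSigma c (visited τ z₁ z₂ {u})] (fun s => ξ u s + 2 * K) := by
      let _ : MeasurableSpace S := fieldSigma c (visited τ z₁ z₂ {u})
      exact (measurable_pathField_fieldSigma (mem_singleton u)).add_const _
    have hv0 : 0 ≤ (r - u) / ε ^ 2 := div_nonneg (by linarith) hε2.le
    have := abs_integral_mul_sub_le_alphaUM (P := P) hcm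
      (visited_dist (z₁ := z₁) (z₂ := z₂) (I := {r}) (J := {u}) (d := (r - u) / ε ^ 2)
        (τ := τ) (by
          rintro v rfl w rfl
          rw [hτd v ⟨hu.le.trans hur, hr⟩ w ⟨hu, hur.trans hr⟩, abs_of_nonneg (by linarith)]))
      (measurable_pathField_fieldSigma (θ₁ := θ₁) (θ₂ := θ₂) (mem_singleton r)) (hξK r)
      hF.stronglyMeasurable.aestronglyMeasurable hFi hF0
    rw [← hξdef, hξ0, zero_mul, sub_zero] at this
    have e1 : ∫ s, ξ u s + 2 * K ∂P = 2 * K := by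
      rw [integral_add (hξi u) (integrable_const _), hξ0]; simp
    have e2 : ∫ s, ξ r s * (ξ u s + 2 * K) ∂P = ∫ s, ξ r s * ξ u s ∂P := by
      have : ∀ s, ξ r s * (ξ u s + 2 * K) = ξ r s * ξ u s + ξ r s * (2 * K) := fun s => mul_add _ _ _
      simp_rw [this]
      rw [integral_add, integral_mul_const, hξ0, zero_mul, add_zero]
      · exact (hξi u).bdd_mul (hξm r).aestronglyMeasurable (ae_of_all _ (hξK r))
      · exact (hξi r).mul_const _
    rw [e1, e2] at this
    refine this.trans ?_
    have h2 : (1 + (r - u) / ε ^ 2) ^ (-(2 + δ)) ≤ ((1 + (r - u) / ε ^ 2) ^ 2)⁻¹ := by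
      exact rpow_neg_le_inv_sq (by linarith) hδ
    calc 2 * (2 * K) * alphaUM P c ((r - u) / ε ^ 2) * (2 * K)
        = 8 * K ^ 2 * alphaUM P c ((r - u) / ε ^ 2) := by ring
      _ ≤ 8 * K ^ 2 * (C * (1 + (r - u) / ε ^ 2) ^ (-(2 + δ))) := by gcongr; exact hmix _ hv0
      _ ≤ 8 * K ^ 2 * (C * ((1 + (r - u) / ε ^ 2) ^ 2)⁻¹) := by gcongr
      _ = _ := by ring

end LogExpMoment


/-! ### The correlation function: stationarity, measurability and decay. -/

section Correlation

variable {S : Type*} [mS : MeasurableSpace S] {P : Measure S} {c : ℝ≥0 → ℝ → S → ℝ}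

lemma fieldCorrelation_of_nonneg {t x : ℝ} (ht : 0 ≤ t) :
    fieldCorrelation P c t x = ∫ s, c 0 0 s * c t.toNNReal x s ∂P := by
  simp [fieldCorrelation, Real.toNNReal_of_nonpos (neg_nonpos.2 ht)]

/-- The two point function of a stationary field depends on the differences only. -/
lemma integral_mul_eq_fieldCorrelation (hstat : IsStationaryField P c) {t₁ t₂ : ℝ≥0}
    (h : t₁ ≤ t₂) (y z : ℝ) :
    ∫ s, c t₁ y s * c t₂ z s ∂P = fieldCorrelation P c ((t₂ : ℝ) - t₁) (z - y) := by
  rw [fieldCorrelation_of_nonneg (sub_nonneg.2 (NNReal.coe_le_coe.2 h))]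
  have hm : Measurable fun f : ℝ≥0 × ℝ → ℝ => f (0, 0) * f (t₂ - t₁, z - y) :=
    (measurable_pi_apply _).mul (measurable_pi_apply _)
  have := ((hstat t₁ y).comp hm).integral_eq
  simp only [Function.comp_def, zero_add, tsub_add_cancel_of_le h, sub_add_cancel] at this
  rw [this]
  congr 1

lemma measurable_fieldCorrelation [SFinite P]
    (hc : Measurable (fun q : ℝ≥0 × ℝ × S => c q.1 q.2.1 q.2.2)) :
    Measurable fun p : ℝ × ℝ => fieldCorrelation P c p.1 p.2 := by
  refine StronglyMeasurable.measurable (StronglyMeasurable.integral_prod_right'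
      (f := fun z : (ℝ × ℝ) × S => c (-z.1.1).toNNReal 0 z.2 * c z.1.1.toNNReal z.1.2 z.2) ?_)
  refine Measurable.stronglyMeasurable (Measurable.mul ?_ ?_)
  · exact measurable_field_comp hc (by fun_prop) measurable_const measurable_snd
  · exact measurable_field_comp hc (by fun_prop) (by fun_prop) measurable_snd

/-- Mixing between two single points at distance at least `v`, with the nonnegative factor `c 0 0 +
K`. The bound is uniform in `x` and integrable in `v`, so it dominates all lag integrals. -/
lemma abs_fieldCorrelation_le [IsProbabilityMeasure P] {K C δ : ℝ} (hδ : 0 < δ)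
    (hc : Measurable (fun q : ℝ≥0 × ℝ × S => c q.1 q.2.1 q.2.2))
    (hK : ∀ t x s, |c t x s| ≤ K) (hc0 : ∀ t x, ∫ s, c t x s ∂P = 0)
    (hmix : ∀ r ≥ (0 : ℝ), alphaUM P c r ≤ C * (1 + r) ^ (-(2 + δ))) {v : ℝ} (hv : 0 ≤ v) (x : ℝ) :
    |fieldCorrelation P c v x| ≤ 2 * K ^ 2 * C * ((1 + v) ^ 2)⁻¹ := by
  obtain ⟨s₀⟩ : Nonempty S := nonempty_of_isProbabilityMeasure P
  have hC0 : 0 ≤ C := by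
    have := (alphaUM_nonneg (P := P) c 0).trans (hmix 0 le_rfl)
    simpa using this
  have hcm : ∀ t x, Measurable (c t x) := fun t x =>
    measurable_field_comp hc measurable_const measurable_const measurable_id
  have hci : ∀ t x, Integrable (c t x) P := fun t x =>
    integrable_of_measurable_bdd (hcm t x) (hK t x)
  have hF : Measurable[fieldSigma c {((0 : ℝ≥0), (0 : ℝ))}] (fun s => c 0 0 s + K) := by
    let _ : MeasurableSpace S := fieldSigma c {((0 : ℝ≥0), (0 : ℝ))}
    exact (measurable_fieldSigma c (p := (0, 0)) (mem_singleton _)).add_const _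
  have := abs_integral_mul_sub_le_alphaUM (P := P) hcm (r := v) (A₁ := {(v.toNNReal, x)})
    (A₂ := {(0, 0)}) (by
      rintro p rfl q rfl
      refine Real.le_sqrt_of_sq_le ?_
      simp only [NNReal.coe_zero, sub_zero, Real.coe_toNNReal _ hv]
      nlinarith [sq_nonneg x])
    (measurable_fieldSigma c (p := (v.toNNReal, x)) (mem_singleton _)) (hK _ _)
    hF.stronglyMeasurable.aestronglyMeasurable ((hci 0 0).add (integrable_const K))
    (fun s => by linarith [(abs_le.1 (hK 0 0 s)).1])
  simp only [hc0, zero_mul, sub_zero] at this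
  have e1 : ∫ s, c 0 0 s + K ∂P = K := by
    rw [integral_add (hci 0 0) (integrable_const _), hc0]; simp
  have e2 : ∫ s, c v.toNNReal x s * (c 0 0 s + K) ∂P = fieldCorrelation P c v x := by
    rw [fieldCorrelation_of_nonneg hv]
    have : ∀ s, c v.toNNReal x s * (c 0 0 s + K) = c 0 0 s * c v.toNNReal x s + c v.toNNReal x s * K :=
      fun s => by ring
    simp_rw [this]
    rw [integral_add, integral_mul_const, hc0, zero_mul, add_zero]
    · exact (hci _ _).bdd_mul (hcm _ _).aestronglyMeasurable (ae_of_all _ (hK _ _))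
    · exact (hci _ _).mul_const _
  rw [e1, e2] at this
  refine this.trans ?_
  calc 2 * K * alphaUM P c v * K = 2 * K ^ 2 * alphaUM P c v := by ring
    _ ≤ 2 * K ^ 2 * (C * (1 + v) ^ (-(2 + δ))) := by gcongr; exact hmix _ hv
    _ ≤ 2 * K ^ 2 * (C * ((1 + v) ^ 2)⁻¹) := by
      gcongr; exact rpow_neg_le_inv_sq (by linarith) hδ
    _ = _ := by ring

end Correlation

/-! ### Reduction of the integrated covariance to a fixed time lag. -/

section CovarianceLimit

/-- A correlation kernel: measurable, integrable, and summably decaying in time. -/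
structure IsCorrKernel (Ψ : ℝ → ℝ → ℝ) (D : ℝ) : Prop where
  measurable : Measurable (Function.uncurry Ψ)
  bound : ∀ v, 0 ≤ v → ∀ z, |Ψ v z| ≤ D * ((1 + v) ^ 2)⁻¹
  integrable : Integrable (Function.uncurry Ψ)

lemma integrableOn_inv_sq (D : ℝ) : IntegrableOn (fun v : ℝ => D * ((1 + v) ^ 2)⁻¹) (Ioi 0) := by
  refine Integrable.const_mul ?_ D
  have h := integrableOn_add_rpow_Ioi_of_lt (a := -2) (m := 1) (c := 0) (by norm_num) (by norm_num)
  refine h.congr_fun (fun v hv => ?_) measurableSet_Ioi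
  have hv' : (0:ℝ) < v := hv
  dsimp only
  rw [add_comm v 1, Real.rpow_neg (by positivity), Real.rpow_two]

/-- Averaging in the time lag: a pointwise `L¹` limit of the time averages for each lag gives
the `L¹` limit of the integral over all lags. -/
lemma tendsto_integral_abs_lag {Ω : Type*} [MeasurableSpace Ω] {μ : Measure Ω}
    [IsProbabilityMeasure μ] {T : ℝ} (hT : 0 ≤ T) {k m : ℝ → ℝ} {ψ : ℝ → ℝ → ℝ → Ω → ℝ}
    (hk : IntegrableOn k (Ioi 0)) (hm : Measurable m) (hmk : ∀ v ∈ Ioi (0:ℝ), |m v| ≤ k v)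
    (hψ : ∀ ε > 0, Measurable fun p : ℝ × ℝ × Ω => ψ ε p.1 p.2.1 p.2.2)
    (hψk : ∀ ε > 0, ∀ v ∈ Ioi (0:ℝ), ∀ r ω, |ψ ε v r ω| ≤ k v)
    (hlim : ∀ᵐ v ∂(volume.restrict (Ioi (0:ℝ))),
      Tendsto (fun ε => ∫ ω, |(∫ r in (0:ℝ)..T, ψ ε v r ω) - T * m v| ∂μ) (𝓝[>] 0) (𝓝 0)) :
    Tendsto (fun ε => ∫ ω, |(∫ r in (0:ℝ)..T, ∫ v in Ioi (0:ℝ), ψ ε v r ω)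
      - T * ∫ v in Ioi (0:ℝ), m v| ∂μ) (𝓝[>] 0) (𝓝 0) := by
  set lam : Measure ℝ := volume.restrict (Ioi (0:ℝ)) with hlam
  have hk' : Integrable k lam := hk
  have hmi : Integrable m lam := hk'.mono' hm.aestronglyMeasurable
    ((ae_restrict_mem measurableSet_Ioi).mono fun v hv => hmk v hv)
  have mem : ∀ᵐ v ∂lam, v ∈ Ioi (0:ℝ) := ae_restrict_mem measurableSet_Ioi
  -- pointwise domination
  have inner_bd : ∀ ε > 0, ∀ v ∈ Ioi (0:ℝ), ∀ ω,
      |(∫ r in (0:ℝ)..T, ψ ε v r ω) - T * m v| ≤ 2 * T * k v := by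
    intro ε hε v hv ω
    have h1 := intervalIntegral.norm_integral_le_of_norm_le_const (E := ℝ) (a := 0) (b := T)
      (f := fun r => ψ ε v r ω) (C := k v) fun r _ => hψk ε hε v hv r ω
    rw [sub_zero, abs_of_nonneg hT, Real.norm_eq_abs] at h1
    calc _ ≤ |∫ r in (0:ℝ)..T, ψ ε v r ω| + |T * m v| := abs_sub _ _
      _ ≤ k v * T + T * k v := by
        rw [abs_mul, abs_of_nonneg hT]
        gcongr
        exact hmk v hv
      _ = _ := by ring
  have minner : ∀ ε > 0, Measurable fun p : ℝ × Ω => (∫ r in (0:ℝ)..T, ψ ε p.1 r p.2) - T * m p.1 := by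
    intro ε hε
    refine Measurable.sub ?_ ((hm.comp measurable_fst).const_mul T)
    refine measurable_intervalIntegral_param (X := fun r (p : ℝ × Ω) => ψ ε p.1 r p.2) ?_
      measurable_const measurable_const
    exact (hψ ε hε).comp (by fun_prop : Measurable fun q : ℝ × (ℝ × Ω) => (q.2.1, q.1, q.2.2))
  -- Dominated convergence is applied in `v` to the mean error at each lag. The error of the
  -- integral over all lags is at most the integral of these errors.
  have dct : Tendsto (fun ε => ∫ v, ∫ ω, |(∫ r in (0:ℝ)..T, ψ ε v r ω) - T * m v| ∂μ ∂lam)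
      (𝓝[>] 0) (𝓝 (∫ v, 0 ∂lam)) := by
    refine tendsto_integral_filter_of_dominated_convergence (fun v => 2 * T * k v) ?_ ?_
      (hk'.const_mul _) hlim
    · filter_upwards [self_mem_nhdsWithin] with ε hε
      exact (StronglyMeasurable.integral_prod_right'
        (f := fun p : ℝ × Ω => |(∫ r in (0:ℝ)..T, ψ ε p.1 r p.2) - T * m p.1|)
        ((minner ε hε).abs).stronglyMeasurable).aestronglyMeasurable
    · filter_upwards [self_mem_nhdsWithin] with ε hε
      filter_upwards [mem] with v hv
      have := norm_integral_le_of_norm_le_const (μ := μ)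
        (f := fun ω => |(∫ r in (0:ℝ)..T, ψ ε v r ω) - T * m v|) (C := 2 * T * k v)
        (ae_of_all _ fun ω => by rw [Real.norm_eq_abs, abs_abs]; exact inner_bd ε hε v hv ω)
      simpa using this
  rw [integral_zero] at dct
  refine squeeze_zero' ?_ ?_ dct
  · exact Eventually.of_forall fun ε => integral_nonneg fun ω => abs_nonneg _
  filter_upwards [self_mem_nhdsWithin] with ε hε
  have prodbd : Integrable (fun p : ℝ × Ω => (∫ r in (0:ℝ)..T, ψ ε p.1 r p.2) - T * m p.1)
      (lam.prod μ) := by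
    refine Integrable.mono' (g := fun p : ℝ × Ω => 2 * T * k p.1)
      ((hk'.const_mul (2 * T)).comp_fst μ) (minner ε hε).aestronglyMeasurable ?_
    filter_upwards [(Measure.quasiMeasurePreserving_fst (μ := lam) (ν := μ)).ae mem] with p hp
    exact inner_bd ε hε p.1 hp p.2
  rw [integral_integral_swap prodbd.abs]
  have swap : ∀ ω, (∫ r in (0:ℝ)..T, ∫ v, ψ ε v r ω ∂lam) = ∫ v, (∫ r in (0:ℝ)..T, ψ ε v r ω) ∂lam := by
    intro ω
    rw [intervalIntegral_integral_swap]
    rw [uIoc_of_le hT]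
    refine Integrable.mono' (g := fun p : ℝ × ℝ => k p.2) (hk'.comp_snd _) ?_ ?_
    · exact ((hψ ε hε).comp (by fun_prop : Measurable fun q : ℝ × ℝ => (q.2, q.1, ω))).aestronglyMeasurable
    · filter_upwards [(Measure.quasiMeasurePreserving_snd
        (μ := volume.restrict (Ioc 0 T)) (ν := lam)).ae mem] with p hp
      exact hψk ε hε p.2 hp p.1 ω
  refine integral_mono_of_nonneg (ae_of_all _ fun ω => abs_nonneg _) prodbd.abs.integral_prod_right
    (ae_of_all _ fun ω => ?_)
  dsimp only
  rw [swap ω, ← integral_const_mul, ← integral_sub _ (hmi.const_mul T)]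
  · exact abs_integral_le_integral_abs
  · refine Integrable.mono' (hk'.const_mul T) ?_ ?_
    · exact (measurable_intervalIntegral_param (X := fun r v => ψ ε v r ω)
        ((hψ ε hε).comp (by fun_prop : Measurable fun q : ℝ × ℝ => (q.2, q.1, ω)))
        measurable_const measurable_const).aestronglyMeasurable
    · filter_upwards [mem] with v hv
      have h1 := intervalIntegral.norm_integral_le_of_norm_le_const (E := ℝ) (a := 0) (b := T)
        (f := fun r => ψ ε v r ω) (C := k v) fun r _ => hψk ε hε v hv r ω
      rw [sub_zero, abs_of_nonneg hT] at h1
      linarith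

end CovarianceLimit


/-! ### Law of large numbers for rescaled increments of one path. -/

section BrownianAverages

variable {Ω : Type*} [mΩ : MeasurableSpace Ω] {PB : Measure Ω} [IsProbabilityMeasure PB]
  {B : ℝ≥0 → Ω → ℝ} {Ψ : ℝ → ℝ → ℝ} {D : ℝ}

/-- The mean of a correlation kernel along Brownian motion. -/
def kernelMean (PB : Measure Ω) (B : ℝ≥0 → Ω → ℝ) (Ψ : ℝ → ℝ → ℝ) (v : ℝ) : ℝ :=
  ∫ ω, Ψ v (B v.toNNReal ω) ∂PB

/-- The kernel at lag `v` along two Brownian paths in diffusive scaling. -/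
def lagKernel {Ω : Type*} (Ψ : ℝ → ℝ → ℝ) (b b' : ℝ≥0 → Ω → ℝ) (ε v r : ℝ) (ω : Ω) : ℝ :=
  if ε ^ 2 * v < r then Ψ v ((b' r.toNNReal ω - b (r - ε ^ 2 * v).toNNReal ω) / ε) else 0

lemma measurable_lagKernel {Ω : Type*} [MeasurableSpace Ω] {b b' : ℝ≥0 → Ω → ℝ}
    (hΨ : Measurable (Function.uncurry Ψ))
    (hb : Measurable (Function.uncurry b)) (hb' : Measurable (Function.uncurry b')) (ε : ℝ) :
    Measurable fun p : ℝ × ℝ × Ω => lagKernel Ψ b b' ε p.1 p.2.1 p.2.2 := by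
  unfold lagKernel
  refine Measurable.ite (measurableSet_lt (by fun_prop) (by fun_prop)) ?_ measurable_const
  refine hΨ.comp (measurable_fst.prodMk (Measurable.div_const (Measurable.sub ?_ ?_) _))
  · exact hb'.comp (by fun_prop : Measurable fun p : ℝ × ℝ × Ω => (p.2.1.toNNReal, p.2.2))
  · exact hb.comp
      (by fun_prop : Measurable fun p : ℝ × ℝ × Ω => ((p.2.1 - ε ^ 2 * p.1).toNNReal, p.2.2))

lemma abs_lagKernel_le {Ω : Type*} (hΨ : IsCorrKernel Ψ D) (b b' : ℝ≥0 → Ω → ℝ) {ε v : ℝ}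
    (hv : 0 ≤ v) (r : ℝ) (ω : Ω) : |lagKernel Ψ b b' ε v r ω| ≤ D * ((1 + v) ^ 2)⁻¹ := by
  unfold lagKernel
  split_ifs
  · exact hΨ.bound v hv _
  · rw [abs_zero]
    exact (abs_nonneg _).trans (hΨ.bound v hv 0)

lemma abs_kernelMean_le (hΨ : IsCorrKernel Ψ D) {v : ℝ} (hv : 0 ≤ v) :
    |kernelMean PB B Ψ v| ≤ D * ((1 + v) ^ 2)⁻¹ := by
  have := norm_integral_le_of_norm_le_const (μ := PB) (f := fun ω => Ψ v (B v.toNNReal ω))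
    (ae_of_all _ fun ω => hΨ.bound v hv _)
  simpa [kernelMean] using this

lemma measurable_kernelMean (hΨ : Measurable (Function.uncurry Ψ))
    (hBm : Measurable (Function.uncurry B)) : Measurable (kernelMean PB B Ψ) := by
  refine StronglyMeasurable.measurable (StronglyMeasurable.integral_prod_right'
      (f := fun z : ℝ × Ω => Ψ z.1 (B z.1.toNNReal z.2)) ?_)
  refine (hΨ.comp (measurable_fst.prodMk ?_)).stronglyMeasurable
  exact hBm.comp (by fun_prop : Measurable fun z : ℝ × Ω => (z.1.toNNReal, z.2))

/-- Scaled Brownian increments have the law of Brownian motion at the unscaled time. -/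
lemma integral_scaled_increment (hB : IsPreBrownianReal B PB) {ε v r : ℝ} (hε : 0 < ε)
    (hv : 0 ≤ v) (hr : ε ^ 2 * v ≤ r) {f : ℝ → ℝ} (hf : Measurable f) :
    ∫ ω, f ((B r.toNNReal ω - B (r - ε ^ 2 * v).toNNReal ω) / ε) ∂PB
      = ∫ ω, f (B v.toNNReal ω) ∂PB := by
  have h1 := gaussianReal_div_const (hB.hasLaw_sub r.toNNReal (r - ε ^ 2 * v).toNNReal) ε
  have h2 := hB.hasLaw_eval v.toNNReal
  have hεv : 0 ≤ ε ^ 2 * v := by positivity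
  have h1' : HasLaw (fun ω => (B r.toNNReal ω - B (r - ε ^ 2 * v).toNNReal ω) / ε)
      (gaussianReal 0 v.toNNReal) PB := by
    convert h1 using 2
    · rfl
    · rw [zero_div]
    · ext
      change _ = dist ((r.toNNReal : ℝ≥0) : ℝ) ((r - ε ^ 2 * v).toNNReal : ℝ≥0) / ε ^ 2
      rw [Real.coe_toNNReal _ (hεv.trans hr), Real.coe_toNNReal _ hv,
        Real.coe_toNNReal _ (by linarith), Real.dist_eq, sub_sub_cancel, abs_of_nonneg hεv]
      field_simp
  have e1 := h1'.integral_comp (f := f) hf.aestronglyMeasurable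
  have e2 := h2.integral_comp (f := f) hf.aestronglyMeasurable
  exact e1.trans e2.symm

/-- Functions of disjoint Brownian increments are uncorrelated. -/
lemma integral_mul_increment (hB : IsPreBrownianReal B PB) {s₁ s₂ t₁ t₂ : ℝ≥0}
    (hs : s₁ ≤ t₁) (hst : s₂ ≤ t₁) (ht : t₁ ≤ t₂) {f g : ℝ → ℝ} (hf : Measurable f)
    (hg : Measurable g) :
    ∫ ω, f (B t₂ ω - B t₁ ω) * g (B s₂ ω - B s₁ ω) ∂PB
      = (∫ ω, f (B t₂ ω - B t₁ ω) ∂PB) * ∫ ω, g (B s₂ ω - B s₁ ω) ∂PB := by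
  -- The later increment depends on the process restarted at `t₁`, the earlier one on the path up to
  -- `t₁`.
  have h := (hB.indepFun_shift t₁).comp (φ := fun x : ℝ≥0 → ℝ => f (x (t₂ - t₁)))
    (ψ := fun x : Set.Iic t₁ → ℝ => g (x ⟨s₂, hst⟩ - x ⟨s₁, hs⟩))
    (hf.comp (measurable_pi_apply _))
    (hg.comp ((measurable_pi_apply _).sub (measurable_pi_apply _)))
  simp only [Function.comp_def, add_tsub_cancel_of_le ht] at h
  have am := fun t => hB.aemeasurable t
  exact h.integral_fun_mul_eq_mul_integral
    ((hf.comp_aemeasurable ((am _).sub (am _))).aestronglyMeasurable)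
    ((hg.comp_aemeasurable ((am _).sub (am _))).aestronglyMeasurable)

/-- The variance of `|f|` is nonnegative. -/
lemma sq_integral_abs_le {μ : Measure Ω} [IsProbabilityMeasure μ] {f : Ω → ℝ} (hf : MemLp f 2 μ) :
    (∫ ω, |f ω| ∂μ) ^ 2 ≤ ∫ ω, f ω ^ 2 ∂μ := by
  have h := variance_nonneg |f| μ
  rw [variance_eq_sub hf.abs] at h
  simp only [Pi.pow_apply, Pi.abs_apply, sq_abs] at h
  linarith

lemma volume_abs_sub_lt_le (T a r : ℝ) (ha : 0 ≤ a) :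
    volume.real ({r' | |r - r'| < a} ∩ Ioc 0 T) ≤ 2 * a := by
  calc volume.real ({r' | |r - r'| < a} ∩ Ioc 0 T) ≤ volume.real (Icc (r - a) (r + a)) := by
        refine measureReal_mono (fun x hx => ?_) measure_Icc_lt_top.ne
        have := abs_lt.1 (show |r - x| < a from hx.1)
        exact ⟨by linarith, by linarith⟩
    _ = 2 * a := by rw [Real.volume_real_Icc_of_le (by linarith)]; ring

/-- The ergodic average along a single path at a fixed lag. -/
lemma tendsto_lag_diagonal (hB : IsPreBrownianReal B PB) (hBm : Measurable (Function.uncurry B))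
    (hΨ : IsCorrKernel Ψ D) {T : ℝ} (hT : 0 ≤ T) {v : ℝ} (hv : 0 < v) :
    Tendsto (fun ε => ∫ ω, |(∫ r in (0:ℝ)..T, lagKernel Ψ B B ε v r ω)
      - T * kernelMean PB B Ψ v| ∂PB) (𝓝[>] 0) (𝓝 0) := by
  set m := kernelMean PB B Ψ v with hm
  set k := D * ((1 + v) ^ 2)⁻¹ with hk
  have hmk : |m| ≤ k := abs_kernelMean_le hΨ hv.le
  have hk0 : 0 ≤ k := (abs_nonneg _).trans hmk
  have hΨv : Measurable (Ψ v) := hΨ.measurable.comp (measurable_const.prodMk measurable_id)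
  -- an explicit bound
  have bound : ∀ ε > 0, ∫ ω, |(∫ r in (0:ℝ)..T, lagKernel Ψ B B ε v r ω) - T * m| ∂PB
      ≤ √(T * (2 * (ε ^ 2 * v)) * (2 * k) ^ 2) + k * (ε ^ 2 * v) := by
    intro ε hε
    have hεv : 0 < ε ^ 2 * v := by positivity
    -- The centered integrand, set to zero on the initial stretch `r ≤ ε² v`, where no full
    -- increment of length `ε² v` is available.
    set h : ℝ → Ω → ℝ := fun r ω => if ε ^ 2 * v < r then lagKernel Ψ B B ε v r ω - m else 0 with hh
    have mlag : Measurable fun p : ℝ × Ω => lagKernel Ψ B B ε v p.1 p.2 :=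
      (measurable_lagKernel hΨ.measurable hBm hBm ε).comp (measurable_const.prodMk measurable_id)
    have mh : Measurable (Function.uncurry h) := by
      refine Measurable.ite (measurableSet_lt measurable_const measurable_fst) ?_ measurable_const
      exact mlag.sub_const m
    have hh2 : ∀ r ω, |h r ω| ≤ 2 * k := by
      intro r ω
      simp only [hh]
      split_ifs
      · calc _ ≤ |lagKernel Ψ B B ε v r ω| + |m| := abs_sub _ _
          _ ≤ k + k := add_le_add (abs_lagKernel_le hΨ B B hv.le r ω) hmk
          _ = _ := by ring
      · rw [abs_zero]; positivity
    have hform : ∀ r, ε ^ 2 * v < r → ∀ ω,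
        h r ω = (fun y => Ψ v (y / ε) - m) (B r.toNNReal ω - B (r - ε ^ 2 * v).toNNReal ω) := by
      intro r hr ω
      simp only [hh, lagKernel, if_pos hr]
    have mF : Measurable fun y => Ψ v (y / ε) - m :=
      (hΨv.comp (measurable_id.div_const ε)).sub_const m
    have hzero : ∀ r, ∫ ω, h r ω ∂PB = 0 := by
      intro r
      by_cases hr : ε ^ 2 * v < r
      · simp only [hform r hr]
        have hi : Integrable (fun ω => Ψ v ((B r.toNNReal ω - B (r - ε ^ 2 * v).toNNReal ω) / ε)) PB := by
          refine integrable_of_measurable_bdd ?_ (C := k) fun ω => hΨ.bound v hv.le _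
          refine hΨv.comp (Measurable.div_const (Measurable.sub ?_ ?_) _)
          · exact hBm.comp (measurable_const.prodMk measurable_id)
          · exact hBm.comp (measurable_const.prodMk measurable_id)
        rw [integral_sub hi (integrable_const _), integral_scaled_increment hB hε hv.le hr.le hΨv]
        simp [hm, kernelMean]
      · simp only [hh, if_neg hr, integral_zero]
    -- The increments over `[r - ε²v, r]` and `[r' - ε²v, r']` do not overlap.
    have huncorr : ∀ r r', ε ^ 2 * v ≤ r' - r → ∫ ω, h r' ω * h r ω ∂PB = 0 := by
      intro r r' hrr
      by_cases hr : ε ^ 2 * v < r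
      · have hr' : ε ^ 2 * v < r' := by linarith
        simp only [hform r hr, hform r' hr']
        rw [integral_mul_increment hB (f := fun y => Ψ v (y / ε) - m) (g := fun y => Ψ v (y / ε) - m)
          (Real.toNNReal_le_toNNReal (by linarith)) (Real.toNNReal_le_toNNReal (by linarith))
          (Real.toNNReal_le_toNNReal (by linarith)) mF mF]
        have := hzero r
        simp only [hform r hr] at this
        rw [this, mul_zero]
      · simp only [hh, if_neg hr, mul_zero, integral_zero]
    have hcov : ∀ r r', |∫ ω, h r ω * h r' ω ∂PB| ≤
        {r' | |r - r'| < ε ^ 2 * v}.indicator (fun _ => (2 * k) ^ 2) r' := by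
      intro r r'
      by_cases hr : |r - r'| < ε ^ 2 * v
      · rw [indicator_of_mem (by exact hr)]
        have := norm_integral_le_of_norm_le_const (μ := PB) (f := fun ω => h r ω * h r' ω)
          (C := (2 * k) ^ 2) (ae_of_all _ fun ω => by
            rw [norm_mul, sq]
            exact mul_le_mul (hh2 _ _) (hh2 _ _) (norm_nonneg _) (by positivity))
        simpa using this
      · rw [indicator_of_notMem (by exact hr)]
        rw [not_lt] at hr
        rcases le_abs.1 hr with h1 | h1
        · rw [huncorr r' r h1, abs_zero]
        · simp_rw [mul_comm (h r _)]
          rw [huncorr r r' (by linarith), abs_zero]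
    set Z : Ω → ℝ := fun ω => ∫ r in (0:ℝ)..T, h r ω with hZ
    have mZ : Measurable Z := measurable_intervalIntegral_param mh measurable_const measurable_const
    have bZ : ∀ ω, |Z ω| ≤ 2 * k * T := fun ω => by
      have h1 := intervalIntegral.norm_integral_le_of_norm_le_const (E := ℝ) (a := 0) (b := T)
        (f := fun r => h r ω) (C := 2 * k) fun r _ => hh2 r ω
      rwa [sub_zero, abs_of_nonneg hT] at h1
    -- The double integral of the covariance is carried by the band `|r - r'| < ε²v`, whose sections
    -- have length at most `2ε²v`.
    have Zsq : ∫ ω, Z ω ^ 2 ∂PB ≤ T * (2 * (ε ^ 2 * v)) * (2 * k) ^ 2 := by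
      have e1 : ∀ ω, Z ω ^ 2 = ∫ r in (0:ℝ)..T, ∫ r' in (0:ℝ)..T, h r ω * h r' ω := fun ω => by
        simp only [intervalIntegral.integral_const_mul, intervalIntegral.integral_mul_const, sq, hZ]
      have : IsFiniteMeasure (volume.restrict (uIoc 0 T)) := by rw [uIoc_of_le hT]; infer_instance
      have i3 : ∀ r, Integrable (Function.uncurry fun (r' : ℝ) ω => h r ω * h r' ω)
          ((volume.restrict (uIoc 0 T)).prod PB) := fun r => by
        refine Integrable.of_bound (C := (2 * k) ^ 2) (Measurable.aestronglyMeasurable ?_)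
          (ae_of_all _ fun p => ?_)
        · exact (mh.comp (measurable_const.prodMk measurable_snd)).mul mh
        · simp only [Function.uncurry]
          rw [norm_mul, sq]
          exact mul_le_mul (hh2 _ _) (hh2 _ _) (norm_nonneg _) (by positivity)
      have e2 : ∫ ω, Z ω ^ 2 ∂PB
          = ∫ r in (0:ℝ)..T, ∫ r' in (0:ℝ)..T, ∫ ω, h r ω * h r' ω ∂PB := by
        simp_rw [e1]
        rw [← intervalIntegral_integral_swap]
        · congr 1; ext r
          rw [intervalIntegral_integral_swap (i3 r)]
        · refine Integrable.of_bound (C := 2 * k * (2 * k * T)) (Measurable.aestronglyMeasurable ?_)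
            (ae_of_all _ fun p => ?_)
          · simp only [Function.uncurry_def, intervalIntegral.integral_const_mul]
            exact mh.mul (mZ.comp measurable_snd)
          · simp only [Function.uncurry_def, intervalIntegral.integral_const_mul]
            rw [norm_mul]
            exact mul_le_mul (hh2 _ _) (bZ _) (norm_nonneg _) (by positivity)
      rw [e2]
      have e3 : ∀ r, ‖∫ r' in (0:ℝ)..T, ∫ ω, h r ω * h r' ω ∂PB‖ ≤ 2 * (ε ^ 2 * v) * (2 * k) ^ 2 := by
        intro r
        have mset : MeasurableSet {r' : ℝ | |r - r'| < ε ^ 2 * v} :=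
          measurableSet_lt (by fun_prop) measurable_const
        rw [intervalIntegral.integral_of_le hT]
        refine (norm_integral_le_of_norm_le (g := {r' | |r - r'| < ε ^ 2 * v}.indicator
          (fun _ => (2 * k) ^ 2)) ((integrable_const _).indicator mset)
          (ae_of_all _ fun r' => hcov r r')).trans ?_
        rw [integral_indicator mset, setIntegral_const, smul_eq_mul, measureReal_restrict_apply mset]
        have := volume_abs_sub_lt_le T (ε ^ 2 * v) r hεv.le
        gcongr
      have := intervalIntegral.norm_integral_le_of_norm_le_const (a := 0) (b := T)
        (f := fun r => ∫ r' in (0:ℝ)..T, ∫ ω, h r ω * h r' ω ∂PB) (fun r _ => e3 r)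
      rw [sub_zero, abs_of_nonneg hT] at this
      calc _ ≤ _ := le_abs_self _
        _ ≤ _ := this
        _ = _ := by ring
    have hpt : ∀ ω, |(∫ r in (0:ℝ)..T, lagKernel Ψ B B ε v r ω) - T * m| ≤ |Z ω| + k * (ε ^ 2 * v) := by
      intro ω
      have il : IntervalIntegrable (fun r => lagKernel Ψ B B ε v r ω) volume 0 T :=
        intervalIntegrable_of_measurable_bdd (mlag.comp (measurable_id.prodMk measurable_const))
          (fun r => abs_lagKernel_le hΨ B B hv.le r ω) _ _
      have ih : IntervalIntegrable (fun r => h r ω) volume 0 T :=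
        intervalIntegrable_of_measurable_bdd (mh.comp (measurable_id.prodMk measurable_const))
          (fun r => hh2 r ω) _ _
      -- On the initial stretch the kernel vanishes but its mean `m` has been subtracted; this costs
      -- at most `k ε² v`.
      have e1 : (∫ r in (0:ℝ)..T, lagKernel Ψ B B ε v r ω) - T * m - Z ω
          = ∫ r in (0:ℝ)..T, (Iic (ε ^ 2 * v)).indicator (fun _ => -m) r := by
        have : T * m = ∫ r in (0:ℝ)..T, m := by simp
        rw [this, hZ, ← intervalIntegral.integral_sub il intervalIntegrable_const,
          ← intervalIntegral.integral_sub (il.sub intervalIntegrable_const) ih]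
        congr 1; ext r
        simp only [hh]
        by_cases hr : ε ^ 2 * v < r
        · rw [if_pos hr, indicator_of_notMem (by simpa using hr)]; ring
        · rw [if_neg hr, indicator_of_mem (by simpa using hr), lagKernel, if_neg hr]; ring
      have e2 : |∫ r in (0:ℝ)..T, (Iic (ε ^ 2 * v)).indicator (fun _ => -m) r| ≤ k * (ε ^ 2 * v) := by
        rw [intervalIntegral.integral_of_le hT, integral_indicator measurableSet_Iic,
          setIntegral_const, smul_eq_mul, abs_mul, abs_neg, measureReal_restrict_apply measurableSet_Iic,
          abs_of_nonneg measureReal_nonneg, mul_comm]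
        have : volume.real (Iic (ε ^ 2 * v) ∩ Ioc 0 T) ≤ ε ^ 2 * v := by
          calc _ ≤ volume.real (Icc 0 (ε ^ 2 * v)) :=
                measureReal_mono (fun x hx => ⟨hx.2.1.le, hx.1⟩) measure_Icc_lt_top.ne
            _ = _ := by rw [Real.volume_real_Icc_of_le hεv.le, sub_zero]
        gcongr
      have : (∫ r in (0:ℝ)..T, lagKernel Ψ B B ε v r ω) - T * m
          = Z ω + ((∫ r in (0:ℝ)..T, lagKernel Ψ B B ε v r ω) - T * m - Z ω) := by ring
      rw [this]
      refine (abs_add_le _ _).trans ?_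
      rw [e1]
      gcongr
    have iZ : Integrable Z PB := integrable_of_measurable_bdd mZ bZ
    have Z2 : MemLp Z 2 PB := MemLp.of_bound mZ.aestronglyMeasurable _ (ae_of_all _ bZ)
    calc ∫ ω, |(∫ r in (0:ℝ)..T, lagKernel Ψ B B ε v r ω) - T * m| ∂PB
        ≤ ∫ ω, (|Z ω| + k * (ε ^ 2 * v)) ∂PB :=
          integral_mono_of_nonneg (ae_of_all _ fun _ => abs_nonneg _)
            (iZ.abs.add (integrable_const _)) (ae_of_all _ hpt)
      _ = ∫ ω, |Z ω| ∂PB + k * (ε ^ 2 * v) := by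
          rw [integral_add iZ.abs (integrable_const _)]; simp
      _ ≤ _ := by
          gcongr
          exact Real.le_sqrt_of_sq_le ((sq_integral_abs_le Z2).trans Zsq)
  refine squeeze_zero' (Eventually.of_forall fun ε => integral_nonneg fun ω => abs_nonneg _)
    (eventually_mem_nhdsWithin.mono bound) ?_
  have : Continuous fun ε : ℝ => √(T * (2 * (ε ^ 2 * v)) * (2 * k) ^ 2) + k * (ε ^ 2 * v) := by
    fun_prop
  have h0 := this.tendsto 0
  simp only [ne_eq, OfNat.ofNat_ne_zero, not_false_eq_true, zero_pow, zero_mul, mul_zero,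
    Real.sqrt_zero, add_zero] at h0
  exact h0.mono_left nhdsWithin_le_nhds

end BrownianAverages


/-! ### Negligibility of covariances between two independent paths. -/

section BrownianCross

variable {Ω : Type*} [mΩ : MeasurableSpace Ω] {PB : Measure Ω} [IsProbabilityMeasure PB]
  {B : ℝ≥0 → Ω → ℝ} {Ψ : ℝ → ℝ → ℝ} {D : ℝ}

lemma gaussianPDFReal_le (m : ℝ) (v : ℝ≥0) (x : ℝ) :
    gaussianPDFReal m v x ≤ (√(2 * Real.pi * v))⁻¹ := by
  rw [gaussianPDFReal_def]
  refine mul_le_of_le_one_right (by positivity) ?_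
  rw [Real.exp_le_one_iff, neg_div]
  have : 0 ≤ (x - m) ^ 2 / (2 * (v : ℝ)) := by positivity
  linarith

/-- The expectation of a function of Brownian motion as an integral against the heat kernel. -/
lemma integral_comp_brownian (hB : IsPreBrownianReal B PB) {t : ℝ≥0} (ht : t ≠ 0) (x : ℝ)
    {f : ℝ → ℝ} (hf : Measurable f) :
    ∫ ω, f (x + B t ω) ∂PB = ∫ y, gaussianPDFReal x t y * f y := by
  have h := gaussianReal_const_add (hB.hasLaw_eval t) x
  rw [zero_add] at h
  have := h.integral_comp (f := f) hf.aestronglyMeasurable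
  simp only [Function.comp_def] at this
  rw [this, integral_gaussianReal_eq_integral_smul ht]
  simp only [smul_eq_mul]

/-- Brownian expectations of rescaled integrable functions are small. -/
lemma integral_abs_comp_brownian_le (hB : IsPreBrownianReal B PB) {t : ℝ≥0} (ht : t ≠ 0) {ε : ℝ}
    (hε : 0 < ε) (a : ℝ) {f : ℝ → ℝ} (hf : Measurable f) (hfi : Integrable f) :
    ∫ ω, |f ((B t ω - a) / ε)| ∂PB ≤ ε * ((√(2 * Real.pi * t))⁻¹ * ∫ z, |f z|) := by
  have e := integral_comp_brownian hB ht (-a) (f := fun y => |f (y / ε)|)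
    (hf.comp (measurable_id.div_const ε)).abs
  have e0 : ∫ ω, |f ((B t ω - a) / ε)| ∂PB = ∫ ω, |f ((-a + B t ω) / ε)| ∂PB := by
    congr 1; ext ω; ring_nf
  have hfe : Integrable fun y => |f (y / ε)| := (hfi.comp_div hε.ne').abs
  rw [e0, e]
  calc ∫ y, gaussianPDFReal (-a) t y * |f (y / ε)|
      ≤ ∫ y, (√(2 * Real.pi * t))⁻¹ * |f (y / ε)| := by
        refine integral_mono_of_nonneg (ae_of_all _ fun y =>
          mul_nonneg (gaussianPDFReal_nonneg _ _ _) (abs_nonneg _)) (hfe.const_mul _)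
          (ae_of_all _ fun y => ?_)
        exact mul_le_mul_of_nonneg_right (gaussianPDFReal_le _ _ _) (abs_nonneg _)
    _ = _ := by
        rw [integral_const_mul, Measure.integral_comp_div (fun z => |f z|), smul_eq_mul,
          abs_of_pos hε]
        ring

/-- The mixed average along two independent paths at a fixed lag is negligible. -/
lemma tendsto_lag_cross (hB : IsPreBrownianReal B PB) (hBm : Measurable (Function.uncurry B))
    (hΨ : IsCorrKernel Ψ D) {T : ℝ} (hT : 0 ≤ T) {v : ℝ} (hv : 0 < v) (hΨv : Integrable (Ψ v)) :
    Tendsto (fun ε => ∫ ω, |(∫ r in (0:ℝ)..T,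
      lagKernel Ψ (fun t (ω : Ω × Ω) => B t ω.1) (fun t (ω : Ω × Ω) => B t ω.2) ε v r ω)
      - T * 0| ∂(PB.prod PB)) (𝓝[>] 0) (𝓝 0) := by
  set b : ℝ≥0 → Ω × Ω → ℝ := fun t ω => B t ω.1 with hb
  set b' : ℝ≥0 → Ω × Ω → ℝ := fun t ω => B t ω.2 with hb'
  have mb : Measurable (Function.uncurry b) :=
    hBm.comp (by fun_prop : Measurable fun p : ℝ≥0 × (Ω × Ω) => (p.1, p.2.1))
  have mb' : Measurable (Function.uncurry b') :=
    hBm.comp (by fun_prop : Measurable fun p : ℝ≥0 × (Ω × Ω) => (p.1, p.2.2))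
  set k := D * ((1 + v) ^ 2)⁻¹ with hk
  have mΨv : Measurable (Ψ v) := hΨ.measurable.comp (measurable_const.prodMk measurable_id)
  have mlag : ∀ ε, Measurable fun p : ℝ × (Ω × Ω) => lagKernel Ψ b b' ε v p.1 p.2 := fun ε =>
    (measurable_lagKernel hΨ.measurable mb mb' ε).comp (measurable_const.prodMk measurable_id)
  have blag : ∀ ε r ω, |lagKernel Ψ b b' ε v r ω| ≤ k := fun ε r ω =>
    abs_lagKernel_le hΨ b b' hv.le r ω
  have hfin : IsFiniteMeasure (volume.restrict (uIoc 0 T)) := by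
    rw [uIoc_of_le hT]; infer_instance
  -- For fixed `r > 0`, given the first path, the second has density at most `(2πr)^{-1/2}` at time
  -- `r`, and rescaling `Ψ v` gains a factor `ε`. Taking limits pointwise in `r` under the constant
  -- bound `k` avoids the singularity at `r = 0`.
  have dct : Tendsto (fun ε => ∫ r in (0:ℝ)..T, ∫ ω, |lagKernel Ψ b b' ε v r ω| ∂(PB.prod PB))
      (𝓝[>] 0) (𝓝 (∫ r in (0:ℝ)..T, 0)) := by
    refine intervalIntegral.tendsto_integral_filter_of_dominated_convergence (fun _ => k) ?_ ?_ ?_ ?_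
    · refine Eventually.of_forall fun ε => ?_
      exact (StronglyMeasurable.integral_prod_right'
        (f := fun p : ℝ × (Ω × Ω) => |lagKernel Ψ b b' ε v p.1 p.2|)
        (mlag ε).abs.stronglyMeasurable).aestronglyMeasurable
    · refine Eventually.of_forall fun ε => ae_of_all _ fun r _ => ?_
      have := norm_integral_le_of_norm_le_const (μ := PB.prod PB)
        (f := fun ω => |lagKernel Ψ b b' ε v r ω|) (C := k)
        (ae_of_all _ fun ω => by rw [Real.norm_eq_abs, abs_abs]; exact blag ε r ω)
      simpa using this
    · exact intervalIntegrable_const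
    · refine ae_of_all _ fun r hr => ?_
      rw [uIoc_of_le hT] at hr
      have hr0 : r.toNNReal ≠ 0 := by simpa using hr.1
      have bound : ∀ ε > 0, ∫ ω, |lagKernel Ψ b b' ε v r ω| ∂(PB.prod PB)
          ≤ ε * ((√(2 * Real.pi * r.toNNReal))⁻¹ * ∫ z, |Ψ v z|) := by
        intro ε hε
        have hnn : 0 ≤ ε * ((√(2 * Real.pi * r.toNNReal))⁻¹ * ∫ z, |Ψ v z|) := by
          have : 0 ≤ ∫ z, |Ψ v z| := integral_nonneg fun _ => abs_nonneg _
          positivity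
        rw [integral_prod]
        · refine (le_abs_self _).trans ?_
          have := norm_integral_le_of_norm_le_const (μ := PB)
            (f := fun x => ∫ y, |lagKernel Ψ b b' ε v r (x, y)| ∂PB)
            (C := ε * ((√(2 * Real.pi * r.toNNReal))⁻¹ * ∫ z, |Ψ v z|)) (ae_of_all _ fun x => by
              rw [Real.norm_of_nonneg (integral_nonneg fun _ => abs_nonneg _)]
              by_cases h : ε ^ 2 * v < r
              · simp only [lagKernel, if_pos h, hb, hb']
                exact integral_abs_comp_brownian_le hB hr0 hε _ mΨv hΨv
              · simpa only [lagKernel, if_neg h, abs_zero, integral_zero] using hnn)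
          simpa using this
        · exact integrable_of_measurable_bdd ((mlag ε).comp (measurable_const.prodMk measurable_id)).abs
            (C := k) (fun ω => by rw [abs_abs]; exact blag ε r ω)
      refine squeeze_zero' (Eventually.of_forall fun ε => integral_nonneg fun ω => abs_nonneg _)
        (eventually_mem_nhdsWithin.mono bound) ?_
      have : Continuous fun ε : ℝ => ε * ((√(2 * Real.pi * r.toNNReal))⁻¹ * ∫ z, |Ψ v z|) := by
        fun_prop
      have h0 := this.tendsto 0
      rw [zero_mul] at h0
      exact h0.mono_left nhdsWithin_le_nhds
  simp only [intervalIntegral.integral_zero] at dct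
  refine squeeze_zero (fun ε => integral_nonneg fun ω => abs_nonneg _) (fun ε => ?_) dct
  have ip : Integrable (Function.uncurry fun r ω => |lagKernel Ψ b b' ε v r ω|)
      ((volume.restrict (uIoc 0 T)).prod (PB.prod PB)) :=
    integrable_of_measurable_bdd (mlag ε).abs (C := k) (fun p => by
      simp only [Function.uncurry]; rw [abs_abs]; exact blag ε _ _)
  rw [intervalIntegral_integral_swap ip]
  refine integral_mono_of_nonneg (ae_of_all _ fun _ => abs_nonneg _) ?_ (ae_of_all _ fun ω => ?_)
  · refine integrable_of_measurable_bdd (measurable_intervalIntegral_param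
      (X := fun r ω => |lagKernel Ψ b b' ε v r ω|) (mlag ε).abs measurable_const measurable_const)
      (C := k * |T - 0|) fun ω => ?_
    exact intervalIntegral.norm_integral_le_of_norm_le_const (E := ℝ)
      (f := fun r => |lagKernel Ψ b b' ε v r ω|) fun r _ => by
        rw [Real.norm_eq_abs, abs_abs]; exact blag ε r ω
  · dsimp only
    rw [mul_zero, sub_zero]
    exact intervalIntegral.abs_integral_le_integral_abs hT

/-- The integrated covariance of the field along two paths, in diffusive scaling. -/
def pathCov {Ω : Type*} (Ψ : ℝ → ℝ → ℝ) (T : ℝ) (b b' : ℝ≥0 → Ω → ℝ) (ε : ℝ) (ω : Ω) : ℝ :=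
  ∫ r in (0:ℝ)..T, (ε ^ 2)⁻¹ * ∫ u in (0:ℝ)..r,
    Ψ ((r - u) / ε ^ 2) ((b' r.toNNReal ω - b u.toNNReal ω) / ε)

/-- The substitution `v = (r - u)/ε²` absorbs the prefactor. The range `0 < u` becomes the condition
`ε² v < r` of `lagKernel`, so the lags run over a half-line not depending on `r`. -/
lemma pathCov_eq_lag {Ω : Type*} (Ψ : ℝ → ℝ → ℝ) {T : ℝ} (hT : 0 ≤ T) (b b' : ℝ≥0 → Ω → ℝ) {ε : ℝ}
    (hε : 0 < ε) (ω : Ω) :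
    pathCov Ψ T b b' ε ω = ∫ r in (0:ℝ)..T, ∫ v in Ioi (0:ℝ), lagKernel Ψ b b' ε v r ω := by
  unfold pathCov
  refine intervalIntegral.integral_congr fun r hr => ?_
  rw [uIcc_of_le hT] at hr
  have hε2 : 0 < ε ^ 2 := by positivity
  set F : ℝ → ℝ := fun v => Ψ v ((b' r.toNNReal ω - b (r - ε ^ 2 * v).toNNReal ω) / ε) with hF
  have e1 : ∀ u, Ψ ((r - u) / ε ^ 2) ((b' r.toNNReal ω - b u.toNNReal ω) / ε)
      = F (r / ε ^ 2 - u / ε ^ 2) := by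
    intro u
    simp only [hF]
    rw [← sub_div, mul_div_cancel₀ _ hε2.ne', sub_sub_cancel]
  simp_rw [e1]
  rw [intervalIntegral.inv_mul_integral_comp_sub_div]
  have e2 : ∀ v, lagKernel Ψ b b' ε v r ω = (Iio (r / ε ^ 2)).indicator F v := by
    intro v
    by_cases h : ε ^ 2 * v < r
    · rw [indicator_of_mem (by rw [mem_Iio, lt_div_iff₀ hε2]; linarith), lagKernel, if_pos h]
    · rw [indicator_of_notMem (by rw [mem_Iio, lt_div_iff₀ hε2]; linarith), lagKernel, if_neg h]
  simp_rw [e2]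
  rw [setIntegral_indicator measurableSet_Iio, zero_div, sub_zero, sub_self,
    intervalIntegral.integral_of_le (div_nonneg hr.1 hε2.le), integral_Ioc_eq_integral_Ioo]
  rfl

lemma tendsto_pathCov_diagonal (hB : IsPreBrownianReal B PB)
    (hBm : Measurable (Function.uncurry B)) (hΨ : IsCorrKernel Ψ D) {T : ℝ} (hT : 0 ≤ T) :
    Tendsto (fun ε => ∫ ω, |pathCov Ψ T B B ε ω - T * ∫ v in Ioi (0:ℝ), kernelMean PB B Ψ v| ∂PB)
      (𝓝[>] 0) (𝓝 0) := by
  refine (tendsto_integral_abs_lag (μ := PB) hT (ψ := lagKernel Ψ B B) (integrableOn_inv_sq D)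
    (measurable_kernelMean (PB := PB) hΨ.measurable hBm)
    (fun v hv => abs_kernelMean_le hΨ (le_of_lt hv))
    (fun ε _ => measurable_lagKernel hΨ.measurable hBm hBm ε)
    (fun ε _ v hv r ω => abs_lagKernel_le hΨ B B (le_of_lt hv) r ω) ?_).congr' ?_
  · filter_upwards [ae_restrict_mem measurableSet_Ioi] with v hv
    exact tendsto_lag_diagonal hB hBm hΨ hT hv
  · filter_upwards [self_mem_nhdsWithin] with ε hε
    simp_rw [pathCov_eq_lag Ψ hT B B hε]

lemma tendsto_pathCov_cross (hB : IsPreBrownianReal B PB)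
    (hBm : Measurable (Function.uncurry B)) (hΨ : IsCorrKernel Ψ D) {T : ℝ} (hT : 0 ≤ T) :
    Tendsto (fun ε => ∫ ω, |pathCov Ψ T (fun t (ω : Ω × Ω) => B t ω.1)
      (fun t (ω : Ω × Ω) => B t ω.2) ε ω| ∂(PB.prod PB)) (𝓝[>] 0) (𝓝 0) := by
  have mb : Measurable (Function.uncurry fun t (ω : Ω × Ω) => B t ω.1) :=
    hBm.comp (by fun_prop : Measurable fun p : ℝ≥0 × (Ω × Ω) => (p.1, p.2.1))
  have mb' : Measurable (Function.uncurry fun t (ω : Ω × Ω) => B t ω.2) :=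
    hBm.comp (by fun_prop : Measurable fun p : ℝ≥0 × (Ω × Ω) => (p.1, p.2.2))
  -- Integrability on the plane gives integrable sections for almost every lag only, hence the
  -- almost everywhere form of the limit over lags.
  have hi : ∀ᵐ v : ℝ, Integrable (Ψ v) := by
    have := hΨ.integrable
    exact (Measure.volume_eq_prod ℝ ℝ ▸ this).prod_right_ae
  have key := tendsto_integral_abs_lag (μ := PB.prod PB) hT (ψ := lagKernel Ψ
      (fun t (ω : Ω × Ω) => B t ω.1) (fun t (ω : Ω × Ω) => B t ω.2)) (m := fun _ => 0)
    (integrableOn_inv_sq D)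
    measurable_const (fun v hv => by
      rw [abs_zero]; exact (abs_nonneg _).trans (hΨ.bound v (le_of_lt hv) 0))
    (fun ε _ => measurable_lagKernel hΨ.measurable mb mb' ε)
    (fun ε _ v hv r ω => abs_lagKernel_le hΨ _ _ (le_of_lt hv) r ω) (by
      filter_upwards [ae_restrict_mem measurableSet_Ioi, ae_restrict_of_ae hi] with v hv hiv
      exact tendsto_lag_cross hB hBm hΨ hT hv hiv)
  refine key.congr' ?_
  filter_upwards [self_mem_nhdsWithin] with ε hε
  simp_rw [pathCov_eq_lag Ψ hT _ _ hε]
  simp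

lemma measurable_pathCov {Ω : Type*} [MeasurableSpace Ω] {b b' : ℝ≥0 → Ω → ℝ}
    (hΨ : Measurable (Function.uncurry Ψ)) (hb : Measurable (Function.uncurry b))
    (hb' : Measurable (Function.uncurry b')) (T ε : ℝ) : Measurable (pathCov Ψ T b b' ε) := by
  unfold pathCov
  refine measurable_intervalIntegral_param ?_ measurable_const measurable_const
  refine Measurable.const_mul ?_ _
  refine measurable_intervalIntegral_param (X := fun u (p : ℝ × Ω) =>
    Ψ ((p.1 - u) / ε ^ 2) ((b' p.1.toNNReal p.2 - b u.toNNReal p.2) / ε)) ?_ measurable_const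
    measurable_fst
  refine hΨ.comp (Measurable.prodMk (by fun_prop) (Measurable.div_const (Measurable.sub ?_ ?_) _))
  · exact hb'.comp (by fun_prop : Measurable fun p : ℝ × (ℝ × Ω) => (p.2.1.toNNReal, p.2.2))
  · exact hb.comp (by fun_prop : Measurable fun p : ℝ × (ℝ × Ω) => (p.1.toNNReal, p.2.2))

/-- The rescaled inverse square has integral at most `1`. This bound, uniform in `ε` and in the
paths, bounds the exponential moments and upgrades `L¹` convergence to mean square convergence. -/
lemma abs_pathCov_le {Ω : Type*} (hΨ : IsCorrKernel Ψ D) {T : ℝ} (hT : 0 ≤ T)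
    (b b' : ℝ≥0 → Ω → ℝ) {ε : ℝ} (hε : 0 < ε) (ω : Ω) : |pathCov Ψ T b b' ε ω| ≤ D * T := by
  have hD : 0 ≤ D := by
    have := (abs_nonneg _).trans (hΨ.bound 0 le_rfl 0)
    simpa using this
  have hε2 : 0 < ε ^ 2 := by positivity
  unfold pathCov
  have := intervalIntegral.norm_integral_le_of_norm_le_const (a := 0) (b := T) (C := D)
    (f := fun r => (ε ^ 2)⁻¹ * ∫ u in (0:ℝ)..r,
      Ψ ((r - u) / ε ^ 2) ((b' r.toNNReal ω - b u.toNNReal ω) / ε)) (fun r hr => by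
    rw [uIoc_of_le hT] at hr
    have hr0 := hr.1.le
    have kint : IntervalIntegrable (fun u => ((1 + (r - u) / ε ^ 2) ^ 2)⁻¹) volume 0 r := by
      refine ContinuousOn.intervalIntegrable (ContinuousOn.inv₀ (by fun_prop) fun u hu => ?_)
      rw [uIcc_of_le hr0] at hu
      have : 0 ≤ (r - u) / ε ^ 2 := div_nonneg (by linarith [hu.2]) hε2.le
      positivity
    have bnd := intervalIntegral.norm_integral_le_of_norm_le (μ := volume) hr0
      (f := fun u => Ψ ((r - u) / ε ^ 2) ((b' r.toNNReal ω - b u.toNNReal ω) / ε))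
      (g := fun u => D * ((1 + (r - u) / ε ^ 2) ^ 2)⁻¹)
      (ae_of_all _ fun u hu => hΨ.bound _ (div_nonneg (by linarith [hu.2]) hε2.le) _)
      (kint.const_mul _)
    rw [intervalIntegral.integral_const_mul, inv_sq_integral hε2 hr0 le_rfl] at bnd
    have h1 : 0 ≤ (1 + (r - 0) / ε ^ 2)⁻¹ := by
      have : 0 ≤ (r - 0) / ε ^ 2 := div_nonneg (by linarith) hε2.le
      positivity
    rw [norm_mul, Real.norm_of_nonneg (inv_nonneg.2 hε2.le)]
    calc _ ≤ (ε ^ 2)⁻¹ * (D * (ε ^ 2 * ((1 + (r - r) / ε ^ 2)⁻¹ - (1 + (r - 0) / ε ^ 2)⁻¹))) := by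
          gcongr
      _ = D * ((1 + (r - r) / ε ^ 2)⁻¹ - (1 + (r - 0) / ε ^ 2)⁻¹) := by field_simp
      _ ≤ D * 1 := by
          gcongr
          simp only [sub_self, zero_div, add_zero, inv_one]; linarith
      _ = D := mul_one D)
  rwa [sub_zero, abs_of_nonneg hT] at this

end BrownianCross


/-! ### Exponential moments and integrated covariances along a pair of Brownian paths. -/

section SecondMoment

lemma integral_abs_mul_le_sqrt {α : Type*} [MeasurableSpace α] {μ : Measure α} {f h : α → ℝ}
    (hf : MemLp f 2 μ) (hh : MemLp h 2 μ) :
    ∫ a, |f a * h a| ∂μ ≤ √(∫ a, f a ^ 2 ∂μ) * √(∫ a, h a ^ 2 ∂μ) := by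
  have := integral_mul_norm_le_Lp_mul_Lq (μ := μ) (f := f) (g := h) (p := 2) (q := 2)
    ⟨by norm_num, by norm_num, by norm_num⟩ (by simpa using hf) (by simpa using hh)
  simp only [Real.norm_eq_abs, Real.rpow_two, sq_abs, ← Real.sqrt_eq_rpow] at this
  simpa only [abs_mul] using this

lemma abs_exp_sub_exp_le_mul {a b R : ℝ} (ha : a ≤ R) (hb : b ≤ R) :
    |Real.exp a - Real.exp b| ≤ Real.exp R * |a - b| := by
  wlog h : b ≤ a generalizing a b
  · rw [abs_sub_comm, abs_sub_comm a b]
    exact this hb ha (le_of_not_ge h)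
  rw [abs_of_nonneg (sub_nonneg.2 (Real.exp_le_exp.2 h)), abs_of_nonneg (sub_nonneg.2 h)]
  have h1 := Real.add_one_le_exp (b - a)
  have e : Real.exp b = Real.exp a * Real.exp (b - a) := by rw [← Real.exp_add]; ring_nf
  have h2 := Real.exp_le_exp.2 ha
  have h3 := Real.exp_pos a
  calc Real.exp a - Real.exp b = Real.exp a * (1 - Real.exp (b - a)) := by rw [e]; ring
    _ ≤ Real.exp a * (a - b) := mul_le_mul_of_nonneg_left (by linarith) h3.le
    _ ≤ Real.exp R * (a - b) := by
      have : 0 ≤ a - b := sub_nonneg.2 h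
      gcongr

variable {S Ω : Type*} [mS : MeasurableSpace S] [mΩ : MeasurableSpace Ω] {P : Measure S}
  [IsProbabilityMeasure P] {PB : Measure Ω} [IsProbabilityMeasure PB]
  {B : ℝ≥0 → Ω → ℝ} {Ψ : ℝ → ℝ → ℝ} {D K T x ε : ℝ} {c : ℝ≥0 → ℝ → S → ℝ} {τ : ℝ → ℝ≥0}

/-- The scaled space path of a particle started at `x`. -/
def scaledPath {Ω : Type*} (B : ℝ≥0 → Ω → ℝ) (x ε : ℝ) (ω : Ω) (r : ℝ) : ℝ :=
  (x + B r.toNNReal ω) / ε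

/-- The rescaled time integral of the field along the path, with time change `τ`. -/
def fieldInt {S Ω : Type*} (c : ℝ≥0 → ℝ → S → ℝ) (τ : ℝ → ℝ≥0) (B : ℝ≥0 → Ω → ℝ) (x T ε : ℝ)
    (s : S) (ω : Ω) : ℝ :=
  ε⁻¹ * ∫ r in (0:ℝ)..T, c (τ r) (scaledPath B x ε ω r) s

lemma measurable_scaledPath_uncurry (hBm : Measurable (Function.uncurry B)) :
    Measurable fun p : Ω × ℝ => scaledPath B x ε p.1 p.2 := by
  unfold scaledPath
  exact (measurable_const.add (hBm.comp
    (by fun_prop : Measurable fun p : Ω × ℝ => (p.2.toNNReal, p.1)))).div_const _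

lemma measurable_scaledPath (hBm : Measurable (Function.uncurry B)) (ω : Ω) :
    Measurable (scaledPath B x ε ω) :=
  (measurable_scaledPath_uncurry hBm).comp (measurable_const.prodMk measurable_id)

lemma measurable_fieldInt (hc : Measurable (fun q : ℝ≥0 × ℝ × S => c q.1 q.2.1 q.2.2))
    (hτ : Measurable τ) (hBm : Measurable (Function.uncurry B)) :
    Measurable fun p : S × Ω => fieldInt c τ B x T ε p.1 p.2 := by
  unfold fieldInt
  refine Measurable.const_mul (measurable_intervalIntegral_param
    (X := fun r (p : S × Ω) => c (τ r) (scaledPath B x ε p.2 r) p.1) ?_ measurable_const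
    measurable_const) _
  exact measurable_field_comp hc (hτ.comp measurable_fst)
    ((measurable_scaledPath_uncurry hBm).comp
      (by fun_prop : Measurable fun q : ℝ × (S × Ω) => (q.2.2, q.1)))
    (measurable_fst.comp measurable_snd)

lemma abs_fieldInt_le {S Ω : Type*} {c : ℝ≥0 → ℝ → S → ℝ} {τ : ℝ → ℝ≥0} {B : ℝ≥0 → Ω → ℝ}
    (hK : ∀ t x s, |c t x s| ≤ K) (hε : 0 < ε) (hT : 0 ≤ T) (s : S) (ω : Ω) :
    |fieldInt c τ B x T ε s ω| ≤ ε⁻¹ * (K * T) := by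
  unfold fieldInt
  rw [abs_mul, abs_of_pos (inv_pos.2 hε)]
  gcongr
  have := intervalIntegral.norm_integral_le_of_norm_le_const (E := ℝ) (a := 0) (b := T)
    (f := fun r => c (τ r) (scaledPath B x ε ω r) s) (C := K) fun r _ => hK _ _ _
  rwa [sub_zero, abs_of_nonneg hT] at this

/-- The exponential moment of the field along a pair of paths. -/
def pairMoment (P : Measure S) (c : ℝ≥0 → ℝ → S → ℝ) (τ : ℝ → ℝ≥0) (B : ℝ≥0 → Ω → ℝ)
    (x T ε θ₁ θ₂ : ℝ) (ω : Ω × Ω) : ℝ :=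
  ∫ s, Real.exp (θ₁ * fieldInt c τ B x T ε s ω.1 + θ₂ * fieldInt c τ B x T ε s ω.2) ∂P

lemma measurable_pairExp (hc : Measurable (fun q : ℝ≥0 × ℝ × S => c q.1 q.2.1 q.2.2))
    (hτ : Measurable τ) (hBm : Measurable (Function.uncurry B)) (θ₁ θ₂ : ℝ) :
    Measurable fun p : (Ω × Ω) × S => Real.exp (θ₁ * fieldInt c τ B x T ε p.2 p.1.1
      + θ₂ * fieldInt c τ B x T ε p.2 p.1.2) := by
  have h := measurable_fieldInt (x := x) (T := T) (ε := ε) hc hτ hBm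
  refine Real.measurable_exp.comp (Measurable.add (Measurable.const_mul ?_ _)
    (Measurable.const_mul ?_ _))
  · exact h.comp (by fun_prop : Measurable fun p : (Ω × Ω) × S => (p.2, p.1.1))
  · exact h.comp (by fun_prop : Measurable fun p : (Ω × Ω) × S => (p.2, p.1.2))

lemma measurable_pairMoment (hc : Measurable (fun q : ℝ≥0 × ℝ × S => c q.1 q.2.1 q.2.2))
    (hτ : Measurable τ) (hBm : Measurable (Function.uncurry B)) (θ₁ θ₂ : ℝ) :
    Measurable (pairMoment P c τ B x T ε θ₁ θ₂) :=
  StronglyMeasurable.measurable (StronglyMeasurable.integral_prod_right'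
    (f := fun p : (Ω × Ω) × S => Real.exp (θ₁ * fieldInt c τ B x T ε p.2 p.1.1
      + θ₂ * fieldInt c τ B x T ε p.2 p.1.2)) (measurable_pairExp hc hτ hBm θ₁ θ₂).stronglyMeasurable)

lemma scaledInt_pathField (hc : Measurable (fun q : ℝ≥0 × ℝ × S => c q.1 q.2.1 q.2.2))
    (hK : ∀ t x s, |c t x s| ≤ K) (hτ : Measurable τ) (hBm : Measurable (Function.uncurry B))
    (θ₁ θ₂ : ℝ) (ω : Ω × Ω) (s : S) :
    scaledInt ε (pathField c τ (scaledPath B x ε ω.1) (scaledPath B x ε ω.2) θ₁ θ₂) T s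
      = θ₁ * fieldInt c τ B x T ε s ω.1 + θ₂ * fieldInt c τ B x T ε s ω.2 := by
  have hi : ∀ ω : Ω, IntervalIntegrable (fun r => c (τ r) (scaledPath B x ε ω r) s) volume 0 T :=
    fun ω => intervalIntegrable_of_measurable_bdd
      (measurable_field_comp hc hτ (measurable_scaledPath hBm ω) measurable_const)
      (fun r => hK _ _ _) _ _
  unfold scaledInt pathField fieldInt
  rw [intervalIntegral.integral_add ((hi _).const_mul _) ((hi _).const_mul _),
    intervalIntegral.integral_const_mul, intervalIntegral.integral_const_mul]
  ring

/-- The limiting log-moment: integrated covariances along all pairs of paths. -/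
def pairCov {Ω : Type*} (Ψ : ℝ → ℝ → ℝ) (B : ℝ≥0 → Ω → ℝ) (T ε θ₁ θ₂ : ℝ) (ω : Ω × Ω) : ℝ :=
  θ₁ ^ 2 * pathCov Ψ T B B ε ω.1 + θ₂ ^ 2 * pathCov Ψ T B B ε ω.2
    + θ₁ * θ₂ * (pathCov Ψ T (fun t (ω : Ω × Ω) => B t ω.1) (fun t (ω : Ω × Ω) => B t ω.2) ε ω
      + pathCov Ψ T (fun t (ω : Ω × Ω) => B t ω.1) (fun t (ω : Ω × Ω) => B t ω.2) ε ω.swap)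

/-- The product of two sums has four terms. In each, the path read at the earlier time `u` is the
first argument of `pathCov`; the two mixed terms differ by exchanging the paths, hence the `swap` in
`pairCov`. The starting point `x` cancels in differences. -/
lemma integral_cov_pathField (hε : 0 < ε) (hT : 0 ≤ T)
    (hc : Measurable (fun q : ℝ≥0 × ℝ × S => c q.1 q.2.1 q.2.2))
    (hK : ∀ t x s, |c t x s| ≤ K) (hBm : Measurable (Function.uncurry B))
    (hΨ : IsCorrKernel Ψ D)
    (hcov : ∀ u r, 0 ≤ u → u ≤ r → r ≤ T → ∀ y z,
      ∫ s, c (τ u) y s * c (τ r) z s ∂P = Ψ ((r - u) / ε ^ 2) (z - y))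
    (θ₁ θ₂ : ℝ) (ω : Ω × Ω) :
    ∫ r in (0:ℝ)..T, (ε ^ 2)⁻¹ * ∫ u in (0:ℝ)..r, ∫ s,
      pathField c τ (scaledPath B x ε ω.1) (scaledPath B x ε ω.2) θ₁ θ₂ r s *
      pathField c τ (scaledPath B x ε ω.1) (scaledPath B x ε ω.2) θ₁ θ₂ u s ∂P
      = pairCov Ψ B T ε θ₁ θ₂ ω := by
  have hε2 : 0 < ε ^ 2 := by positivity
  have hci : ∀ t y t' y', Integrable (fun s => c t y s * c t' y' s) P := fun t y t' y' => by
    refine integrable_of_measurable_bdd (Measurable.mul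
      (measurable_field_comp hc measurable_const measurable_const measurable_id)
      (measurable_field_comp hc measurable_const measurable_const measurable_id)) (C := K * K) ?_
    intro s
    rw [abs_mul]
    exact mul_le_mul (hK _ _ _) (hK _ _ _) (abs_nonneg _) ((abs_nonneg _).trans (hK t y s))
  -- kernels along the paths
  let k : Ω → Ω → ℝ → ℝ → ℝ := fun a b r u => Ψ ((r - u) / ε ^ 2) ((B r.toNNReal b - B u.toNNReal a) / ε)
  have hd : ∀ a b r u, scaledPath B x ε b r - scaledPath B x ε a u
      = (B r.toNNReal b - B u.toNNReal a) / ε := fun a b r u => by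
    unfold scaledPath; ring
  have mk : ∀ a b, Measurable (Function.uncurry (k a b)) := fun a b => by
    refine hΨ.measurable.comp (Measurable.prodMk (by fun_prop) (Measurable.div_const
      (Measurable.sub ?_ ?_) _))
    · exact hBm.comp (by fun_prop : Measurable fun p : ℝ × ℝ => (p.1.toNNReal, b))
    · exact hBm.comp (by fun_prop : Measurable fun p : ℝ × ℝ => (p.2.toNNReal, a))
  have bk : ∀ a b, ∀ r, ∀ u ∈ Ioc 0 r, |k a b r u| ≤ D := fun a b r u hu => by
    have h0 : 0 ≤ (r - u) / ε ^ 2 := div_nonneg (by linarith [hu.2]) hε2.le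
    refine (hΨ.bound _ h0 _).trans ?_
    have hD : 0 ≤ D := by simpa using (abs_nonneg _).trans (hΨ.bound 0 le_rfl 0)
    refine mul_le_of_le_one_right hD (inv_le_one_of_one_le₀ ?_)
    nlinarith
  have ik : ∀ a b r, 0 ≤ r → IntervalIntegrable (k a b r) volume 0 r := fun a b r hr => by
    refine (intervalIntegrable_const (c := D)).mono_fun
      ((mk a b).comp (measurable_const.prodMk measurable_id)).aestronglyMeasurable ?_
    rw [uIoc_of_le hr]
    filter_upwards [ae_restrict_mem measurableSet_Ioc] with u hu
    exact (bk a b r u hu).trans (le_abs_self D)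
  let I : Ω → Ω → ℝ → ℝ := fun a b r => (ε ^ 2)⁻¹ * ∫ u in (0:ℝ)..r, k a b r u
  have mI : ∀ a b, Measurable (I a b) := fun a b => by
    refine Measurable.const_mul ?_ _
    exact measurable_intervalIntegral_param (X := fun u r => k a b r u)
      ((mk a b).comp measurable_swap) measurable_const measurable_id
  have iI : ∀ a b, IntervalIntegrable (I a b) volume 0 T := fun a b => by
    refine (intervalIntegrable_const (c := (ε ^ 2)⁻¹ * (D * T))).mono_fun
      (mI a b).aestronglyMeasurable ?_
    rw [uIoc_of_le hT]
    filter_upwards [ae_restrict_mem measurableSet_Ioc] with r hr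
    have hD : 0 ≤ D := by simpa using (abs_nonneg _).trans (hΨ.bound 0 le_rfl 0)
    rw [Real.norm_of_nonneg (by positivity : 0 ≤ (ε ^ 2)⁻¹ * (D * T)), norm_mul,
      Real.norm_of_nonneg (inv_nonneg.2 hε2.le)]
    gcongr
    refine (intervalIntegral.norm_integral_le_of_norm_le_const (C := D) (fun u hu => ?_)).trans ?_
    · rw [uIoc_of_le hr.1.le] at hu
      exact bk a b r u hu
    · rw [sub_zero, abs_of_nonneg hr.1.le]
      have := hr.2
      gcongr
  have inner : ∀ r ∈ Icc 0 T, (ε ^ 2)⁻¹ * ∫ u in (0:ℝ)..r, ∫ s,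
      pathField c τ (scaledPath B x ε ω.1) (scaledPath B x ε ω.2) θ₁ θ₂ r s *
      pathField c τ (scaledPath B x ε ω.1) (scaledPath B x ε ω.2) θ₁ θ₂ u s ∂P
      = θ₁ ^ 2 * I ω.1 ω.1 r + θ₂ ^ 2 * I ω.2 ω.2 r + θ₁ * θ₂ * (I ω.1 ω.2 r + I ω.2 ω.1 r) := by
    intro r hr
    have e : ∀ u ∈ uIcc 0 r, (∫ s,
        pathField c τ (scaledPath B x ε ω.1) (scaledPath B x ε ω.2) θ₁ θ₂ r s *
        pathField c τ (scaledPath B x ε ω.1) (scaledPath B x ε ω.2) θ₁ θ₂ u s ∂P)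
        = θ₁ ^ 2 * k ω.1 ω.1 r u + θ₂ ^ 2 * k ω.2 ω.2 r u
          + θ₁ * θ₂ * (k ω.1 ω.2 r u + k ω.2 ω.1 r u) := by
      intro u hu
      rw [uIcc_of_le hr.1] at hu
      have hcv : ∀ a b : Ω, ∫ s, c (τ u) (scaledPath B x ε a u) s * c (τ r) (scaledPath B x ε b r) s ∂P
          = k a b r u := fun a b => by
        rw [hcov u r hu.1 hu.2 hr.2, hd]
      rw [← hcv, ← hcv, ← hcv, ← hcv]
      set f₁ := fun s => c (τ u) (scaledPath B x ε ω.1 u) s * c (τ r) (scaledPath B x ε ω.1 r) s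
      set f₂ := fun s => c (τ u) (scaledPath B x ε ω.2 u) s * c (τ r) (scaledPath B x ε ω.2 r) s
      set f₃ := fun s => c (τ u) (scaledPath B x ε ω.1 u) s * c (τ r) (scaledPath B x ε ω.2 r) s
      set f₄ := fun s => c (τ u) (scaledPath B x ε ω.2 u) s * c (τ r) (scaledPath B x ε ω.1 r) s
      have i₁ : Integrable f₁ P := hci _ _ _ _
      have i₂ : Integrable f₂ P := hci _ _ _ _
      have i₃ : Integrable f₃ P := hci _ _ _ _
      have i₄ : Integrable f₄ P := hci _ _ _ _
      have j₁ : Integrable (fun s => θ₁ ^ 2 * f₁ s + θ₂ ^ 2 * f₂ s) P :=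
        (i₁.const_mul _).add (i₂.const_mul _)
      have j₂ : Integrable (fun s => θ₁ * θ₂ * (f₃ s + f₄ s)) P := (i₃.add i₄).const_mul _
      have e : (fun s => pathField c τ (scaledPath B x ε ω.1) (scaledPath B x ε ω.2) θ₁ θ₂ r s *
          pathField c τ (scaledPath B x ε ω.1) (scaledPath B x ε ω.2) θ₁ θ₂ u s)
          = fun s => θ₁ ^ 2 * f₁ s + θ₂ ^ 2 * f₂ s + θ₁ * θ₂ * (f₃ s + f₄ s) := by
        ext s
        simp only [pathField, f₁, f₂, f₃, f₄]
        ring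
      rw [e, integral_add j₁ j₂, integral_add (i₁.const_mul _) (i₂.const_mul _),
        integral_const_mul, integral_const_mul, integral_const_mul, integral_add i₃ i₄]
    rw [intervalIntegral.integral_congr e]
    have i1 := ik ω.1 ω.1 r hr.1
    have i2 := ik ω.2 ω.2 r hr.1
    have i3 := ik ω.1 ω.2 r hr.1
    have i4 := ik ω.2 ω.1 r hr.1
    rw [intervalIntegral.integral_add ((i1.const_mul _).add (i2.const_mul _))
      ((i3.add i4).const_mul _), intervalIntegral.integral_add (i1.const_mul _) (i2.const_mul _)]
    simp only [intervalIntegral.integral_const_mul]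
    rw [intervalIntegral.integral_add i3 i4]
    simp only [I]
    ring
  rw [intervalIntegral.integral_congr (g := fun r => θ₁ ^ 2 * I ω.1 ω.1 r + θ₂ ^ 2 * I ω.2 ω.2 r
      + θ₁ * θ₂ * (I ω.1 ω.2 r + I ω.2 ω.1 r)) (fun r hr => by
        rw [uIcc_of_le hT] at hr; exact inner r hr)]
  have i1 := iI ω.1 ω.1
  have i2 := iI ω.2 ω.2
  have i3 := iI ω.1 ω.2
  have i4 := iI ω.2 ω.1
  rw [intervalIntegral.integral_add ((i1.const_mul _).add (i2.const_mul _))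
      ((i3.add i4).const_mul _), intervalIntegral.integral_add (i1.const_mul _) (i2.const_mul _)]
  simp only [intervalIntegral.integral_const_mul]
  rw [intervalIntegral.integral_add i3 i4]
  rfl

lemma abs_pairCov_le {Ω : Type*} {B : ℝ≥0 → Ω → ℝ} (hΨ : IsCorrKernel Ψ D) (hε : 0 < ε)
    (hT : 0 ≤ T) {θ₁ θ₂ : ℝ} (hθ₁ : |θ₁| ≤ 1) (hθ₂ : |θ₂| ≤ 1) (ω : Ω × Ω) :
    |pairCov Ψ B T ε θ₁ θ₂ ω| ≤ 4 * (D * T) := by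
  have h1 := abs_pathCov_le hΨ hT B B hε ω.1
  have h2 := abs_pathCov_le hΨ hT B B hε ω.2
  have h3 := abs_pathCov_le hΨ hT (fun t (ω : Ω × Ω) => B t ω.1) (fun t (ω : Ω × Ω) => B t ω.2) hε ω
  have h4 := abs_pathCov_le hΨ hT (fun t (ω : Ω × Ω) => B t ω.1) (fun t (ω : Ω × Ω) => B t ω.2) hε ω.swap
  have t1 : |θ₁ ^ 2| ≤ 1 := by rw [abs_pow]; exact pow_le_one₀ (abs_nonneg _) hθ₁
  have t2 : |θ₂ ^ 2| ≤ 1 := by rw [abs_pow]; exact pow_le_one₀ (abs_nonneg _) hθ₂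
  have t3 : |θ₁ * θ₂| ≤ 1 := by rw [abs_mul]; exact mul_le_one₀ hθ₁ (abs_nonneg _) hθ₂
  unfold pairCov
  set a := pathCov Ψ T B B ε ω.1
  set b := pathCov Ψ T B B ε ω.2
  set d := pathCov Ψ T (fun t (ω : Ω × Ω) => B t ω.1) (fun t (ω : Ω × Ω) => B t ω.2) ε ω
  set e := pathCov Ψ T (fun t (ω : Ω × Ω) => B t ω.1) (fun t (ω : Ω × Ω) => B t ω.2) ε ω.swap
  have m : ∀ p q : ℝ, |p| ≤ 1 → |p * q| ≤ |q| := fun p q hp => by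
    rw [abs_mul]; exact mul_le_of_le_one_left (abs_nonneg _) hp
  calc _ ≤ |θ₁ ^ 2 * a| + |θ₂ ^ 2 * b| + |θ₁ * θ₂ * (d + e)| := abs_add_three _ _ _
    _ ≤ |a| + |b| + (|d| + |e|) :=
       add_le_add (add_le_add (m _ _ t1) (m _ _ t2)) ((m _ _ t3).trans (abs_add_le _ _))
    _ ≤ D * T + D * T + (D * T + D * T) := add_le_add (add_le_add h1 h2) (add_le_add h3 h4)
    _ = _ := by ring

lemma measurable_pairCov (hBm : Measurable (Function.uncurry B))
    (hΨ : Measurable (Function.uncurry Ψ)) (T ε θ₁ θ₂ : ℝ) :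
    Measurable (pairCov Ψ B T ε θ₁ θ₂) := by
  have mb : Measurable (Function.uncurry fun t (ω : Ω × Ω) => B t ω.1) :=
    hBm.comp (by fun_prop : Measurable fun p : ℝ≥0 × (Ω × Ω) => (p.1, p.2.1))
  have mb' : Measurable (Function.uncurry fun t (ω : Ω × Ω) => B t ω.2) :=
    hBm.comp (by fun_prop : Measurable fun p : ℝ≥0 × (Ω × Ω) => (p.1, p.2.2))
  have h1 := measurable_pathCov hΨ hBm hBm T ε
  have h2 := measurable_pathCov hΨ mb mb' T ε
  exact (((h1.comp measurable_fst).const_mul _).add ((h1.comp measurable_snd).const_mul _)).add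
    ((h2.add (h2.comp measurable_swap)).const_mul _)

/-- The effective variance of a kernel along Brownian motion. -/
def kernelConst (PB : Measure Ω) (B : ℝ≥0 → Ω → ℝ) (Ψ : ℝ → ℝ → ℝ) : ℝ :=
  ∫ v in Ioi (0:ℝ), kernelMean PB B Ψ v

/-- Each diagonal term averages to the effective constant and the mixed ones vanish, so two
independent particles asymptotically see independent environments. The swapped mixed term has the
same mean because the product measure is symmetric. -/
lemma tendsto_pairCov (hB : IsPreBrownianReal B PB) (hBm : Measurable (Function.uncurry B))
    (hΨ : IsCorrKernel Ψ D) (hT : 0 ≤ T) (θ₁ θ₂ : ℝ) :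
    Tendsto (fun ε => ∫ ω, |pairCov Ψ B T ε θ₁ θ₂ ω
      - (θ₁ ^ 2 + θ₂ ^ 2) * (T * kernelConst PB B Ψ)| ∂(PB.prod PB)) (𝓝[>] 0) (𝓝 0) := by
  have mb : Measurable (Function.uncurry fun t (ω : Ω × Ω) => B t ω.1) :=
    hBm.comp (by fun_prop : Measurable fun p : ℝ≥0 × (Ω × Ω) => (p.1, p.2.1))
  have mb' : Measurable (Function.uncurry fun t (ω : Ω × Ω) => B t ω.2) :=
    hBm.comp (by fun_prop : Measurable fun p : ℝ≥0 × (Ω × Ω) => (p.1, p.2.2))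
  have d := tendsto_pathCov_diagonal hB hBm hΨ hT
  have x := tendsto_pathCov_cross hB hBm hΨ hT
  have lim := ((d.const_mul (θ₁ ^ 2)).add (d.const_mul (θ₂ ^ 2))).add
    ((x.add x).const_mul |θ₁ * θ₂|)
  simp only [mul_zero, add_zero] at lim
  refine squeeze_zero' (Eventually.of_forall fun ε => integral_nonneg fun ω => abs_nonneg _) ?_ lim
  filter_upwards [self_mem_nhdsWithin] with ε hε
  set s := T * kernelConst PB B Ψ with hs
  set V : Ω → ℝ := fun ω => |pathCov Ψ T B B ε ω - s| with hV
  set W : Ω × Ω → ℝ := fun ω =>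
    |pathCov Ψ T (fun t (ω : Ω × Ω) => B t ω.1) (fun t (ω : Ω × Ω) => B t ω.2) ε ω| with hW
  have iV : Integrable V PB := (Integrable.sub (integrable_of_measurable_bdd
    (measurable_pathCov hΨ.measurable hBm hBm T ε) (abs_pathCov_le hΨ hT B B hε))
    (integrable_const _)).abs
  have iW : Integrable W (PB.prod PB) := (integrable_of_measurable_bdd
    (measurable_pathCov hΨ.measurable mb mb' T ε) (abs_pathCov_le hΨ hT _ _ hε)).abs
  have e1 : ∫ ω, V ω.1 ∂(PB.prod PB) = ∫ ω, V ω ∂PB := by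
    rw [integral_fun_fst]; simp
  have e2 : ∫ ω, V ω.2 ∂(PB.prod PB) = ∫ ω, V ω ∂PB := by
    rw [integral_fun_snd]; simp
  have e3 : ∫ ω, W ω.swap ∂(PB.prod PB) = ∫ ω, W ω ∂(PB.prod PB) := integral_prod_swap W
  have j1 : Integrable (fun ω : Ω × Ω => V ω.1) (PB.prod PB) := iV.comp_fst _
  have j2 : Integrable (fun ω : Ω × Ω => V ω.2) (PB.prod PB) := iV.comp_snd _
  have j3 : Integrable (fun ω : Ω × Ω => W ω.swap) (PB.prod PB) := iW.swap
  change _ ≤ θ₁ ^ 2 * (∫ ω, V ω ∂PB) + θ₂ ^ 2 * (∫ ω, V ω ∂PB)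
    + |θ₁ * θ₂| * (∫ ω, W ω ∂(PB.prod PB) + ∫ ω, W ω ∂(PB.prod PB))
  calc _ ≤ ∫ ω, (θ₁ ^ 2 * V ω.1 + θ₂ ^ 2 * V ω.2 + |θ₁ * θ₂| * (W ω + W ω.swap)) ∂(PB.prod PB) := by
        refine integral_mono_of_nonneg (ae_of_all _ fun ω => abs_nonneg _)
          (((j1.const_mul _).add (j2.const_mul _)).add ((iW.add j3).const_mul _))
          (ae_of_all _ fun ω => ?_)
        unfold pairCov
        dsimp only
        set a := pathCov Ψ T B B ε ω.1 with ha
        set b := pathCov Ψ T B B ε ω.2 with hb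
        set d := pathCov Ψ T (fun t (ω : Ω × Ω) => B t ω.1) (fun t (ω : Ω × Ω) => B t ω.2) ε ω
        set e := pathCov Ψ T (fun t (ω : Ω × Ω) => B t ω.1) (fun t (ω : Ω × Ω) => B t ω.2) ε ω.swap
        have : θ₁ ^ 2 * a + θ₂ ^ 2 * b + θ₁ * θ₂ * (d + e) - (θ₁ ^ 2 + θ₂ ^ 2) * s
            = θ₁ ^ 2 * (a - s) + θ₂ ^ 2 * (b - s) + θ₁ * θ₂ * (d + e) := by ring
        rw [this]
        refine (abs_add_three _ _ _).trans ?_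
        rw [abs_mul, abs_mul, abs_mul _ (d + e), abs_of_nonneg (sq_nonneg θ₁),
          abs_of_nonneg (sq_nonneg θ₂)]
        gcongr
        exact abs_add_le _ _
    _ = _ := by
        have k1 : Integrable (fun ω : Ω × Ω => θ₁ ^ 2 * V ω.1 + θ₂ ^ 2 * V ω.2) (PB.prod PB) :=
          (j1.const_mul _).add (j2.const_mul _)
        have k2 : Integrable (fun ω : Ω × Ω => |θ₁ * θ₂| * (W ω + W ω.swap)) (PB.prod PB) :=
          (iW.add j3).const_mul _
        rw [integral_add k1 k2, integral_add (j1.const_mul _) (j2.const_mul _), integral_const_mul, integral_const_mul,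
          integral_const_mul, integral_add iW j3, e1, e2, e3]

end SecondMoment


/-! ### Mean square convergence for a general clock. -/

section MeanSquare

variable {S Ω : Type*} [mS : MeasurableSpace S] [mΩ : MeasurableSpace Ω] {P : Measure S}
  [IsProbabilityMeasure P] {PB : Measure Ω} [IsProbabilityMeasure PB]
  {B : ℝ≥0 → Ω → ℝ} {Ψ : ℝ → ℝ → ℝ} {D K C δ T x ε : ℝ} {c : ℝ≥0 → ℝ → S → ℝ}
  {τ : ℝ → ℝ → ℝ≥0} {γ : Ω → ℝ}

/-- A bounded, centered, measurable field whose mixing coefficients decay faster than `r⁻²`. -/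
structure IsMixingField (P : Measure S) (c : ℝ≥0 → ℝ → S → ℝ) (K C δ : ℝ) : Prop where
  pos : 0 < δ
  measurable : Measurable (fun q : ℝ≥0 × ℝ × S => c q.1 q.2.1 q.2.2)
  bound : ∀ t x s, |c t x s| ≤ K
  centered : ∀ t x, ∫ s, c t x s ∂P = 0
  mixing : ∀ r ≥ (0 : ℝ), alphaUM P c r ≤ C * (1 + r) ^ (-(2 + δ))

/-- The time changes `τ ε` run with speed `ε⁻²` on `[0, T]`, and `Ψ` is the covariance of the field
in the changed time. -/
structure IsClock (P : Measure S) (c : ℝ≥0 → ℝ → S → ℝ) (Ψ : ℝ → ℝ → ℝ) (T : ℝ)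
    (τ : ℝ → ℝ → ℝ≥0) : Prop where
  measurable : ∀ ε, Measurable (τ ε)
  dist : ∀ ε > 0, ∀ r ∈ Icc 0 T, ∀ u ∈ Icc 0 T, |(τ ε r : ℝ) - τ ε u| = |r - u| / ε ^ 2
  cov : ∀ ε > 0, ∀ u r, 0 ≤ u → u ≤ r → r ≤ T → ∀ y z,
      ∫ s, c (τ ε u) y s * c (τ ε r) z s ∂P = Ψ ((r - u) / ε ^ 2) (z - y)

lemma pairMoment_pos (hc : IsMixingField P c K C δ) (hτ : IsClock P c Ψ T τ)
    (hBm : Measurable (Function.uncurry B)) (hε : 0 < ε) (hT : 0 ≤ T) (θ₁ θ₂ : ℝ) (ω : Ω × Ω) :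
    0 < pairMoment P c (τ ε) B x T ε θ₁ θ₂ ω := by
  have hm : Measurable fun s => Real.exp (θ₁ * fieldInt c (τ ε) B x T ε s ω.1
      + θ₂ * fieldInt c (τ ε) B x T ε s ω.2) :=
    (measurable_pairExp hc.measurable (hτ.measurable ε) hBm θ₁ θ₂).comp
      (g := fun p : (Ω × Ω) × S => Real.exp (θ₁ * fieldInt c (τ ε) B x T ε p.2 p.1.1
        + θ₂ * fieldInt c (τ ε) B x T ε p.2 p.1.2)) (f := fun s => (ω, s)) (by fun_prop)
  refine integral_exp_pos (integrable_of_measurable_bdd hm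
    (C := Real.exp (|θ₁| * (ε⁻¹ * (K * T)) + |θ₂| * (ε⁻¹ * (K * T)))) fun s => ?_)
  rw [abs_of_pos (Real.exp_pos _)]
  refine Real.exp_le_exp.2 (add_le_add ?_ ?_)
  all_goals
    refine (le_abs_self _).trans ?_
    rw [abs_mul]
    exact mul_le_mul_of_nonneg_left (abs_fieldInt_le hc.bound hε hT _ _) (abs_nonneg _)

/-- The error does not depend on `ω`, since the paths enter the mixing estimates only through
separation in time. All remaining randomness sits in `pairCov`. -/
lemma abs_log_pairMoment_sub_le (hc : IsMixingField P c K C δ) (hτ : IsClock P c Ψ T τ)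
    (hBm : Measurable (Function.uncurry B)) (hΨ : IsCorrKernel Ψ D) (hε : 0 < ε) (hT : 0 ≤ T)
    {θ₁ θ₂ : ℝ} (hθ₁ : |θ₁| ≤ 1) (hθ₂ : |θ₂| ≤ 1) (ω : Ω × Ω) :
    |Real.log (pairMoment P c (τ ε) B x T ε θ₁ θ₂ ω) - pairCov Ψ B T ε θ₁ θ₂ ω|
      ≤ expErr (2 * K) (8 * K ^ 2 * C) ((4 * K + 8 * K ^ 2) * C * (1 + window δ ε) ^ (-(2 + δ)))
          ε (window δ ε) * T := by
  have h := abs_log_expMoment_pathField_sub_le hε hT hc.pos hc.measurable hc.bound hc.centered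
    hc.mixing (hτ.measurable ε) (hτ.dist ε hε) (measurable_scaledPath (x := x) (ε := ε) hBm ω.1)
    (measurable_scaledPath (x := x) (ε := ε) hBm ω.2) hθ₁ hθ₂
  rw [integral_cov_pathField hε hT hc.measurable hc.bound hBm hΨ (hτ.cov ε hε)] at h
  simp_rw [scaledInt_pathField hc.measurable hc.bound (hτ.measurable ε) hBm] at h
  exact h

/-- Exponential moments along pairs of Brownian paths converge in mean square. -/
lemma tendsto_sq_pairMoment_sub (hc : IsMixingField P c K C δ) (hτ : IsClock P c Ψ T τ)
    (hB : IsPreBrownianReal B PB) (hBm : Measurable (Function.uncurry B))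
    (hΨ : IsCorrKernel Ψ D) (hT : 0 ≤ T) {θ₁ θ₂ : ℝ} (hθ₁ : |θ₁| ≤ 1) (hθ₂ : |θ₂| ≤ 1) :
    ∃ R, (∀ᶠ ε in 𝓝[>] 0, ∀ ω, |pairMoment P c (τ ε) B x T ε θ₁ θ₂ ω| ≤ R) ∧
    Tendsto (fun ε => ∫ ω, (pairMoment P c (τ ε) B x T ε θ₁ θ₂ ω
      - Real.exp ((θ₁ ^ 2 + θ₂ ^ 2) * (T * kernelConst PB B Ψ))) ^ 2 ∂(PB.prod PB))
      (𝓝[>] 0) (𝓝 0) := by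
  set s := (θ₁ ^ 2 + θ₂ ^ 2) * (T * kernelConst PB B Ψ) with hs
  set η : ℝ → ℝ := fun ε => expErr (2 * K) (8 * K ^ 2 * C)
    ((4 * K + 8 * K ^ 2) * C * (1 + window δ ε) ^ (-(2 + δ))) ε (window δ ε) * T with hη
  have hη0 : Tendsto η (𝓝[>] 0) (𝓝 0) := by
    have := (tendsto_expErr hc.pos (2 * K) (8 * K ^ 2 * C) ((4 * K + 8 * K ^ 2) * C)).mul_const T
    rwa [zero_mul] at this
  have hD : 0 ≤ D := by simpa using (abs_nonneg _).trans (hΨ.bound 0 le_rfl 0)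
  -- `R` dominates the limit `s` and, once the error is below `1`, also the logarithm of every
  -- moment.
  set R := 4 * (D * T) + 1 + |s| with hR
  have hDT : 0 ≤ 4 * (D * T) := by positivity
  have hlog : ∀ᶠ ε in 𝓝[>] (0:ℝ), ∀ ω,
      Real.log (pairMoment P c (τ ε) B x T ε θ₁ θ₂ ω) ≤ R := by
    filter_upwards [self_mem_nhdsWithin, hη0.eventually (gt_mem_nhds one_pos)] with ε hε h1 ω
    have a := abs_log_pairMoment_sub_le (x := x) hc hτ hBm hΨ hε hT hθ₁ hθ₂ ω
    have b := abs_pairCov_le (B := B) hΨ hε hT hθ₁ hθ₂ ω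
    have a' := (abs_le.1 a).2
    have b' := (abs_le.1 b).2
    have := abs_nonneg s
    simp only [hη] at h1
    linarith
  have hM : ∀ᶠ ε in 𝓝[>] (0:ℝ), ∀ ω, |pairMoment P c (τ ε) B x T ε θ₁ θ₂ ω| ≤ Real.exp R := by
    filter_upwards [self_mem_nhdsWithin, hlog] with ε hε h ω
    have hp := pairMoment_pos (x := x) hc hτ hBm hε hT θ₁ θ₂ ω
    rw [abs_of_pos hp]
    exact (Real.log_le_iff_le_exp hp).1 (h ω)
  refine ⟨Real.exp R, hM, ?_⟩
  have lim := (hη0.add (tendsto_pairCov hB hBm hΨ hT θ₁ θ₂)).const_mul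
    (2 * Real.exp R * Real.exp R)
  rw [add_zero, mul_zero] at lim
  refine squeeze_zero' (Eventually.of_forall fun ε => integral_nonneg fun ω => sq_nonneg _) ?_ lim
  filter_upwards [self_mem_nhdsWithin, hlog, hM] with ε hε hl hm
  have iV : Integrable (fun ω => |pairCov Ψ B T ε θ₁ θ₂ ω - s|) (PB.prod PB) :=
    ((integrable_of_measurable_bdd (measurable_pairCov hBm hΨ.measurable T ε θ₁ θ₂)
      (abs_pairCov_le hΨ hε hT hθ₁ hθ₂)).sub (integrable_const _)).abs
  have iV' : Integrable (fun ω => η ε + |pairCov Ψ B T ε θ₁ θ₂ ω - s|) (PB.prod PB) :=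
    (integrable_const _).add iV
  have e : η ε + ∫ ω, |pairCov Ψ B T ε θ₁ θ₂ ω - s| ∂(PB.prod PB)
      = ∫ ω, (η ε + |pairCov Ψ B T ε θ₁ θ₂ ω - s|) ∂(PB.prod PB) := by
    rw [integral_add (integrable_const _) iV]; simp
  rw [e, ← integral_const_mul]
  refine integral_mono_of_nonneg (ae_of_all _ fun ω => sq_nonneg _) (iV'.const_mul _)
    (ae_of_all _ fun ω => ?_)
  dsimp only
  set M := pairMoment P c (τ ε) B x T ε θ₁ θ₂ ω with hMdef
  have hp : 0 < M := pairMoment_pos hc hτ hBm hε hT θ₁ θ₂ ω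
  have hsR : s ≤ R := (le_abs_self s).trans (by linarith)
  have h1 : |M - Real.exp s| ≤ Real.exp R * |Real.log M - s| := by
    have := abs_exp_sub_exp_le_mul (hl ω) hsR
    rwa [Real.exp_log hp] at this
  have h2 : |M - Real.exp s| ≤ 2 * Real.exp R := by
    have := (abs_sub M (Real.exp s)).trans (add_le_add (hm ω) (le_of_eq (abs_of_pos (Real.exp_pos s))))
    have h := Real.exp_le_exp.2 hsR
    linarith
  have h3 : |Real.log M - s| ≤ η ε + |pairCov Ψ B T ε θ₁ θ₂ ω - s| :=
    (abs_sub_le _ (pairCov Ψ B T ε θ₁ θ₂ ω) _).trans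
      (add_le_add (abs_log_pairMoment_sub_le hc hτ hBm hΨ hε hT hθ₁ hθ₂ ω) le_rfl)
  -- One factor is bounded uniformly, the other by the distance of the logarithms, whose mean tends
  -- to zero.
  calc (M - Real.exp s) ^ 2 = |M - Real.exp s| * |M - Real.exp s| := by rw [← sq, sq_abs]
    _ ≤ (2 * Real.exp R) * (Real.exp R * |Real.log M - s|) :=
        mul_le_mul h2 h1 (abs_nonneg _) (by positivity)
    _ ≤ (2 * Real.exp R) * (Real.exp R * (η ε + |pairCov Ψ B T ε θ₁ θ₂ ω - s|)) := by gcongr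
    _ = _ := by ring

lemma memLp_mul_prod (hγ : MemLp γ 2 PB) :
    MemLp (fun ω : Ω × Ω => γ ω.1 * γ ω.2) 2 (PB.prod PB) := by
  rw [memLp_two_iff_integrable_sq]
  · have := hγ.integrable_sq.mul_prod hγ.integrable_sq
    simpa only [mul_pow] using this
  · exact hγ.1.comp_fst.mul hγ.1.comp_snd

/-- The limit of second moments of Brownian functionals of the field. -/
lemma tendsto_integral_mul_pairMoment (hc : IsMixingField P c K C δ) (hτ : IsClock P c Ψ T τ)
    (hB : IsPreBrownianReal B PB) (hBm : Measurable (Function.uncurry B))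
    (hΨ : IsCorrKernel Ψ D) (hT : 0 ≤ T) {θ₁ θ₂ : ℝ} (hθ₁ : |θ₁| ≤ 1) (hθ₂ : |θ₂| ≤ 1)
    (hγ : MemLp γ 2 PB) :
    Tendsto (fun ε => ∫ ω, γ ω.1 * γ ω.2 * pairMoment P c (τ ε) B x T ε θ₁ θ₂ ω ∂(PB.prod PB))
      (𝓝[>] 0) (𝓝 (Real.exp ((θ₁ ^ 2 + θ₂ ^ 2) * (T * kernelConst PB B Ψ)) * (∫ ω, γ ω ∂PB) ^ 2)) := by
  obtain ⟨R, hR, lim⟩ := tendsto_sq_pairMoment_sub (x := x) hc hτ hB hBm hΨ hT hθ₁ hθ₂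
  set q := Real.exp ((θ₁ ^ 2 + θ₂ ^ 2) * (T * kernelConst PB B Ψ)) with hq
  have hγ2 := memLp_mul_prod hγ
  have hγi : Integrable (fun ω : Ω × Ω => γ ω.1 * γ ω.2) (PB.prod PB) := hγ2.integrable (by simp)
  have e : ∫ ω, γ ω.1 * γ ω.2 ∂(PB.prod PB) = (∫ ω, γ ω ∂PB) ^ 2 := by
    rw [integral_prod_mul, sq]
  -- The weight `γ ω.1 * γ ω.2` is only square integrable, so it is paired with the mean square
  -- convergence by Cauchy–Schwarz.
  have l2 := (lim.sqrt).const_mul (√(∫ ω, (γ ω.1 * γ ω.2) ^ 2 ∂(PB.prod PB)))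
  rw [Real.sqrt_zero, mul_zero] at l2
  rw [tendsto_iff_norm_sub_tendsto_zero]
  refine squeeze_zero' (Eventually.of_forall fun ε => norm_nonneg _) ?_ l2
  filter_upwards [hR] with ε hε
  have hMm := measurable_pairMoment (P := P) (x := x) (T := T) (ε := ε) hc.measurable
    (hτ.measurable ε) hBm θ₁ θ₂
  have hM : MemLp (fun ω => pairMoment P c (τ ε) B x T ε θ₁ θ₂ ω - q) 2 (PB.prod PB) :=
    (MemLp.of_bound hMm.aestronglyMeasurable R (ae_of_all _ hε)).sub (memLp_const q)
  have i1 : Integrable (fun ω => γ ω.1 * γ ω.2 * pairMoment P c (τ ε) B x T ε θ₁ θ₂ ω)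
      (PB.prod PB) := hγi.mul_bdd hMm.aestronglyMeasurable (ae_of_all _ hε)
  refine le_trans ?_ (integral_abs_mul_le_sqrt hγ2 hM)
  rw [← e, ← integral_const_mul, ← integral_sub i1 (hγi.const_mul _)]
  refine (norm_integral_le_integral_norm _).trans (le_of_eq ?_)
  congr 1; ext ω
  rw [Real.norm_eq_abs]
  congr 1
  ring

lemma measurable_exp_fieldInt_sub (hc : IsMixingField P c K C δ) (hτ : IsClock P c Ψ T τ)
    (hBm : Measurable (Function.uncurry B)) (a : ℝ) :
    Measurable fun p : S × Ω => Real.exp (fieldInt c (τ ε) B x T ε p.1 p.2) - a :=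
  (measurable_fieldInt hc.measurable (hτ.measurable ε) hBm).exp.sub_const _

lemma abs_exp_fieldInt_sub_le (hc : IsMixingField P c K C δ) (hε : 0 < ε) (hT : 0 ≤ T)
    {τ : ℝ → ℝ≥0} (s : S) (ω : Ω) (a : ℝ) :
    |Real.exp (fieldInt c τ B x T ε s ω) - a| ≤ Real.exp (ε⁻¹ * (K * T)) + |a| := by
  refine (abs_sub _ _).trans (add_le_add ?_ le_rfl)
  rw [abs_of_pos (Real.exp_pos _)]
  exact Real.exp_le_exp.2 ((le_abs_self _).trans (abs_fieldInt_le hc.bound hε hT _ _))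

lemma integrable_mul_exp_fieldInt (hc : IsMixingField P c K C δ) (hτ : IsClock P c Ψ T τ)
    (hBm : Measurable (Function.uncurry B)) (hε : 0 < ε) (hT : 0 ≤ T) (hγ : Integrable γ PB)
    (s : S) (a : ℝ) :
    Integrable (fun ω => γ ω * (Real.exp (fieldInt c (τ ε) B x T ε s ω) - a)) PB := by
  refine hγ.mul_bdd (Measurable.aestronglyMeasurable ?_)
    (ae_of_all _ fun ω => abs_exp_fieldInt_sub_le hc hε hT s ω a)
  exact (measurable_exp_fieldInt_sub (x := x) (ε := ε) hc hτ hBm a).comp (f := fun ω => (s, ω))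
    (by fun_prop)

lemma memLp_integral_mul_exp_fieldInt (hc : IsMixingField P c K C δ) (hτ : IsClock P c Ψ T τ)
    (hBm : Measurable (Function.uncurry B)) (hε : 0 < ε) (hT : 0 ≤ T) (hγ : Integrable γ PB)
    (a : ℝ) (p : ℝ≥0∞) :
    MemLp (fun s => ∫ ω, γ ω * (Real.exp (fieldInt c (τ ε) B x T ε s ω) - a) ∂PB) p P := by
  have hm : AEStronglyMeasurable (fun z : S × Ω =>
      γ z.2 * (Real.exp (fieldInt c (τ ε) B x T ε z.1 z.2) - a)) (P.prod PB) :=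
    hγ.1.comp_snd.mul (measurable_exp_fieldInt_sub hc hτ hBm a).aestronglyMeasurable
  refine MemLp.of_bound hm.integral_prod_right'
    (∫ ω, |γ ω| * (Real.exp (ε⁻¹ * (K * T)) + |a|) ∂PB) (ae_of_all _ fun s => ?_)
  refine (norm_integral_le_integral_norm _).trans (integral_mono_of_nonneg
    (ae_of_all _ fun ω => norm_nonneg _) (hγ.abs.mul_const _) (ae_of_all _ fun ω => ?_))
  dsimp only
  rw [norm_mul]
  exact mul_le_mul_of_nonneg_left (abs_exp_fieldInt_sub_le hc hε hT s ω a) (abs_nonneg _)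

lemma integral_linear_combination {α : Type*} [MeasurableSpace α] {μ : Measure α}
    {f₁ f₂ f₃ f₄ : α → ℝ} (h₁ : Integrable f₁ μ) (h₂ : Integrable f₂ μ) (h₃ : Integrable f₃ μ)
    (h₄ : Integrable f₄ μ) {a b : ℝ} :
    ∫ z, (f₁ z - a * f₂ z - a * f₃ z + b * f₄ z) ∂μ
      = ∫ z, f₁ z ∂μ - a * ∫ z, f₂ z ∂μ - a * ∫ z, f₃ z ∂μ + b * ∫ z, f₄ z ∂μ := by
  have k : Integrable (fun z => f₁ z - a * f₂ z) μ := h₁.sub (h₂.const_mul a)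
  have k' : Integrable (fun z => f₁ z - a * f₂ z - a * f₃ z) μ := k.sub (h₃.const_mul a)
  rw [integral_add k' (h₄.const_mul b), integral_sub k (h₃.const_mul a),
    integral_sub h₁ (h₂.const_mul a)]
  simp only [integral_const_mul]

/-- The square of a Brownian expectation is an expectation over two independent copies. Fubini puts
the field average inside, and the exponents `0` and `1` encode the four terms of the product of `exp
- a` over the two copies. -/
lemma integral_sq_eq_pairMoments (hc : IsMixingField P c K C δ) (hτ : IsClock P c Ψ T τ)
    (hBm : Measurable (Function.uncurry B)) (hε : 0 < ε) (hT : 0 ≤ T) (hγ : MemLp γ 2 PB) (a : ℝ) :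
    ∫ s, (∫ ω, γ ω * (Real.exp (fieldInt c (τ ε) B x T ε s ω) - a) ∂PB) ^ 2 ∂P
      = ∫ ω, γ ω.1 * γ ω.2 * pairMoment P c (τ ε) B x T ε 1 1 ω ∂(PB.prod PB)
        - a * ∫ ω, γ ω.1 * γ ω.2 * pairMoment P c (τ ε) B x T ε 1 0 ω ∂(PB.prod PB)
        - a * ∫ ω, γ ω.1 * γ ω.2 * pairMoment P c (τ ε) B x T ε 0 1 ω ∂(PB.prod PB)
        + a ^ 2 * ∫ ω, γ ω.1 * γ ω.2 * pairMoment P c (τ ε) B x T ε 0 0 ω ∂(PB.prod PB) := by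
  have hγi : Integrable (fun ω : Ω × Ω => γ ω.1 * γ ω.2) (PB.prod PB) :=
    (memLp_mul_prod hγ).integrable (by simp)
  set R := Real.exp (ε⁻¹ * (K * T)) with hR
  have mF : ∀ θ₁ θ₂ : ℝ, Measurable fun z : S × (Ω × Ω) =>
      Real.exp (θ₁ * fieldInt c (τ ε) B x T ε z.1 z.2.1 + θ₂ * fieldInt c (τ ε) B x T ε z.1 z.2.2) :=
    fun θ₁ θ₂ => (measurable_pairExp (x := x) (T := T) (ε := ε) hc.measurable (hτ.measurable ε)
      hBm θ₁ θ₂).comp measurable_swap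
  have bF : ∀ θ₁ θ₂ : ℝ, |θ₁| ≤ 1 → |θ₂| ≤ 1 → ∀ z : S × (Ω × Ω),
      |Real.exp (θ₁ * fieldInt c (τ ε) B x T ε z.1 z.2.1 + θ₂ * fieldInt c (τ ε) B x T ε z.1 z.2.2)|
        ≤ R * R := by
    intro θ₁ θ₂ h₁ h₂ z
    rw [abs_of_pos (Real.exp_pos _), hR, ← Real.exp_add]
    refine Real.exp_le_exp.2 (add_le_add ?_ ?_)
    all_goals
      refine (le_abs_self _).trans ?_
      rw [abs_mul]
      refine (mul_le_of_le_one_left (abs_nonneg _) (by assumption)).trans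
        (abs_fieldInt_le hc.bound hε hT _ _)
  have iF : ∀ θ₁ θ₂ : ℝ, |θ₁| ≤ 1 → |θ₂| ≤ 1 → Integrable (fun z : S × (Ω × Ω) => γ z.2.1 * γ z.2.2 *
      Real.exp (θ₁ * fieldInt c (τ ε) B x T ε z.1 z.2.1 + θ₂ * fieldInt c (τ ε) B x T ε z.1 z.2.2))
      (P.prod (PB.prod PB)) := fun θ₁ θ₂ h₁ h₂ =>
    (hγi.comp_snd P).mul_bdd (mF θ₁ θ₂).aestronglyMeasurable (ae_of_all _ (bF θ₁ θ₂ h₁ h₂))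
  have eF : ∀ θ₁ θ₂ : ℝ, |θ₁| ≤ 1 → |θ₂| ≤ 1 → ∫ z : S × (Ω × Ω), γ z.2.1 * γ z.2.2 *
      Real.exp (θ₁ * fieldInt c (τ ε) B x T ε z.1 z.2.1 + θ₂ * fieldInt c (τ ε) B x T ε z.1 z.2.2)
      ∂(P.prod (PB.prod PB))
      = ∫ ω, γ ω.1 * γ ω.2 * pairMoment P c (τ ε) B x T ε θ₁ θ₂ ω ∂(PB.prod PB) := by
    intro θ₁ θ₂ h₁ h₂
    rw [integral_prod_symm _ (iF θ₁ θ₂ h₁ h₂)]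
    congr 1; ext ω
    exact integral_const_mul (μ := P) (γ ω.1 * γ ω.2) _
  have n1 : |(1:ℝ)| ≤ 1 := by simp
  have n0 : |(0:ℝ)| ≤ 1 := by simp
  set f : S × (Ω × Ω) → ℝ := fun z => γ z.2.1 * γ z.2.2 *
      ((Real.exp (fieldInt c (τ ε) B x T ε z.1 z.2.1) - a)
        * (Real.exp (fieldInt c (τ ε) B x T ε z.1 z.2.2) - a)) with hf
  have ef : f = fun z => γ z.2.1 * γ z.2.2 *
      Real.exp (1 * fieldInt c (τ ε) B x T ε z.1 z.2.1 + 1 * fieldInt c (τ ε) B x T ε z.1 z.2.2)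
      - a * (γ z.2.1 * γ z.2.2 *
      Real.exp (1 * fieldInt c (τ ε) B x T ε z.1 z.2.1 + 0 * fieldInt c (τ ε) B x T ε z.1 z.2.2))
      - a * (γ z.2.1 * γ z.2.2 *
      Real.exp (0 * fieldInt c (τ ε) B x T ε z.1 z.2.1 + 1 * fieldInt c (τ ε) B x T ε z.1 z.2.2))
      + a ^ 2 * (γ z.2.1 * γ z.2.2 *
      Real.exp (0 * fieldInt c (τ ε) B x T ε z.1 z.2.1 + 0 * fieldInt c (τ ε) B x T ε z.1 z.2.2)) := by
    ext z
    simp only [hf, one_mul, zero_mul, zero_add, add_zero, Real.exp_zero, Real.exp_add]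
    ring
  have i11 := iF 1 1 n1 n1
  have i10 := iF 1 0 n1 n0
  have i01 := iF 0 1 n0 n1
  have i00 := iF 0 0 n0 n0
  have ifn : Integrable f (P.prod (PB.prod PB)) := by
    rw [ef]; exact ((i11.sub (i10.const_mul _)).sub (i01.const_mul _)).add (i00.const_mul _)
  have e1 : ∀ s, (∫ ω, γ ω * (Real.exp (fieldInt c (τ ε) B x T ε s ω) - a) ∂PB) ^ 2
      = ∫ ω, f (s, ω) ∂(PB.prod PB) := by
    intro s
    rw [sq, ← integral_prod_mul]
    congr 1; ext ω
    simp only [hf]; ring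
  simp_rw [e1]
  rw [← integral_prod _ ifn, ef, integral_linear_combination i11 i10 i01 i00, eF 1 1 n1 n1,
    eF 1 0 n1 n0, eF 0 1 n0 n1, eF 0 0 n0 n0]

/-- Brownian functionals of the rescaled field homogenize in mean square. -/
theorem tendsto_integral_sq_exp_fieldInt (hc : IsMixingField P c K C δ) (hτ : IsClock P c Ψ T τ)
    (hB : IsPreBrownianReal B PB) (hBm : Measurable (Function.uncurry B))
    (hΨ : IsCorrKernel Ψ D) (hT : 0 ≤ T) (hγ : MemLp γ 2 PB) :
    Tendsto (fun ε => ∫ s, (∫ ω, γ ω * (Real.exp (fieldInt c (τ ε) B x T ε s ω)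
      - Real.exp (T * kernelConst PB B Ψ)) ∂PB) ^ 2 ∂P) (𝓝[>] 0) (𝓝 0) := by
  have n1 : |(1:ℝ)| ≤ 1 := by simp
  have n0 : |(0:ℝ)| ≤ 1 := by simp
  set a := Real.exp (T * kernelConst PB B Ψ) with ha
  have l11 := tendsto_integral_mul_pairMoment (x := x) hc hτ hB hBm hΨ hT n1 n1 hγ
  have l10 := tendsto_integral_mul_pairMoment (x := x) hc hτ hB hBm hΨ hT n1 n0 hγ
  have l01 := tendsto_integral_mul_pairMoment (x := x) hc hτ hB hBm hΨ hT n0 n1 hγ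
  have l00 := tendsto_integral_mul_pairMoment (x := x) hc hτ hB hBm hΨ hT n0 n0 hγ
  have l := ((l11.sub (l10.const_mul a)).sub (l01.const_mul a)).add (l00.const_mul (a ^ 2))
  have e : Real.exp (((1:ℝ) ^ 2 + 1 ^ 2) * (T * kernelConst PB B Ψ)) = a ^ 2 := by
    rw [ha, ← Real.exp_nat_mul]; norm_num
  have e1 : Real.exp (((1:ℝ) ^ 2 + 0 ^ 2) * (T * kernelConst PB B Ψ)) = a := by
    rw [ha]; norm_num
  have e2 : Real.exp (((0:ℝ) ^ 2 + 1 ^ 2) * (T * kernelConst PB B Ψ)) = a := by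
    rw [ha]; norm_num
  have e3 : Real.exp (((0:ℝ) ^ 2 + 0 ^ 2) * (T * kernelConst PB B Ψ)) = 1 := by
    norm_num
  rw [e, e1, e2, e3] at l
  -- The cancellation rests on the absence of a mixed term in the limit: the moment with both
  -- exponents equal to `1` tends to `a²`.
  have z : a ^ 2 * (∫ ω, γ ω ∂PB) ^ 2 - a * (a * (∫ ω, γ ω ∂PB) ^ 2) - a * (a * (∫ ω, γ ω ∂PB) ^ 2)
    + a ^ 2 * (1 * (∫ ω, γ ω ∂PB) ^ 2) = 0 := by ring
  rw [z] at l
  refine l.congr' ?_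
  filter_upwards [self_mem_nhdsWithin] with ε hε
  exact (integral_sq_eq_pairMoments hc hτ hBm hε hT hγ a).symm

end MeanSquare


/-! ### Evaluation of paths through dyadic times. -/

section PathRegularization

/-- The value at `u` of a path read off its dyadic approximations. -/
def dyadicReg (b : ℝ≥0 → ℝ) (u : ℝ≥0) : ℝ :=
  limUnder atTop fun n : ℕ => b ((⌊(2:ℝ≥0) ^ n * u⌋₊ : ℝ≥0) / 2 ^ n)

/-- Evaluation `(b, u) ↦ b u` is not measurable for the product σ-algebra. Each dyadic approximation
involves countably many coordinates, selected by a measurable integer, and is therefore measurable.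
-/
lemma measurable_dyadicReg : Measurable fun p : (ℝ≥0 → ℝ) × ℝ≥0 => dyadicReg p.1 p.2 := by
  refine StronglyMeasurable.measurable (StronglyMeasurable.limUnder
    (f := fun n (p : (ℝ≥0 → ℝ) × ℝ≥0) => p.1 ((⌊(2:ℝ≥0) ^ n * p.2⌋₊ : ℝ≥0) / 2 ^ n)) fun n => ?_)
  refine Measurable.stronglyMeasurable ?_
  have h : Measurable fun q : (ℝ≥0 → ℝ) × ℕ => q.1 ((q.2 : ℝ≥0) / 2 ^ n) :=
    measurable_from_prod_countable_left fun k => measurable_pi_apply ((k : ℝ≥0) / 2 ^ n)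
  exact h.comp (g := fun q : (ℝ≥0 → ℝ) × ℕ => q.1 ((q.2 : ℝ≥0) / 2 ^ n))
    (f := fun p : (ℝ≥0 → ℝ) × ℝ≥0 => (p.1, ⌊(2:ℝ≥0) ^ n * p.2⌋₊))
    (measurable_fst.prodMk (Nat.measurable_floor.comp (measurable_snd.const_mul _)))

/-- The points `⌊2ⁿu⌋ / 2ⁿ` converge to `u`. Only countably many values of `b'` matter, so a
modification of a continuous process determines its paths almost surely. -/
lemma dyadicReg_eq {b b' : ℝ≥0 → ℝ} (hb : Continuous b)
    (h : ∀ n k : ℕ, b' ((k : ℝ≥0) / 2 ^ n) = b ((k : ℝ≥0) / 2 ^ n)) (u : ℝ≥0) :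
    dyadicReg b' u = b u := by
  unfold dyadicReg
  simp_rw [h]
  refine Tendsto.limUnder_eq ((hb.tendsto u).comp ?_)
  have h2 : Tendsto (fun n : ℕ => (2:ℝ≥0) ^ n) atTop atTop :=
    tendsto_pow_atTop_atTop_of_one_lt (by norm_num)
  have := (tendsto_nat_floor_mul_div_atTop (R := ℝ) (a := (u : ℝ)) u.2).comp
    (tendsto_pow_atTop_atTop_of_one_lt (r := (2:ℝ)) (by norm_num))
  rw [← NNReal.tendsto_coe]
  refine this.congr fun n => ?_
  simp only [Function.comp, NNReal.coe_div, NNReal.coe_natCast, NNReal.coe_pow, NNReal.coe_ofNat]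
  congr 2
  rw [mul_comm]
  exact (Nonneg.nat_floor_coe ((2:ℝ≥0) ^ n * u)).trans rfl

end PathRegularization

/-! ### The Markov property for path functionals with a time dependent potential. -/

section FeynmanKac

variable {Ω : Type*} [mΩ : MeasurableSpace Ω] {PB : Measure Ω} [IsProbabilityMeasure PB]
  {B : ℝ≥0 → Ω → ℝ} {V : ℝ → ℝ → ℝ} {g : ℝ → ℝ} {M : ℝ}

lemma map_path_eq {X Y : ℝ≥0 → Ω → ℝ} (hX : IsPreBrownianReal X PB) (hY : IsPreBrownianReal Y PB)
    (mX : ∀ t, Measurable (X t)) (mY : ∀ t, Measurable (Y t)) :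
    PB.map (fun ω => (X · ω)) = PB.map (fun ω => (Y · ω)) :=
  (map_eq_iff_forall_finset_map_restrict_eq (measurable_pi_lambda _ mX).aemeasurable
    (measurable_pi_lambda _ mY).aemeasurable).2 fun I => by
      rw [(hX.hasLaw I).map_eq, (hY.hasLaw I).map_eq]

/-- The Markov property of Brownian motion for functionals of the whole path. -/
lemma integral_markov (hB : IsPreBrownianReal B PB) (hBm : Measurable (Function.uncurry B))
    (u : ℝ≥0) {F : ℝ × (ℝ≥0 → ℝ) → ℝ} (hF : Measurable F)
    (hFi : Integrable (fun ω => F (B u ω, fun t => B (u + t) ω - B u ω)) PB) :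
    ∫ ω, F (B u ω, fun t => B (u + t) ω - B u ω) ∂PB
      = ∫ ω, ∫ ω', F (B u ω, fun t => B t ω') ∂PB ∂PB := by
  have mB : ∀ t, Measurable (B t) := fun t => hBm.comp (measurable_const.prodMk measurable_id)
  have mP : Measurable fun ω => (B · ω) := measurable_pi_lambda _ mB
  have mZ : Measurable fun ω => (fun t => B (u + t) ω - B u ω : ℝ≥0 → ℝ) :=
    measurable_pi_lambda _ fun t => (mB _).sub (mB _)
  have hind : IndepFun (B u) (fun ω t => B (u + t) ω - B u ω) PB :=
    ((hB.indepFun_shift u).comp measurable_id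
      (measurable_pi_apply (⟨u, mem_Iic.2 le_rfl⟩ : Iic u))).symm
  -- The restarted path is independent of the position at time `u` and has the law of `B`, so the
  -- pair has the law of the position and an independent copy.
  have e : PB.map (fun ω => (B u ω, fun t => B (u + t) ω - B u ω))
      = (PB.prod PB).map (Prod.map (B u) (fun ω => (B · ω))) := by
    rw [(indepFun_iff_map_prod_eq_prod_map_map (mB u).aemeasurable mZ.aemeasurable).1 hind,
      map_path_eq (hB.shift u) hB (fun t => (mB _).sub (mB _)) mB, Measure.map_prod_map _ _ (mB u) mP]
  have i0 : Integrable F ((PB.prod PB).map (Prod.map (B u) (fun ω => (B · ω)))) := by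
    rw [← e, integrable_map_measure hF.aestronglyMeasurable ((mB u).prodMk mZ).aemeasurable]
    exact hFi
  have i1 : Integrable (fun p : Ω × Ω => F (B u p.1, (B · p.2))) (PB.prod PB) := by
    rw [integrable_map_measure hF.aestronglyMeasurable ((mB u).prodMap mP).aemeasurable] at i0
    exact i0
  rw [← integral_prod (fun p : Ω × Ω => F (B u p.1, (B · p.2))) i1,
    ← integral_map (f := F) ((mB u).prodMk mZ).aemeasurable hF.aestronglyMeasurable, e,
    integral_map ((mB u).prodMap mP).aemeasurable hF.aestronglyMeasurable]
  rfl

/-- The Feynman–Kac functional of a path `b` started at `y`, for a time dependent potential. -/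
def fkPath (V : ℝ → ℝ → ℝ) (g : ℝ → ℝ) (t y : ℝ) (b : ℝ≥0 → ℝ) : ℝ :=
  g (y + b t.toNNReal) * Real.exp (∫ r in (0:ℝ)..t, V (t - r) (y + b r.toNNReal))

/-- The Feynman–Kac solution. -/
def fkSol (PB : Measure Ω) (B : ℝ≥0 → Ω → ℝ) (V : ℝ → ℝ → ℝ) (g : ℝ → ℝ) (t x : ℝ) : ℝ :=
  ∫ ω, fkPath V g t x (B · ω) ∂PB

/-- The Markov property is an identity of laws on path space and requires measurability in the path
itself; `dyadicReg` provides it. -/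
lemma measurable_fkPath_reg (hV : Measurable (Function.uncurry V)) (hg : Measurable g) (t : ℝ) :
    Measurable fun p : ℝ × (ℝ≥0 → ℝ) => fkPath V g t p.1 (dyadicReg p.2) := by
  unfold fkPath
  refine Measurable.mul (hg.comp (measurable_fst.add ?_)) (Real.measurable_exp.comp ?_)
  · exact measurable_dyadicReg.comp (measurable_snd.prodMk measurable_const)
  · refine measurable_intervalIntegral_param
      (X := fun r (p : ℝ × (ℝ≥0 → ℝ)) => V (t - r) (p.1 + dyadicReg p.2 r.toNNReal)) ?_
      measurable_const measurable_const
    refine hV.comp (Measurable.prodMk (by fun_prop) (Measurable.add (by fun_prop) ?_))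
    exact measurable_dyadicReg.comp
      (by fun_prop : Measurable fun q : ℝ × (ℝ × (ℝ≥0 → ℝ)) => (q.2.2, q.1.toNNReal))

lemma measurable_path_potential (hBm : Measurable (Function.uncurry B))
    (hV : Measurable (Function.uncurry V)) {α : Type*} [MeasurableSpace α] {f r x : α → ℝ}
    {w : α → Ω} (hf : Measurable f) (hr : Measurable r) (hx : Measurable x) (hw : Measurable w) :
    Measurable fun p => V (f p) (x p + B (r p).toNNReal (w p)) :=
  hV.comp (hf.prodMk (hx.add (hBm.comp (hr.real_toNNReal.prodMk hw))))

lemma measurable_fkPath (hBm : Measurable (Function.uncurry B))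
    (hV : Measurable (Function.uncurry V)) (hg : Measurable g) :
    Measurable fun p : (ℝ × ℝ) × Ω => fkPath V g p.1.1 p.1.2 (B · p.2) := by
  unfold fkPath
  refine Measurable.mul (hg.comp (Measurable.add (by fun_prop) ?_)) (Real.measurable_exp.comp ?_)
  · exact hBm.comp (by fun_prop : Measurable fun p : (ℝ × ℝ) × Ω => (p.1.1.toNNReal, p.2))
  · refine measurable_intervalIntegral_param
      (X := fun r (p : (ℝ × ℝ) × Ω) => V (p.1.1 - r) (p.1.2 + B r.toNNReal p.2)) ?_
      measurable_const (by fun_prop)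
    exact measurable_path_potential hBm hV (by fun_prop) (by fun_prop) (by fun_prop) (by fun_prop)

lemma measurable_fkSol (hBm : Measurable (Function.uncurry B))
    (hV : Measurable (Function.uncurry V)) (hg : Measurable g) :
    Measurable fun p : ℝ × ℝ => fkSol PB B V g p.1 p.2 :=
  (StronglyMeasurable.integral_prod_right' (ν := PB) (f := fun p : (ℝ × ℝ) × Ω =>
    fkPath V g p.1.1 p.1.2 (B · p.2)) (measurable_fkPath hBm hV hg).stronglyMeasurable).measurable

lemma exp_integral_le (hM : ∀ t x, |V t x| ≤ M) {a b : ℝ} (hab : a ≤ b) (f : ℝ → ℝ) (t : ℝ) :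
    Real.exp (∫ r in a..b, V (t - r) (f r)) ≤ Real.exp (M * (b - a)) := by
  refine Real.exp_le_exp.2 ((le_abs_self _).trans ?_)
  have := intervalIntegral.norm_integral_le_of_norm_le_const (E := ℝ) (a := a) (b := b)
    (f := fun r => V (t - r) (f r)) (C := M) fun r _ => hM _ _
  rwa [abs_of_nonneg (sub_nonneg.2 hab)] at this

lemma abs_fkPath_le (hM : ∀ t x, |V t x| ≤ M) {t : ℝ} (ht : 0 ≤ t) (y : ℝ) (b : ℝ≥0 → ℝ) :
    |fkPath V g t y b| ≤ Real.exp (M * t) * |g (y + b t.toNNReal)| := by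
  unfold fkPath
  rw [abs_mul, abs_of_pos (Real.exp_pos _), mul_comm]
  have := exp_integral_le hM ht (fun r => y + b r.toNNReal) t
  rw [sub_zero] at this
  gcongr

/-- The Markov property for the Feynman–Kac functional. -/
lemma integral_fk_markov (hB : IsBrownianReal B PB) (hBm : Measurable (Function.uncurry B))
    (hV : Measurable (Function.uncurry V)) (hM : ∀ t x, |V t x| ≤ M) (hg : Measurable g)
    {t u : ℝ} (hu : 0 ≤ u) (hut : u ≤ t) (x : ℝ)
    (hgi : Integrable (fun ω => g (x + B t.toNNReal ω)) PB) :
    ∫ ω, V (t - u) (x + B u.toNNReal ω) * (g (x + B t.toNNReal ω)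
        * Real.exp (∫ r in u..t, V (t - r) (x + B r.toNNReal ω))) ∂PB
      = ∫ ω, V (t - u) (x + B u.toNNReal ω) * fkSol PB B V g (t - u) (x + B u.toNNReal ω) ∂PB := by
  set F : ℝ × (ℝ≥0 → ℝ) → ℝ := fun p =>
    V (t - u) (x + p.1) * fkPath V g (t - u) (x + p.1) (dyadicReg p.2) with hFdef
  have mF : Measurable F :=
    (hV.comp (by fun_prop : Measurable fun p : ℝ × (ℝ≥0 → ℝ) => (t - u, x + p.1))).mul
      ((measurable_fkPath_reg hV hg (t - u)).comp
        (by fun_prop : Measurable fun p : ℝ × (ℝ≥0 → ℝ) => (x + p.1, p.2)))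
  have htu : 0 ≤ t - u := sub_nonneg.2 hut
  -- On continuous paths the regularization is the identity, and shifting time by `u` turns the
  -- integral over `[u, t]` into the Feynman–Kac functional with remaining time `t - u`.
  have key : ∀ᵐ ω ∂PB, V (t - u) (x + B u.toNNReal ω) * (g (x + B t.toNNReal ω)
        * Real.exp (∫ r in u..t, V (t - r) (x + B r.toNNReal ω)))
      = F (B u.toNNReal ω, fun s => B (u.toNNReal + s) ω - B u.toNNReal ω) := by
    filter_upwards [hB.cont] with ω hω
    have hc : Continuous fun s => B (u.toNNReal + s) ω - B u.toNNReal ω := by fun_prop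
    have hr : dyadicReg (fun s => B (u.toNNReal + s) ω - B u.toNNReal ω)
        = fun s => B (u.toNNReal + s) ω - B u.toNNReal ω :=
      funext fun s => dyadicReg_eq hc (fun _ _ => rfl) s
    simp only [hFdef, hr, fkPath]
    have e1 : u.toNNReal + (t - u).toNNReal = t.toNNReal := by
      rw [← Real.toNNReal_add hu htu]; congr 1; ring
    have e2 : ∫ r in u..t, V (t - r) (x + B r.toNNReal ω)
        = ∫ r in (0:ℝ)..(t - u), V (t - u - r)
          (x + B u.toNNReal ω + (B (u.toNNReal + r.toNNReal) ω - B u.toNNReal ω)) := by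
      have := intervalIntegral.integral_comp_add_left (a := 0) (b := t - u)
        (fun r => V (t - r) (x + B r.toNNReal ω)) u
      rw [add_zero, add_sub_cancel] at this
      rw [← this]
      refine intervalIntegral.integral_congr fun r hr => ?_
      rw [uIcc_of_le htu] at hr
      rw [Real.toNNReal_add hu hr.1]
      congr 1
      · ring
      · ring
    rw [e1, e2]
    congr 3
    ring
  rw [integral_congr_ae key, integral_markov hB.toIsPreBrownianReal hBm _ mF]
  · refine integral_congr_ae (ae_of_all _ fun ω => ?_)
    simp only [hFdef]
    rw [integral_const_mul]
    congr 1
    unfold fkSol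
    refine integral_congr_ae ?_
    filter_upwards [hB.cont] with ω' hω'
    congr 1
    exact funext fun s => dyadicReg_eq hω' (fun _ _ => rfl) s
  · have m1 : Measurable fun ω => (B u.toNNReal ω, fun s => B (u.toNNReal + s) ω - B u.toNNReal ω) :=
      by
        have mB : ∀ t, Measurable (B t) := fun t => hBm.comp (measurable_const.prodMk measurable_id)
        exact (mB _).prodMk (measurable_pi_lambda _ fun s => (mB _).sub (mB _))
    refine (hgi.norm.const_mul (M * Real.exp (M * (t - u)))).mono' (mF.comp m1).aestronglyMeasurable ?_
    filter_upwards [key] with ω hω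
    change ‖F _‖ ≤ _
    rw [← hω, norm_mul, norm_mul, Real.norm_of_nonneg (Real.exp_pos _).le, mul_assoc,
      mul_comm ‖g _‖]
    have hM0 : 0 ≤ M := (abs_nonneg _).trans (hM 0 0)
    exact mul_le_mul (hM _ _) (mul_le_mul_of_nonneg_right (exp_integral_le hM hut _ t) (norm_nonneg _))
      (by positivity) hM0

end FeynmanKac


/-! ### The Feynman–Kac formula as a mild solution. -/

section MildExistence

variable {Ω : Type*} [mΩ : MeasurableSpace Ω] {PB : Measure Ω} [IsProbabilityMeasure PB]
  {B : ℝ≥0 → Ω → ℝ} {V : ℝ → ℝ → ℝ} {g : ℝ → ℝ} {M : ℝ}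

/-- A square integrable function evaluated at Brownian motion is square integrable. -/
lemma memLp_comp_brownian (hB : IsPreBrownianReal B PB) (hBm : ∀ t, Measurable (B t))
    (hg : Measurable g) (hg2 : MemLp g 2 volume) (t : ℝ≥0) (x : ℝ) :
    MemLp (fun ω => g (x + B t ω)) 2 PB := by
  have hm : Measurable fun ω => g (x + B t ω) := hg.comp ((hBm t).const_add x)
  rcases eq_or_ne t 0 with rfl | ht
  · refine (memLp_const (g x)).ae_eq ?_
    filter_upwards [hB.eval_zero_ae_eq_zero] with ω hω
    rw [hω, add_zero]
  · rw [memLp_two_iff_integrable_sq hm.aestronglyMeasurable]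
    have h := gaussianReal_const_add (hB.hasLaw_eval t) x
    rw [zero_add] at h
    have hi : Integrable (fun y => g y ^ 2) (gaussianReal x t) := by
      rw [gaussianReal_of_var_ne_zero _ ht]
      have := hg2.integrable_sq
      refine (integrable_withDensity_iff_integrable_smul' (measurable_gaussianPDF x t)
        (ae_of_all _ fun _ => gaussianPDF_lt_top)).2 ?_
      refine this.bdd_mul (c := (√(2 * Real.pi * t))⁻¹)
        (measurable_gaussianPDF x t).ennreal_toReal.aestronglyMeasurable (ae_of_all _ fun y => ?_)
      rw [toReal_gaussianPDF, Real.norm_of_nonneg (gaussianPDFReal_nonneg _ _ _)]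
      exact gaussianPDFReal_le _ _ _
    rw [← h.map_eq, integrable_map_measure (hg.pow_const 2).aestronglyMeasurable
      ((hBm t).const_add x).aemeasurable] at hi
    exact hi

lemma fkSol_zero (hB : IsPreBrownianReal B PB) (x : ℝ) : fkSol PB B V g 0 x = g x := by
  unfold fkSol fkPath
  have : ∀ᵐ ω ∂PB, g (x + B (0:ℝ).toNNReal ω)
      * Real.exp (∫ r in (0:ℝ)..0, V (0 - r) (x + B r.toNNReal ω)) = g x := by
    filter_upwards [hB.eval_zero_ae_eq_zero] with ω hω
    rw [Real.toNNReal_zero, hω, intervalIntegral.integral_same]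
    simp
  rw [integral_congr_ae this]
  simp

/-- The Duhamel formula for the Feynman–Kac solution. -/
lemma fkSol_duhamel (hB : IsBrownianReal B PB) (hBm : Measurable (Function.uncurry B))
    (hV : Measurable (Function.uncurry V)) (hM : ∀ t x, |V t x| ≤ M) (hg : Measurable g)
    (hg2 : MemLp g 2 volume) {t : ℝ} (ht : 0 < t) (x : ℝ) :
    fkSol PB B V g t x = (∫ y, gaussianPDFReal x t.toNNReal y * g y) +
      ∫ r in (0 : ℝ)..t, ∫ y, gaussianPDFReal x (t - r).toNNReal y * (V r y * fkSol PB B V g r y) := by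
  have mB : ∀ t, Measurable (B t) := fun t => hBm.comp (measurable_const.prodMk measurable_id)
  have hM0 : 0 ≤ M := (abs_nonneg _).trans (hM 0 0)
  have hgi : Integrable (fun ω => g (x + B t.toNNReal ω)) PB :=
    (memLp_comp_brownian hB.toIsPreBrownianReal mB hg hg2 _ x).integrable (by simp)
  set G : ℝ → Ω → ℝ := fun u ω => V (t - u) (x + B u.toNNReal ω) * (g (x + B t.toNNReal ω)
        * Real.exp (∫ r in u..t, V (t - r) (x + B r.toNNReal ω))) with hG
  have mG : Measurable (Function.uncurry G) := by
    refine Measurable.mul ?_ (Measurable.mul ?_ (Real.measurable_exp.comp ?_))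
    · exact measurable_path_potential hBm hV (by fun_prop) (by fun_prop) measurable_const
        measurable_snd
    · exact hg.comp (measurable_const.add ((mB _).comp measurable_snd))
    · refine measurable_intervalIntegral_param
        (X := fun r (p : ℝ × Ω) => V (t - r) (x + B r.toNNReal p.2)) ?_ measurable_fst
        measurable_const
      exact measurable_path_potential hBm hV (by fun_prop) measurable_fst measurable_const
        (by fun_prop)
  have bG : ∀ u ∈ Ioc 0 t, ∀ ω, ‖G u ω‖ ≤ M * Real.exp (M * t) * ‖g (x + B t.toNNReal ω)‖ := by
    intro u hu ω
    simp only [hG]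
    rw [norm_mul, norm_mul, Real.norm_of_nonneg (Real.exp_pos _).le, mul_assoc, mul_comm ‖g _‖]
    have h1 := exp_integral_le hM hu.2 (fun r => x + B r.toNNReal ω) t
    have h2 : Real.exp (M * (t - u)) ≤ Real.exp (M * t) := by
      apply Real.exp_le_exp.2
      nlinarith [hu.1]
    exact mul_le_mul (hM _ _) (mul_le_mul_of_nonneg_right (h1.trans h2) (norm_nonneg _))
      (by positivity) hM0
  have iG : Integrable (Function.uncurry G) ((volume.restrict (Ioc 0 t)).prod PB) := by
    have i0 : Integrable (fun p : ℝ × Ω => M * Real.exp (M * t) * ‖g (x + B t.toNNReal p.2)‖)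
        ((volume.restrict (Ioc 0 t)).prod PB) := (hgi.norm.comp_snd _).const_mul _
    refine i0.mono' mG.aestronglyMeasurable ?_
    have : ∀ᵐ u ∂(volume.restrict (Ioc 0 t)), u ∈ Ioc 0 t := ae_restrict_mem measurableSet_Ioc
    filter_upwards [Measure.quasiMeasurePreserving_fst.ae this] with p hp
    exact bG p.1 hp p.2
  -- The exponential is expanded from the end: with base point `t` and integrand `-V`, the remaining
  -- exponent at `u` is the integral over `[u, t]`, which the Markov property at time `u` can
  -- handle.
  have e1 : ∀ ω, fkPath V g t x (B · ω) = g (x + B t.toNNReal ω) + ∫ u in (0:ℝ)..t, G u ω := by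
    intro ω
    have mv : Measurable fun r => -V (t - r) (x + B r.toNNReal ω) :=
      (measurable_path_potential hBm hV (by fun_prop) measurable_id measurable_const
        measurable_const).neg
    have := exp_integral_sub_exp (K := M) t mv (fun u => by rw [abs_neg]; exact hM _ _) ht.le
    rw [intervalIntegral.integral_same, Real.exp_zero] at this
    simp only [intervalIntegral.integral_neg] at this
    have hs : ∀ u, -∫ r in t..u, V (t - r) (x + B r.toNNReal ω)
        = ∫ r in u..t, V (t - r) (x + B r.toNNReal ω) := fun u => by
      rw [intervalIntegral.integral_symm, neg_neg]
    simp only [hs] at this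
    have h2 : ∫ u in (0:ℝ)..t, G u ω = -(g (x + B t.toNNReal ω)
        * ∫ u in (0:ℝ)..t, Real.exp (∫ r in u..t, V (t - r) (x + B r.toNNReal ω))
          * -V (t - u) (x + B u.toNNReal ω)) := by
      rw [← intervalIntegral.integral_const_mul, ← intervalIntegral.integral_neg]
      refine intervalIntegral.integral_congr fun u _ => ?_
      simp only [hG]
      ring
    rw [h2, ← this]
    unfold fkPath
    ring
  have i2 : Integrable (fun ω => ∫ u in (0:ℝ)..t, G u ω) PB := by
    simp_rw [intervalIntegral.integral_of_le ht.le]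
    exact iG.integral_prod_right
  have e2 : ∫ ω, (∫ u in (0:ℝ)..t, G u ω) ∂PB = ∫ u in (0:ℝ)..t, ∫ ω, G u ω ∂PB := by
    simp_rw [intervalIntegral.integral_of_le ht.le]
    exact (integral_integral_swap iG).symm
  have ht0 : t.toNNReal ≠ 0 := (Real.toNNReal_pos.2 ht).ne'
  have e3 : fkSol PB B V g t x = (∫ y, gaussianPDFReal x t.toNNReal y * g y)
      + ∫ u in (0:ℝ)..t, ∫ ω, G u ω ∂PB := by
    unfold fkSol
    simp_rw [e1]
    rw [integral_add hgi i2, e2, integral_comp_brownian hB.toIsPreBrownianReal ht0 x hg]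
  rw [e3]
  congr 1
  -- The elapsed Brownian time `u` corresponds to the time `r = t - u` of the equation; the
  -- unsimplified `t - (t - u)` prepares the substitution in `e5`.
  have e4 : ∀ u ∈ Ioc 0 t, ∫ ω, G u ω ∂PB = ∫ y, gaussianPDFReal x (t - (t - u)).toNNReal y
      * (V (t - u) y * fkSol PB B V g (t - u) y) := by
    intro u hu
    rw [sub_sub_cancel]
    simp only [hG]
    rw [integral_fk_markov hB hBm hV hM hg hu.1.le hu.2 x hgi]
    have mf : Measurable fun y => V (t - u) y * fkSol PB B V g (t - u) y :=
      (hV.comp (measurable_const.prodMk measurable_id)).mul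
        ((measurable_fkSol hBm hV hg).comp (measurable_const.prodMk measurable_id))
    exact integral_comp_brownian hB.toIsPreBrownianReal (Real.toNNReal_pos.2 hu.1).ne' x mf
  have e5 := intervalIntegral.integral_comp_sub_left (a := 0) (b := t) (fun r =>
    ∫ y, gaussianPDFReal x (t - r).toNNReal y * (V r y * fkSol PB B V g r y)) t
  rw [sub_self, sub_zero] at e5
  rw [← e5, intervalIntegral.integral_of_le ht.le, intervalIntegral.integral_of_le ht.le]
  exact setIntegral_congr_fun measurableSet_Ioc e4

/-- After the bound by `exp (M t) 𝔼|g(x + B_t)|` and Jensen, Tonelli and translation invariance of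
Lebesgue measure finish for every law of `B_t`, including the point mass at time zero. -/
lemma eLpNorm_fkSol_le (hBm : Measurable (Function.uncurry B))
    (hM : ∀ t x, |V t x| ≤ M) (hg : Measurable g) {t : ℝ} (ht : 0 ≤ t) :
    eLpNorm (fkSol PB B V g t) 2 volume ≤ ENNReal.ofReal (Real.exp (M * t)) * eLpNorm g 2 volume := by
  have mB : ∀ t, Measurable (B t) := fun t => hBm.comp (measurable_const.prodMk measurable_id)
  have h1 : ∀ x, ‖fkSol PB B V g t x‖ₑ ≤ ENNReal.ofReal (Real.exp (M * t))
      * eLpNorm (fun ω => g (x + B t.toNNReal ω)) 2 PB := by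
    intro x
    calc ‖fkSol PB B V g t x‖ₑ ≤ ∫⁻ ω, ‖fkPath V g t x (B · ω)‖ₑ ∂PB :=
          enorm_integral_le_lintegral_enorm _
      _ ≤ ∫⁻ ω, ENNReal.ofReal (Real.exp (M * t)) * ‖g (x + B t.toNNReal ω)‖ₑ ∂PB := by
          refine lintegral_mono fun ω => ?_
          rw [← ofReal_norm, ← ofReal_norm,
            ← ENNReal.ofReal_mul (Real.exp_pos _).le]
          exact ENNReal.ofReal_le_ofReal (abs_fkPath_le hM ht x _)
      _ = ENNReal.ofReal (Real.exp (M * t)) * eLpNorm (fun ω => g (x + B t.toNNReal ω)) 1 PB := by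
          rw [lintegral_const_mul' _ _ ENNReal.ofReal_ne_top, eLpNorm_one_eq_lintegral_enorm]
      _ ≤ _ := by
          gcongr
          exact eLpNorm_le_eLpNorm_of_exponent_le one_le_two
            (hg.comp ((mB _).const_add x)).aestronglyMeasurable
  have h3 : ∫⁻ x, ‖fkSol PB B V g t x‖ₑ ^ 2 ≤ ENNReal.ofReal (Real.exp (M * t)) ^ 2
      * ∫⁻ y, ‖g y‖ₑ ^ 2 := by
    have mgB : Measurable fun p : ℝ × Ω => ‖g (p.1 + B t.toNNReal p.2)‖ₑ ^ 2 :=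
      ((hg.comp (measurable_fst.add ((mB _).comp measurable_snd))).enorm).pow_const 2
    calc ∫⁻ x, ‖fkSol PB B V g t x‖ₑ ^ 2
        ≤ ∫⁻ x, ENNReal.ofReal (Real.exp (M * t)) ^ 2
            * ∫⁻ ω, ‖g (x + B t.toNNReal ω)‖ₑ ^ 2 ∂PB := by
          refine lintegral_mono fun x => ?_
          refine (pow_le_pow_left' (h1 x) 2).trans (le_of_eq ?_)
          rw [mul_pow, eLpNorm_eq_lintegral_rpow_enorm_toReal (by norm_num) (by norm_num)]
          congr 1
          rw [← ENNReal.rpow_natCast, ← ENNReal.rpow_mul]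
          simp
      _ = ENNReal.ofReal (Real.exp (M * t)) ^ 2
            * ∫⁻ ω, (∫⁻ x, ‖g (x + B t.toNNReal ω)‖ₑ ^ 2) ∂PB := by
          rw [lintegral_const_mul' _ _ (by simp), lintegral_lintegral_swap mgB.aemeasurable]
      _ = _ := by
          congr 1
          have : ∀ ω, ∫⁻ x, ‖g (x + B t.toNNReal ω)‖ₑ ^ 2 = ∫⁻ y, ‖g y‖ₑ ^ 2 := fun ω =>
            lintegral_add_right_eq_self (fun y => ‖g y‖ₑ ^ 2) _
          simp_rw [this]
          simp
  rw [eLpNorm_eq_lintegral_rpow_enorm_toReal (by norm_num) (by norm_num),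
    eLpNorm_eq_lintegral_rpow_enorm_toReal (by norm_num) (by norm_num)]
  simp only [ENNReal.toReal_ofNat, ENNReal.rpow_ofNat]
  refine (ENNReal.rpow_le_rpow h3 (by norm_num)).trans (le_of_eq ?_)
  rw [ENNReal.mul_rpow_of_nonneg _ _ (by norm_num), ← ENNReal.rpow_natCast, ← ENNReal.rpow_mul]
  simp

/-- The Feynman–Kac formula gives a mild solution. -/
theorem isMildSolution_fkSol (hB : IsBrownianReal B PB) (hBm : Measurable (Function.uncurry B))
    (hV : Measurable (Function.uncurry V)) (hM : ∀ t x, |V t x| ≤ M) (hg : Measurable g)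
    (hg2 : MemLp g 2 volume) : IsMildSolution V g (fkSol PB B V g) where
  measurable := (measurable_fkSol hBm hV hg).comp
    (by fun_prop : Measurable fun p : ℝ≥0 × ℝ => ((p.1 : ℝ), p.2))
  bounded T := by
    refine ⟨(ENNReal.ofReal (Real.exp (M * T)) * eLpNorm g 2 volume).toNNReal, fun t ht => ?_⟩
    rw [ENNReal.coe_toNNReal (ENNReal.mul_ne_top ENNReal.ofReal_ne_top hg2.2.ne)]
    refine (eLpNorm_fkSol_le hBm hM hg ht.1).trans ?_
    have hM0 : 0 ≤ M := (abs_nonneg _).trans (hM 0 0)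
    have := ht.2
    gcongr
  initial x := fkSol_zero hB.toIsPreBrownianReal x
  duhamel t ht x := fkSol_duhamel hB hBm hV hM hg hg2 ht x

end MildExistence


/-! ### Uniqueness of mild solutions. -/

section MildUniqueness

lemma eLpNorm_two_eq {α : Type*} [MeasurableSpace α] {μ : Measure α} {f : α → ℝ}
    (hf : MemLp f 2 μ) : eLpNorm f 2 μ = ENNReal.ofReal (√(∫ a, f a ^ 2 ∂μ)) := by
  rw [hf.eLpNorm_eq_integral_rpow_norm (by norm_num) (by norm_num), Real.sqrt_eq_rpow]
  simp

variable {V : ℝ → ℝ → ℝ} {g : ℝ → ℝ} {M : ℝ} {f : ℝ → ℝ → ℝ}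

lemma memLp_gaussianPDFReal (x : ℝ) (t : ℝ≥0) : MemLp (gaussianPDFReal x t) 2 volume := by
  rw [memLp_two_iff_integrable_sq (measurable_gaussianPDFReal _ _).aestronglyMeasurable]
  simp only [sq]
  refine (integrable_gaussianPDFReal x t).bdd_mul (c := (√(2 * Real.pi * t))⁻¹)
    (measurable_gaussianPDFReal _ _).aestronglyMeasurable (ae_of_all _ fun y => ?_)
  rw [Real.norm_of_nonneg (gaussianPDFReal_nonneg _ _ _)]
  exact gaussianPDFReal_le _ _ _

/-- A density is at most its supremum times itself after squaring, and its mass is one. The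
resulting `L²` norm of order `t^{-1/4}` is integrable in time. -/
lemma integral_sq_gaussianPDFReal_le (x : ℝ) {t : ℝ≥0} (ht : t ≠ 0) :
    ∫ y, gaussianPDFReal x t y ^ 2 ≤ (√t)⁻¹ := by
  have ht' : (0:ℝ) < t := NNReal.coe_pos.2 (pos_iff_ne_zero.2 ht)
  calc ∫ y, gaussianPDFReal x t y ^ 2 ≤ ∫ y, (√t)⁻¹ * gaussianPDFReal x t y := by
        refine integral_mono (memLp_gaussianPDFReal x t).integrable_sq
          ((integrable_gaussianPDFReal x t).const_mul _) fun y => ?_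
        dsimp only
        rw [sq]
        refine mul_le_mul_of_nonneg_right ((gaussianPDFReal_le _ _ _).trans ?_)
          (gaussianPDFReal_nonneg _ _ _)
        refine inv_anti₀ (Real.sqrt_pos.2 ht') (Real.sqrt_le_sqrt ?_)
        nlinarith [Real.pi_gt_three]
    _ = (√t)⁻¹ := by
        rw [integral_const_mul, integral_gaussianPDFReal_eq_one x ht, mul_one]

lemma sqrt_inv_sqrt {s : ℝ} (hs : 0 ≤ s) : √((√s)⁻¹) = s ^ (-(1/4) : ℝ) := by
  rw [Real.sqrt_eq_rpow, Real.sqrt_eq_rpow, ← Real.rpow_neg hs, ← Real.rpow_mul hs]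
  norm_num

lemma memLp_potential_mul (hV : Measurable (Function.uncurry V)) (hM : ∀ t x, |V t x| ≤ M) (r : ℝ)
    {h : ℝ → ℝ} (hh : MemLp h 2 volume) : MemLp (fun y => V r y * h y) 2 volume :=
  hh.of_le_mul (c := M) ((hV.comp (measurable_const.prodMk
    measurable_id)).aestronglyMeasurable.mul hh.1) (ae_of_all _ fun y => by
      rw [norm_mul]
      exact mul_le_mul_of_nonneg_right (hM _ _) (norm_nonneg _))

/-- The Duhamel integrand is integrable in space, with an integrable singularity in time. -/
lemma integrable_duhamel_space (hV : Measurable (Function.uncurry V)) (hM : ∀ t x, |V t x| ≤ M)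
    (r : ℝ) {h : ℝ → ℝ} (hh : MemLp h 2 volume) (x : ℝ) (s : ℝ≥0) :
    Integrable fun y => gaussianPDFReal x s y * (V r y * h y) := by
  exact (memLp_gaussianPDFReal x s).integrable_mul (memLp_potential_mul hV hM r hh)

/-- Cauchy–Schwarz against the heat kernel trades an `L²` bound on `h` for a pointwise one, at the
price of an integrable singularity. -/
lemma abs_duhamel_space_le (hV : Measurable (Function.uncurry V)) (hM : ∀ t x, |V t x| ≤ M)
    (r : ℝ) {h : ℝ → ℝ} (hh : MemLp h 2 volume) {K : ℝ≥0} (hK : eLpNorm h 2 volume ≤ K) (x : ℝ)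
    {s : ℝ} (hs : 0 < s) :
    |∫ y, gaussianPDFReal x s.toNNReal y * (V r y * h y)| ≤ s ^ (-(1/4) : ℝ) * (M * K) := by
  have hM0 : 0 ≤ M := (abs_nonneg _).trans (hM 0 0)
  have h1 := integral_abs_mul_le_sqrt (memLp_gaussianPDFReal x s.toNNReal) hh
  have h2 : √(∫ y, h y ^ 2) ≤ K := by
    rw [eLpNorm_two_eq hh] at hK
    have := ENNReal.toReal_mono ENNReal.coe_ne_top hK
    rwa [ENNReal.toReal_ofReal (Real.sqrt_nonneg _)] at this
  have h3 : √(∫ y, gaussianPDFReal x s.toNNReal y ^ 2) ≤ s ^ (-(1/4) : ℝ) := by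
    rw [← sqrt_inv_sqrt hs.le]
    refine Real.sqrt_le_sqrt ?_
    have := integral_sq_gaussianPDFReal_le x (Real.toNNReal_pos.2 hs).ne'
    rwa [Real.coe_toNNReal _ hs.le] at this
  calc |∫ y, gaussianPDFReal x s.toNNReal y * (V r y * h y)|
      ≤ ∫ y, |gaussianPDFReal x s.toNNReal y * (V r y * h y)| :=
        abs_integral_le_integral_abs
    _ ≤ ∫ y, M * |gaussianPDFReal x s.toNNReal y * h y| := by
        refine integral_mono (integrable_duhamel_space hV hM r hh x _).abs
          (((memLp_gaussianPDFReal x s.toNNReal).integrable_mul hh).abs.const_mul M) fun y => ?_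
        dsimp only
        rw [mul_left_comm, abs_mul]
        exact mul_le_mul_of_nonneg_right (hM _ _) (abs_nonneg _)
    _ = M * ∫ y, |gaussianPDFReal x s.toNNReal y * h y| := integral_const_mul _ _
    _ ≤ M * (s ^ (-(1/4) : ℝ) * K) := by
        refine mul_le_mul_of_nonneg_left (h1.trans (mul_le_mul h3 h2 (Real.sqrt_nonneg _) ?_)) hM0
        positivity
    _ = _ := by ring

lemma measurable_duhamel_space (hV : Measurable (Function.uncurry V))
    (hf : Measurable (Function.uncurry f)) (t x : ℝ) :
    Measurable fun r => ∫ y, gaussianPDFReal x (t - r).toNNReal y * (V r y * f r y) := by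
  refine (StronglyMeasurable.integral_prod_right' (ν := volume) (f := fun p : ℝ × ℝ =>
    gaussianPDFReal x (t - p.1).toNNReal p.2 * (V p.1 p.2 * f p.1 p.2)) ?_).measurable
  refine Measurable.stronglyMeasurable (Measurable.mul ?_ (hV.mul hf))
  exact measurable_uncurry_gaussianPDFReal.comp
    (by fun_prop : Measurable fun p : ℝ × ℝ => (x, (t - p.1).toNNReal, p.2))

lemma intervalIntegrable_sub_rpow (t : ℝ) :
    IntervalIntegrable (fun r => (t - r) ^ (-(1/4) : ℝ)) volume 0 t := by
  have := (intervalIntegral.intervalIntegrable_rpow' (a := 0) (b := t)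
    (r := -(1/4)) (by norm_num)).comp_sub_left t
  simpa using this.symm

lemma intervalIntegrable_duhamel (hV : Measurable (Function.uncurry V)) (hM : ∀ t x, |V t x| ≤ M)
    (hf : Measurable (Function.uncurry f)) {K : ℝ≥0} {t : ℝ} (ht : 0 ≤ t)
    (hK : ∀ r ∈ Icc 0 t, eLpNorm (f r) 2 volume ≤ K) (x : ℝ) :
    IntervalIntegrable (fun r => ∫ y, gaussianPDFReal x (t - r).toNNReal y * (V r y * f r y))
      volume 0 t := by
  refine ((intervalIntegrable_sub_rpow t).mul_const (M * K)).mono_fun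
    (measurable_duhamel_space hV hf t x).aestronglyMeasurable ?_
  rw [uIoc_of_le ht, ← restrict_Ioo_eq_restrict_Ioc]
  filter_upwards [ae_restrict_mem measurableSet_Ioo] with r hr
  have hfr : MemLp (f r) 2 volume :=
    ⟨(hf.comp (measurable_const.prodMk measurable_id)).aestronglyMeasurable,
      (hK r ⟨hr.1.le, hr.2.le⟩).trans_lt ENNReal.coe_lt_top⟩
  exact (abs_duhamel_space_le hV hM r hfr (hK r ⟨hr.1.le, hr.2.le⟩) x (sub_pos.2 hr.2)).trans
    (le_abs_self _)

/-- A mild solution of the homogeneous problem vanishes. -/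
lemma eq_zero_of_duhamel (hV : Measurable (Function.uncurry V)) (hM : ∀ t x, |V t x| ≤ M)
    (hf : Measurable (Function.uncurry f)) {K : ℝ≥0} {T : ℝ}
    (hK : ∀ r ∈ Icc 0 T, eLpNorm (f r) 2 volume ≤ K) (h0 : ∀ x, f 0 x = 0)
    (hd : ∀ t > 0, ∀ x, f t x =
      ∫ r in (0:ℝ)..t, ∫ y, gaussianPDFReal x (t - r).toNNReal y * (V r y * f r y))
    {t : ℝ} (ht : t ∈ Icc 0 T) (x : ℝ) : f t x = 0 := by
  have hM0 : 0 ≤ M := (abs_nonneg _).trans (hM 0 0)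
  have hT : 0 ≤ T := ht.1.trans ht.2
  -- The integral of `(t - r)^{-1/4}` over `[0, t]` is `t^{3/4} / (3/4)`. So one use of Duhamel's
  -- formula turns the `L²` bound into a uniform bound.
  set A := (M * K) * (T ^ (3/4 : ℝ) / (3/4)) with hA
  have hA0 : 0 ≤ A := by positivity
  have base : ∀ t ∈ Icc 0 T, ∀ x, |f t x| ≤ A := by
    intro t ht x
    rcases ht.1.eq_or_lt with rfl | h
    · rw [h0, abs_zero]; exact hA0
    rw [hd t h x]
    have := intervalIntegral.norm_integral_le_of_norm_le ht.1
      (f := fun r => ∫ y, gaussianPDFReal x (t - r).toNNReal y * (V r y * f r y))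
      (g := fun r => (t - r) ^ (-(1/4) : ℝ) * (M * K)) (μ := volume) ?_
      ((intervalIntegrable_sub_rpow t).mul_const _)
    · refine this.trans ?_
      rw [intervalIntegral.integral_mul_const,
        intervalIntegral.integral_comp_sub_left (fun r => r ^ (-(1/4) : ℝ)) t, sub_self, sub_zero,
        integral_rpow (Or.inl (by norm_num)), mul_comm, hA]
      have e : (-(1/4) : ℝ) + 1 = 3/4 := by norm_num
      rw [e, Real.zero_rpow (by norm_num), sub_zero]
      have := ht.2
      gcongr
    · have hne : ∀ᵐ r : ℝ, r ≠ t := by simp [ae_iff]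
      filter_upwards [hne] with r hr hr'
      have hrt : r < t := lt_of_le_of_ne hr'.2 hr
      have hrT : r ∈ Icc 0 T := ⟨hr'.1.le, hrt.le.trans ht.2⟩
      have hfr : MemLp (f r) 2 volume :=
        ⟨(hf.comp (measurable_const.prodMk measurable_id)).aestronglyMeasurable,
          (hK r hrT).trans_lt ENNReal.coe_lt_top⟩
      exact abs_duhamel_space_le hV hM r hfr (hK r hrT) x (sub_pos.2 hrt)
  -- Picard iteration: for a uniform bound the heat kernel acts with mass one, and each round gains
  -- a factor `M` and a time integration.
  have iter : ∀ n : ℕ, ∀ t ∈ Icc 0 T, ∀ x, |f t x| ≤ A * ((M * t) ^ n / n.factorial) := by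
    intro n
    induction n with
    | zero => intro t ht x; simpa using base t ht x
    | succ n ih =>
      intro t ht x
      rcases ht.1.eq_or_lt with rfl | h
      · rw [h0, abs_zero]; positivity
      rw [hd t h x]
      have := intervalIntegral.norm_integral_le_of_norm_le ht.1
        (f := fun r => ∫ y, gaussianPDFReal x (t - r).toNNReal y * (V r y * f r y))
        (g := fun r => (M * A * (M ^ n / n.factorial)) * r ^ n) (μ := volume) ?_
        (Continuous.intervalIntegrable (by fun_prop) _ _)
      · refine this.trans (le_of_eq ?_)
        rw [intervalIntegral.integral_const_mul, integral_pow, Nat.factorial_succ]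
        push_cast
        have : (n.factorial : ℝ) ≠ 0 := by positivity
        have : (n : ℝ) + 1 ≠ 0 := by positivity
        field_simp
        ring
      · have hne : ∀ᵐ r : ℝ, r ≠ t := by simp [ae_iff]
        filter_upwards [hne] with r hr hr'
        have hrt : r < t := lt_of_le_of_ne hr'.2 hr
        have hrT : r ∈ Icc 0 T := ⟨hr'.1.le, hrt.le.trans ht.2⟩
        have hp := integral_gaussianPDFReal_eq_one x (Real.toNNReal_pos.2 (sub_pos.2 hrt)).ne'
        calc ‖∫ y, gaussianPDFReal x (t - r).toNNReal y * (V r y * f r y)‖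
            ≤ ∫ y, ‖gaussianPDFReal x (t - r).toNNReal y * (V r y * f r y)‖ :=
              norm_integral_le_integral_norm _
          _ ≤ ∫ y, gaussianPDFReal x (t - r).toNNReal y
                * (M * (A * ((M * r) ^ n / n.factorial))) := by
              refine integral_mono_of_nonneg (ae_of_all _ fun y => norm_nonneg _)
                ((integrable_gaussianPDFReal _ _).mul_const _) (ae_of_all _ fun y => ?_)
              dsimp only
              rw [norm_mul, norm_mul, Real.norm_of_nonneg (gaussianPDFReal_nonneg _ _ _)]
              exact mul_le_mul_of_nonneg_left (mul_le_mul (hM _ _) (ih r hrT y) (norm_nonneg _) hM0)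
                (gaussianPDFReal_nonneg _ _ _)
          _ = _ := by
              rw [integral_mul_const, hp, mul_pow]
              ring
  have lim : Tendsto (fun n : ℕ => A * ((M * t) ^ n / n.factorial)) atTop (𝓝 0) := by
    have := (FloorSemiring.tendsto_pow_div_factorial_atTop (M * t)).const_mul A
    rwa [mul_zero] at this
  have := ge_of_tendsto' lim fun n => iter n t ht x
  exact abs_nonpos_iff.1 this

/-- Mild solutions are unique. -/
theorem IsMildSolution.unique {v w : ℝ → ℝ → ℝ} (hV : Measurable (Function.uncurry V))
    (hM : ∀ t x, |V t x| ≤ M) (hv : IsMildSolution V g v) (hw : IsMildSolution V g w)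
    {t : ℝ} (ht : 0 ≤ t) (x : ℝ) : v t x = w t x := by
  -- A mild solution is controlled at nonnegative times only; reading it at `r.toNNReal` gives a
  -- function measurable on all of `ℝ × ℝ`.
  set f : ℝ → ℝ → ℝ := fun r y => v r.toNNReal y - w r.toNNReal y with hf
  have mt : Measurable fun p : ℝ × ℝ => (p.1.toNNReal, p.2) := by fun_prop
  have mv : Measurable (Function.uncurry fun (r y : ℝ) => v r.toNNReal y) := hv.measurable.comp mt
  have mw : Measurable (Function.uncurry fun (r y : ℝ) => w r.toNNReal y) := hw.measurable.comp mt
  have mf : Measurable (Function.uncurry f) := mv.sub mw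
  have bd : ∀ {z : ℝ → ℝ → ℝ}, IsMildSolution V g z → ∀ T : ℝ, ∃ K : ℝ≥0, ∀ r ∈ Icc 0 T,
      eLpNorm (fun y => z r.toNNReal y) 2 volume ≤ K := fun hz T => by
    obtain ⟨K, hK⟩ := hz.bounded T
    exact ⟨K, fun r hr => by rw [Real.coe_toNNReal _ hr.1]; exact hK r hr⟩
  have ml : ∀ {z : ℝ → ℝ → ℝ}, Measurable (Function.uncurry fun (r y : ℝ) => z r.toNNReal y) →
      ∀ {r : ℝ} {K : ℝ≥0}, eLpNorm (fun y => z r.toNNReal y) 2 volume ≤ K →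
      MemLp (fun y => z r.toNNReal y) 2 volume := fun mz r K h =>
    ⟨(mz.comp (measurable_const.prodMk measurable_id)).aestronglyMeasurable,
      h.trans_lt ENNReal.coe_lt_top⟩
  have hd : ∀ t > 0, ∀ x, f t x =
      ∫ r in (0:ℝ)..t, ∫ y, gaussianPDFReal x (t - r).toNNReal y * (V r y * f r y) := by
    intro t ht x
    obtain ⟨K₁, hK₁⟩ := bd hv t
    obtain ⟨K₂, hK₂⟩ := bd hw t
    have e : ∀ {z : ℝ → ℝ → ℝ}, IsMildSolution V g z → z t.toNNReal x =
        (∫ y, gaussianPDFReal x t.toNNReal y * g y) + ∫ r in (0:ℝ)..t,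
          ∫ y, gaussianPDFReal x (t - r).toNNReal y * (V r y * z r.toNNReal y) := fun hz => by
      rw [Real.coe_toNNReal _ ht.le, hz.duhamel t ht x]
      congr 1
      refine intervalIntegral.integral_congr fun r hr => ?_
      rw [uIcc_of_le ht.le] at hr
      rw [Real.coe_toNNReal _ hr.1]
    simp only [hf]
    rw [e hv, e hw, add_sub_add_left_eq_sub,
      ← intervalIntegral.integral_sub (intervalIntegrable_duhamel hV hM mv ht.le hK₁ x)
        (intervalIntegrable_duhamel hV hM mw ht.le hK₂ x)]
    refine intervalIntegral.integral_congr fun r hr => ?_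
    rw [uIcc_of_le ht.le] at hr
    rw [← integral_sub (integrable_duhamel_space hV hM r (ml mv (hK₁ r hr)) x _)
      (integrable_duhamel_space hV hM r (ml mw (hK₂ r hr)) x _)]
    congr 1; ext y
    ring
  obtain ⟨K₁, hK₁⟩ := bd hv t
  obtain ⟨K₂, hK₂⟩ := bd hw t
  have hK : ∀ r ∈ Icc 0 t, eLpNorm (f r) 2 volume ≤ (K₁ + K₂ : ℝ≥0) := fun r hr => by
    rw [ENNReal.coe_add]
    exact (eLpNorm_sub_le (ml mv (hK₁ r hr)).1 (ml mw (hK₂ r hr)).1 one_le_two).trans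
      (add_le_add (hK₁ r hr) (hK₂ r hr))
  have h0 : ∀ x, f 0 x = 0 := fun x => by
    simp only [hf, Real.toNNReal_zero, NNReal.coe_zero, hv.initial, hw.initial, sub_self]
  have := eq_zero_of_duhamel hV hM mf hK h0 hd (right_mem_Icc.2 ht) x
  simp only [hf, Real.coe_toNNReal _ ht] at this
  exact sub_eq_zero.1 this

end MildUniqueness


/-! ### Differentiation of weighted exponential integrals. -/

section WeightedExponential

variable {φ X : ℝ → ℝ} {U : Set ℝ}

lemma integral_withDensity_ofReal (hφ : Measurable φ) (h0 : ∀ y, 0 ≤ φ y) (F : ℝ → ℝ) :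
    ∫ y, F y ∂(volume.withDensity fun y => ENNReal.ofReal (φ y)) = ∫ y, φ y * F y := by
  rw [integral_withDensity_eq_integral_toReal_smul hφ.ennreal_ofReal
    (ae_of_all _ fun _ => ENNReal.ofReal_lt_top)]
  simp [ENNReal.toReal_ofReal (h0 _)]

lemma integrable_withDensity_ofReal (hφ : Measurable φ) (h0 : ∀ y, 0 ≤ φ y) (F : ℝ → ℝ) :
    Integrable F (volume.withDensity fun y => ENNReal.ofReal (φ y))
      ↔ Integrable fun y => φ y * F y := by
  rw [integrable_withDensity_iff_integrable_smul' hφ.ennreal_ofReal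
    (ae_of_all _ fun _ => ENNReal.ofReal_lt_top)]
  simp [ENNReal.toReal_ofReal (h0 _)]

/-- With `φ` as a density, the integral is a moment generating function of `X`, which may be
differentiated in the interior of its domain; `U` is open and lies in that domain. -/
lemma hasDerivAt_weighted_exp_of_nonneg (hφ : Measurable φ) (h0 : ∀ y, 0 ≤ φ y) (hU : IsOpen U)
    (h : ∀ s ∈ U, Integrable fun y => φ y * Real.exp (s * X y)) {s : ℝ} (hs : s ∈ U) (n : ℕ) :
    Integrable (fun y => φ y * (X y ^ n * Real.exp (s * X y))) ∧
    HasDerivAt (fun s => ∫ y, φ y * (X y ^ n * Real.exp (s * X y)))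
      (∫ y, φ y * (X y ^ (n + 1) * Real.exp (s * X y))) s := by
  set μ := volume.withDensity fun y => ENNReal.ofReal (φ y) with hμ
  have hsub : U ⊆ integrableExpSet X μ := fun s hs =>
    (integrable_withDensity_ofReal hφ h0 _).2 (h s hs)
  have hi : s ∈ interior (integrableExpSet X μ) := interior_maximal hsub hU hs
  refine ⟨(integrable_withDensity_ofReal hφ h0 _).1
    (integrable_pow_mul_exp_of_mem_interior_integrableExpSet hi n), ?_⟩
  have := hasDerivAt_integral_pow_mul_exp_real hi n
  simp only [hμ, integral_withDensity_ofReal hφ h0] at this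
  exact this

/-- Weighted exponential integrals may be differentiated under the integral sign. -/
lemma hasDerivAt_weighted_exp (hφ : Measurable φ) (hU : IsOpen U)
    (h : ∀ s ∈ U, Integrable fun y => φ y * Real.exp (s * X y)) {s : ℝ} (hs : s ∈ U) (n : ℕ) :
    Integrable (fun y => φ y * (X y ^ n * Real.exp (s * X y))) ∧
    HasDerivAt (fun s => ∫ y, φ y * (X y ^ n * Real.exp (s * X y)))
      (∫ y, φ y * (X y ^ (n + 1) * Real.exp (s * X y))) s := by
  -- A signed weight is not a density, so its positive and negative parts are treated separately.
  set p : ℝ → ℝ := fun y => max (φ y) 0 with hp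
  set q : ℝ → ℝ := fun y => max (-φ y) 0 with hq
  have hpq : ∀ y, φ y = p y - q y := fun y => by
    simp only [hp, hq]
    rcases le_total 0 (φ y) with h | h
    · rw [max_eq_left h, max_eq_right (neg_nonpos.2 h), sub_zero]
    · rw [max_eq_right h, max_eq_left (neg_nonneg.2 h)]; ring
  have mp : Measurable p := hφ.max measurable_const
  have mq : Measurable q := hφ.neg.max measurable_const
  have ip : ∀ s ∈ U, Integrable fun y => p y * Real.exp (s * X y) := fun s hs => by
    refine (h s hs).pos_part.congr (ae_of_all _ fun y => ?_)
    simp only [hp, max_mul_of_nonneg _ _ (Real.exp_pos _).le, zero_mul]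
  have iq : ∀ s ∈ U, Integrable fun y => q y * Real.exp (s * X y) := fun s hs => by
    refine (h s hs).neg_part.congr (ae_of_all _ fun y => ?_)
    simp only [hq, max_mul_of_nonneg _ _ (Real.exp_pos _).le, zero_mul, neg_mul]
  have P : ∀ {s}, s ∈ U → ∀ n, _ := fun {s} hs n => hasDerivAt_weighted_exp_of_nonneg mp
    (fun y => le_max_right _ _) hU ip hs n
  have Q : ∀ {s}, s ∈ U → ∀ n, _ := fun {s} hs n => hasDerivAt_weighted_exp_of_nonneg mq
    (fun y => le_max_right _ _) hU iq hs n
  have e : ∀ s ∈ U, ∀ n : ℕ, ∫ y, φ y * (X y ^ n * Real.exp (s * X y))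
      = (∫ y, p y * (X y ^ n * Real.exp (s * X y))) - ∫ y, q y * (X y ^ n * Real.exp (s * X y)) := by
    intro s hs n
    rw [← integral_sub (P hs n).1 (Q hs n).1]
    congr 1; ext y
    rw [hpq y]; ring
  refine ⟨((P hs n).1.sub (Q hs n).1).congr (ae_of_all _ fun y => ?_), ?_⟩
  · simp only [Pi.sub_apply]
    rw [hpq y]; ring
  · rw [e s hs]
    refine ((P hs n).2.sub (Q hs n).2).congr_of_eventuallyEq ?_
    filter_upwards [hU.mem_nhds hs] with r hr
    exact e r hr n

/-- Differentiation raises the power `n` by one, so `n` has to vary in the induction on `k`. -/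
lemma contDiff_weighted_exp (hφ : Measurable φ)
    (h : ∀ s, Integrable fun y => φ y * Real.exp (s * X y)) (k n : ℕ) :
    ContDiff ℝ k fun s => ∫ y, φ y * (X y ^ n * Real.exp (s * X y)) := by
  have hd : ∀ n s, HasDerivAt (fun s => ∫ y, φ y * (X y ^ n * Real.exp (s * X y)))
      (∫ y, φ y * (X y ^ (n + 1) * Real.exp (s * X y))) s := fun n s =>
    (hasDerivAt_weighted_exp hφ isOpen_univ (fun s _ => h s) (mem_univ s) n).2
  induction k generalizing n with
  | zero =>
    rw [Nat.cast_zero, contDiff_zero]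
    exact continuous_iff_continuousAt.2 fun s => (hd n s).continuousAt
  | succ k ih =>
    rw [Nat.cast_succ, contDiff_succ_iff_deriv]
    refine ⟨fun s => (hd n s).differentiableAt, by simp, ?_⟩
    have : deriv (fun s => ∫ y, φ y * (X y ^ n * Real.exp (s * X y)))
        = fun s => ∫ y, φ y * (X y ^ (n + 1) * Real.exp (s * X y)) := funext fun s => (hd n s).deriv
    rw [this]
    exact ih (n + 1)

end WeightedExponential

/-! ### Smoothness of Gaussian averages and the heat equation. -/

section HeatFlow

variable {g : ℝ → ℝ}

/-- Expanding the square isolates `x`: a Gaussian average of `g` is an explicit factor times the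
Laplace transform of `exp (-y² / 2t) g(y)` at `x / t`, which is smooth. -/
lemma gaussianPDFReal_expand {t : ℝ} (ht : 0 < t) (x y : ℝ) :
    gaussianPDFReal x t.toNNReal y = (√(2 * Real.pi * t))⁻¹ * Real.exp (-x ^ 2 / (2 * t))
      * (Real.exp (-y ^ 2 / (2 * t)) * Real.exp (x / t * y)) := by
  have h : gaussianPDFReal x t.toNNReal y
      = (√(2 * Real.pi * t))⁻¹ * Real.exp (-(y - x) ^ 2 / (2 * t)) := by
    rw [gaussianPDFReal_def, Real.coe_toNNReal _ ht.le]
  rw [h, ← Real.exp_add, mul_assoc (√(2 * Real.pi * t))⁻¹, ← Real.exp_add]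
  congr 2
  field_simp
  ring

/-- Completing the square turns the weight into a multiple of a Gaussian density centered at `s t`,
and a product of two `L²` functions is integrable. -/
lemma integrable_heat_weight (hg2 : MemLp g 2 volume) {t : ℝ} (ht : 0 < t) (s : ℝ) :
    Integrable fun y => Real.exp (-y ^ 2 / (2 * t)) * g y * Real.exp (s * y) := by
  have h := ((memLp_gaussianPDFReal (s * t) t.toNNReal).integrable_mul hg2).const_mul
    ((√(2 * Real.pi * t))⁻¹ * Real.exp (-(s * t) ^ 2 / (2 * t)))⁻¹
  refine h.congr (ae_of_all _ fun y => ?_)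
  have e : s * t / t = s := by field_simp
  simp only [Pi.mul_apply]
  rw [gaussianPDFReal_expand ht, e]
  have h1 : √(2 * Real.pi * t) ≠ 0 := (Real.sqrt_pos.2 (by positivity)).ne'
  have h2 := (Real.exp_pos (-(s * t) ^ 2 / (2 * t))).ne'
  field_simp

/-- The Gaussian average of a square integrable function is smooth in space and solves the heat
equation. -/
theorem heat_smooth (hg : Measurable g) (hg2 : MemLp g 2 volume) {t : ℝ} (ht : 0 < t) :
    ContDiff ℝ 2 (fun x => ∫ y, gaussianPDFReal x t.toNNReal y * g y) ∧
    ∀ x, HasDerivAt (fun τ => ∫ y, gaussianPDFReal x τ.toNNReal y * g y)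
      (1 / 2 * iteratedDeriv 2 (fun x => ∫ y, gaussianPDFReal x t.toNNReal y * g y) x) t := by
  set φ : ℝ → ℝ := fun y => Real.exp (-y ^ 2 / (2 * t)) * g y with hφ
  have mφ : Measurable φ := by
    refine Measurable.mul (by fun_prop) hg
  have iφ := integrable_heat_weight hg2 ht
  set A : ℕ → ℝ → ℝ := fun n s => ∫ y, φ y * (y ^ n * Real.exp (s * y)) with hA
  have dA : ∀ n s, HasDerivAt (A n) (A (n + 1) s) s := fun n s =>
    (hasDerivAt_weighted_exp mφ isOpen_univ (fun s _ => iφ s) (mem_univ s) n).2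
  have jA : ∀ n s, Integrable fun y => φ y * (y ^ n * Real.exp (s * y)) := fun n s =>
    (hasDerivAt_weighted_exp mφ isOpen_univ (fun s _ => iφ s) (mem_univ s) n).1
  have cA : ∀ n, ContDiff ℝ 2 (A n) := fun n => contDiff_weighted_exp mφ iφ 2 n
  set k := (√(2 * Real.pi * t))⁻¹ with hk
  have e : (fun x => ∫ y, gaussianPDFReal x t.toNNReal y * g y)
      = fun x => k * Real.exp (-x ^ 2 / (2 * t)) * A 0 (x / t) := by
    ext x
    simp only [hA]
    rw [← integral_const_mul]
    congr 1; ext y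
    rw [gaussianPDFReal_expand ht, hφ]
    ring
  have dE : ∀ x, HasDerivAt (fun x => Real.exp (-x ^ 2 / (2 * t)))
      (Real.exp (-x ^ 2 / (2 * t)) * (-x / t)) x := fun x => by
    have h : HasDerivAt (fun x : ℝ => -x ^ 2 / (2 * t)) (-x / t) x := by
      refine (((hasDerivAt_pow 2 x).neg).div_const (2 * t)).congr_deriv ?_
      push_cast
      field_simp
    exact h.exp
  have dA' : ∀ n x, HasDerivAt (fun x => A n (x / t)) (A (n + 1) (x / t) * (1 / t)) x := fun n x =>
    HasDerivAt.comp (h₂ := A n) (h := fun x => x / t) x (dA n (x / t))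
      ((hasDerivAt_id x).div_const t)
  have d1 : ∀ x, HasDerivAt (fun x => k * Real.exp (-x ^ 2 / (2 * t)) * A 0 (x / t))
      (k * Real.exp (-x ^ 2 / (2 * t)) * (-x / t * A 0 (x / t) + A 1 (x / t) / t)) x := fun x => by
    refine (((dE x).const_mul k).mul (dA' 0 x)).congr_deriv ?_
    ring
  have d2 : ∀ x, HasDerivAt
      (fun x => k * Real.exp (-x ^ 2 / (2 * t)) * (-x / t * A 0 (x / t) + A 1 (x / t) / t))
      (k * Real.exp (-x ^ 2 / (2 * t)) * ((x ^ 2 / t ^ 2 - 1 / t) * A 0 (x / t)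
        - 2 * x / t ^ 2 * A 1 (x / t) + A 2 (x / t) / t ^ 2)) x := fun x => by
    have hx : HasDerivAt (fun x : ℝ => -x / t) (-1 / t) x := ((hasDerivAt_id x).neg).div_const t
    refine (((dE x).const_mul k).mul ((hx.mul (dA' 0 x)).add ((dA' 1 x).div_const t))).congr_deriv ?_
    simp only [Pi.add_apply, Pi.mul_apply]
    field_simp
    ring
  have i2 : ∀ x, iteratedDeriv 2 (fun x => ∫ y, gaussianPDFReal x t.toNNReal y * g y) x
      = k * Real.exp (-x ^ 2 / (2 * t)) * ((x ^ 2 / t ^ 2 - 1 / t) * A 0 (x / t)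
        - 2 * x / t ^ 2 * A 1 (x / t) + A 2 (x / t) / t ^ 2) := fun x => by
    rw [e, iteratedDeriv_succ, iteratedDeriv_one, funext fun x => (d1 x).deriv]
    exact (d2 x).deriv
  refine ⟨?_, fun x => ?_⟩
  · rw [e]
    refine ContDiff.mul (by fun_prop) ((cA 0).comp (by fun_prop))
  · rw [i2]
    -- For the time derivative the kernel is a weighted exponential in the parameter `s = 1/t`, with
    -- exponent `s * X y`; the chain rule through the inverse gives the derivative in time.
    set X : ℝ → ℝ := fun y => -(y - x) ^ 2 / 2 with hX
    set N : ℝ → ℝ := fun s => ∫ y, g y * (X y ^ 0 * Real.exp (s * X y)) with hN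
    have eX : ∀ s : ℝ, 0 < s → ∀ y, Real.exp (s * X y)
        = √(2 * Real.pi * s⁻¹) * gaussianPDFReal x (s⁻¹).toNNReal y := fun s hs y => by
      have hs' : 0 < s⁻¹ := inv_pos.2 hs
      rw [gaussianPDFReal_def, Real.coe_toNNReal _ hs'.le, ← mul_assoc,
        mul_inv_cancel₀ (Real.sqrt_pos.2 (by positivity)).ne', one_mul, hX]
      congr 1
      field_simp
    have iN : ∀ s ∈ Ioi (0:ℝ), Integrable fun y => g y * Real.exp (s * X y) := fun s hs => by
      refine ((hg2.integrable_mul (memLp_gaussianPDFReal x (s⁻¹).toNNReal)).const_mul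
        (√(2 * Real.pi * s⁻¹))).congr (ae_of_all _ fun y => ?_)
      simp only [Pi.mul_apply]
      rw [eX s hs]
      ring
    have dN : HasDerivAt N (∫ y, g y * (X y ^ (0 + 1) * Real.exp (t⁻¹ * X y))) t⁻¹ :=
      (hasDerivAt_weighted_exp hg isOpen_Ioi iN (inv_pos.2 ht) 0).2
    have eN : ∀ τ : ℝ, 0 < τ → ∫ y, gaussianPDFReal x τ.toNNReal y * g y
        = (√(2 * Real.pi * τ))⁻¹ * N τ⁻¹ := fun τ hτ => by
      simp only [hN]
      rw [← integral_const_mul]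
      congr 1; ext y
      have h1 : √(2 * Real.pi * τ) ≠ 0 := (Real.sqrt_pos.2 (by positivity)).ne'
      rw [eX _ (inv_pos.2 hτ), inv_inv, pow_zero]
      field_simp
    have dK : HasDerivAt (fun τ => (√(2 * Real.pi * τ))⁻¹) (-(1 / (2 * t)) * k) t := by
      have hpos : 0 < 2 * Real.pi * t := by positivity
      have := (((hasDerivAt_id t).const_mul (2 * Real.pi)).sqrt hpos.ne').inv
        (Real.sqrt_pos.2 hpos).ne'
      refine this.congr_deriv ?_
      have h2 : √(2 * Real.pi * t) ^ 2 = 2 * Real.pi * t := Real.sq_sqrt hpos.le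
      simp only [id, hk]
      rw [h2]
      have := (Real.sqrt_pos.2 hpos).ne'
      have := Real.pi_pos.ne'
      field_simp
    have dt := dK.mul (dN.comp t (hasDerivAt_inv ht.ne'))
    have key : ∀ y, Real.exp (t⁻¹ * X y)
        = Real.exp (-x ^ 2 / (2 * t)) * (Real.exp (-y ^ 2 / (2 * t)) * Real.exp (x / t * y)) :=
      fun y => by
        rw [← Real.exp_add, ← Real.exp_add, hX]
        congr 1
        field_simp
        ring
    have v0 : N t⁻¹ = Real.exp (-x ^ 2 / (2 * t)) * A 0 (x / t) := by
      simp only [hN, hA]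
      rw [← integral_const_mul]
      congr 1; ext y
      rw [key, hφ]
      ring
    -- Both derivatives are written in the moments `A 0`, `A 1`, `A 2` at `x / t`, which reduces the
    -- heat equation to algebra.
    have v1 : ∫ y, g y * (X y ^ (0 + 1) * Real.exp (t⁻¹ * X y)) = Real.exp (-x ^ 2 / (2 * t))
        * (-(1/2) * A 2 (x / t) + x * A 1 (x / t) + -(x ^ 2 / 2) * A 0 (x / t)) := by
      simp only [hA]
      have j2 := (jA 2 (x / t)).const_mul (-(1/2))
      have j1 := (jA 1 (x / t)).const_mul x
      have j0 := (jA 0 (x / t)).const_mul (-(x ^ 2 / 2))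
      have j21 : Integrable (fun y => -(1/2) * (φ y * (y ^ 2 * Real.exp (x / t * y)))
        + x * (φ y * (y ^ 1 * Real.exp (x / t * y)))) := j2.add j1
      rw [← integral_const_mul, ← integral_const_mul, ← integral_const_mul (-(x ^ 2 / 2)),
        ← integral_add j2 j1, ← integral_add j21 j0, ← integral_const_mul]
      congr 1; ext y
      rw [key]
      simp only [hφ, hX]
      ring
    refine (dt.congr_of_eventuallyEq ?_).congr_deriv ?_
    · filter_upwards [Ioi_mem_nhds ht] with τ hτ
      exact eN τ hτ
    · rw [v1]
      simp only [Function.comp]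
      rw [v0, ← hk]
      field_simp
      ring

end HeatFlow


/-! ### Continuity of Brownian averages up to time zero. -/

section HeatContinuity

variable {Ω : Type*} [mΩ : MeasurableSpace Ω] {PB : Measure Ω} [IsProbabilityMeasure PB]
  {B : ℝ≥0 → Ω → ℝ} {g : ℝ → ℝ}

/-- A continuous cutoff equal to one on `[-n, n]` and vanishing outside `[-n - 1, n + 1]`. -/
def cutoff (n : ℕ) (y : ℝ) : ℝ := max 0 (min 1 (n + 1 - |y|))

lemma continuous_cutoff (n : ℕ) : Continuous (cutoff n) := by
  unfold cutoff; fun_prop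

lemma cutoff_nonneg (n : ℕ) (y : ℝ) : 0 ≤ cutoff n y := le_max_left _ _

lemma cutoff_le_one (n : ℕ) (y : ℝ) : cutoff n y ≤ 1 :=
  max_le zero_le_one (min_le_left _ _)

lemma cutoff_eq_one {n : ℕ} {y : ℝ} (h : |y| ≤ n) : cutoff n y = 1 := by
  unfold cutoff
  rw [min_eq_left (by linarith), max_eq_right zero_le_one]

lemma cutoff_eq_zero {n : ℕ} {y : ℝ} (h : n + 1 ≤ |y|) : cutoff n y = 0 := by
  unfold cutoff
  exact max_eq_left ((min_le_right _ _).trans (by linarith))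

/-- Away from its center the Gaussian factor beats the singularity `t^{-1/2}` uniformly in `t`:
after squaring, `exp (-d² / t) ≤ t ≤ 2πt` for `d ≥ 1`. -/
lemma gaussianPDFReal_le_one_of_dist {x y : ℝ} (h : 1 ≤ |y - x|) (t : ℝ≥0) :
    gaussianPDFReal x t y ≤ 1 := by
  rcases eq_or_ne t 0 with rfl | ht
  · simp
  have ht' : (0:ℝ) < t := NNReal.coe_pos.2 (pos_iff_ne_zero.2 ht)
  rw [gaussianPDFReal_def]
  dsimp only
  have hs : 0 < √(2 * Real.pi * t) := Real.sqrt_pos.2 (by positivity)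
  rw [inv_mul_le_iff₀ hs, mul_one]
  refine Real.le_sqrt_of_sq_le ?_
  rw [← Real.exp_nat_mul]
  have h1 : 1 ≤ (y - x) ^ 2 := by
    rw [← sq_abs]; nlinarith [abs_nonneg (y - x)]
  have e : ((2:ℕ):ℝ) * (-(y - x) ^ 2 / (2 * t)) = -((y - x) ^ 2 / t) := by
    push_cast; field_simp
  rw [e, Real.exp_neg]
  have h2 : (t : ℝ)⁻¹ ≤ Real.exp ((y - x) ^ 2 / t) := by
    have := Real.add_one_le_exp ((y - x) ^ 2 / t)
    have h3 : (t : ℝ)⁻¹ ≤ (y - x) ^ 2 / t := by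
      rw [← one_div]; gcongr
    linarith
  refine (inv_anti₀ (inv_pos.2 ht') h2).trans ?_
  rw [inv_inv]
  nlinarith [Real.pi_gt_three]

/-- Brownian averages of functions supported away from the starting point. -/
lemma abs_integral_comp_brownian_le_of_far (hB : IsPreBrownianReal B PB)
    (hBm : ∀ t, Measurable (B t)) {w : ℝ → ℝ} (hw : Measurable w) (hw2 : MemLp w 2 volume) {x : ℝ}
    (hx : ∀ y, |y - x| < 1 → w y = 0) (t : ℝ≥0) :
    |∫ ω, w (x + B t ω) ∂PB| ≤ √(∫ y, w y ^ 2) := by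
  rcases eq_or_ne t 0 with rfl | ht
  · have : ∀ᵐ ω ∂PB, w (x + B 0 ω) = 0 := by
      filter_upwards [hB.eval_zero_ae_eq_zero] with ω hω
      rw [hω]; exact hx _ (by simp)
    rw [integral_congr_ae this, integral_zero, abs_zero]
    exact Real.sqrt_nonneg _
  · have m := memLp_comp_brownian hB hBm hw hw2 t x
    have h1 := integral_abs_mul_le_sqrt m (memLp_const (1:ℝ))
    simp only [mul_one, one_pow, integral_const, probReal_univ, smul_eq_mul, Real.sqrt_one] at h1
    refine abs_integral_le_integral_abs.trans (h1.trans (Real.sqrt_le_sqrt ?_))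
    rw [integral_comp_brownian hB ht x (f := fun y => w y ^ 2) (hw.pow_const 2)]
    refine integral_mono_of_nonneg (ae_of_all _ fun y =>
      mul_nonneg (gaussianPDFReal_nonneg _ _ _) (sq_nonneg _)) hw2.integrable_sq
      (ae_of_all _ fun y => ?_)
    dsimp only
    rcases lt_or_ge |y - x| 1 with h | h
    · rw [hx y h]; simp
    · exact mul_le_of_le_one_left (sq_nonneg _) (gaussianPDFReal_le_one_of_dist h t)

lemma continuous_integral_comp_brownian_of_bdd (hB : IsBrownianReal B PB)
    (hBm : ∀ t, Measurable (B t)) {f : ℝ → ℝ} (hf : Continuous f) {K : ℝ} (hK : ∀ y, |f y| ≤ K) :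
    Continuous fun p : ℝ × ℝ => ∫ ω, f (p.2 + B p.1.toNNReal ω) ∂PB := by
  refine continuous_of_dominated (bound := fun _ => K)
    (fun p => (hf.measurable.comp ((hBm _).const_add _)).aestronglyMeasurable)
    (fun p => ae_of_all _ fun ω => hK _) (integrable_const _) ?_
  filter_upwards [hB.cont] with ω hω
  have : Continuous fun p : ℝ × ℝ => B p.1.toNNReal ω :=
    hω.comp (continuous_real_toNNReal.comp continuous_fst)
  fun_prop

/-- Brownian averages of continuous square integrable functions are continuous up to time zero. -/
theorem continuous_integral_comp_brownian (hB : IsBrownianReal B PB)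
    (hBm : ∀ t, Measurable (B t)) (hg : Continuous g) (hg2 : MemLp g 2 volume) :
    Continuous fun p : ℝ × ℝ => ∫ ω, g (p.2 + B p.1.toNNReal ω) ∂PB := by
  -- As `g` need not be bounded, it is split into a bounded continuous part and a tail. The tail
  -- vanishes near the starting point, so its average is controlled by its `L²` norm even for small
  -- times.
  set f : ℕ → ℝ → ℝ := fun n y => g y * cutoff n y with hf
  set w : ℕ → ℝ → ℝ := fun n y => g y * (1 - cutoff n y) with hw
  have cf : ∀ n, Continuous (f n) := fun n => hg.mul (continuous_cutoff n)
  have cw : ∀ n, Continuous (w n) := fun n => hg.mul (continuous_const.sub (continuous_cutoff n))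
  have bf : ∀ n, ∃ K, ∀ y, |f n y| ≤ K := fun n => by
    obtain ⟨K, hK⟩ := (isCompact_Icc (a := -((n:ℝ) + 1)) (b := n + 1)).exists_bound_of_continuousOn
      (cf n).continuousOn
    refine ⟨max K 0, fun y => ?_⟩
    by_cases h : |y| ≤ n + 1
    · exact (hK y (abs_le.1 h)).trans (le_max_left _ _)
    · simp only [hf]
      rw [cutoff_eq_zero (not_le.1 h).le, mul_zero, abs_zero]
      exact le_max_right _ _
  have bw : ∀ n y, |w n y| ≤ |g y| := fun n y => by
    simp only [hw]
    rw [abs_mul]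
    refine mul_le_of_le_one_right (abs_nonneg _) (abs_le.2 ⟨?_, ?_⟩)
    · linarith [cutoff_le_one n y]
    · linarith [cutoff_nonneg n y]
  have w2 : ∀ n, MemLp (w n) 2 volume := fun n =>
    hg2.mono (cw n).aestronglyMeasurable (ae_of_all _ (bw n))
  have lim0 : Tendsto (fun n => ∫ y, w n y ^ 2) atTop (𝓝 0) := by
    have := tendsto_integral_of_dominated_convergence (μ := volume) (F := fun n y => w n y ^ 2)
      (f := fun _ => 0) (fun y => g y ^ 2) (fun n => ((cw n).pow 2).aestronglyMeasurable)
      hg2.integrable_sq (fun n => ae_of_all _ fun y => by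
        rw [Real.norm_of_nonneg (sq_nonneg _)]; exact sq_le_sq.2 (bw n y))
      (ae_of_all _ fun y => by
        refine tendsto_const_nhds.congr' ?_
        obtain ⟨N, hN⟩ := exists_nat_ge |y|
        filter_upwards [eventually_ge_atTop N] with n hn
        simp only [hw]
        rw [cutoff_eq_one (hN.trans (Nat.cast_le.2 hn))]
        simp)
    simpa using this
  have lim : Tendsto (fun n => √(∫ y, w n y ^ 2)) atTop (𝓝 0) := by
    simpa using lim0.sqrt
  have split : ∀ n (p : ℝ × ℝ), ∫ ω, g (p.2 + B p.1.toNNReal ω) ∂PB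
      - ∫ ω, f n (p.2 + B p.1.toNNReal ω) ∂PB = ∫ ω, w n (p.2 + B p.1.toNNReal ω) ∂PB := fun n p => by
    rw [← integral_sub]
    · congr 1; ext ω; simp only [hf, hw]; ring
    · exact (memLp_comp_brownian hB.toIsPreBrownianReal hBm hg.measurable hg2 _ _).integrable
        (by simp)
    · obtain ⟨K, hK⟩ := bf n
      exact integrable_of_measurable_bdd ((cf n).measurable.comp ((hBm _).const_add _))
        fun ω => hK _
  refine continuous_iff_continuousAt.2 fun p₀ => ?_
  have unif : TendstoLocallyUniformlyOn
      (fun n (p : ℝ × ℝ) => ∫ ω, f n (p.2 + B p.1.toNNReal ω) ∂PB)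
      (fun p : ℝ × ℝ => ∫ ω, g (p.2 + B p.1.toNNReal ω) ∂PB) atTop univ := by
    rw [Metric.tendstoLocallyUniformlyOn_iff]
    intro e he p _
    refine ⟨{q | |q.2| < |p.2| + 1}, mem_nhdsWithin_of_mem_nhds
      ((isOpen_lt (by fun_prop) continuous_const).mem_nhds (by simp)), ?_⟩
    -- One unit is for the neighborhood of starting points, one for the unit distance required of
    -- the tail.
    obtain ⟨N, hN⟩ := exists_nat_ge (|p.2| + 2)
    filter_upwards [lim.eventually (gt_mem_nhds he), eventually_ge_atTop N] with n hn hNn q hq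
    rw [Real.dist_eq, split]
    refine (abs_integral_comp_brownian_le_of_far hB.toIsPreBrownianReal hBm (cw n).measurable (w2 n)
      (fun y hy => ?_) _).trans_lt hn
    simp only [hw]
    rw [cutoff_eq_one, sub_self, mul_zero]
    have h1 : |y| ≤ |y - q.2| + |q.2| := by simpa using abs_add_le (y - q.2) q.2
    have h2 : (N : ℝ) ≤ n := Nat.cast_le.2 hNn
    have h3 : |q.2| < |p.2| + 1 := hq
    linarith
  have := unif.continuousOn (Frequently.of_forall fun n => by
    obtain ⟨K, hK⟩ := bf n
    exact (continuous_integral_comp_brownian_of_bdd hB hBm (cf n) hK).continuousOn)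
  exact (continuousOn_univ.1 this).continuousAt

end HeatContinuity


/-! ### Forward and backward clocks, and reflection of the kernel. -/

section Clocks

variable {S Ω : Type*} [mS : MeasurableSpace S] [mΩ : MeasurableSpace Ω] {P : Measure S}
  [IsProbabilityMeasure P] {PB : Measure Ω} [IsProbabilityMeasure PB]
  {B : ℝ≥0 → Ω → ℝ} {Ψ : ℝ → ℝ → ℝ} {D K C δ T t x ε : ℝ} {c : ℝ≥0 → ℝ → S → ℝ}
  {τ : ℝ → ℝ → ℝ≥0} {γ : Ω → ℝ} {g : ℝ → ℝ}

/-- The diffusive time change. -/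
def forwardClock (ε r : ℝ) : ℝ≥0 := (r / ε ^ 2).toNNReal

/-- The diffusive time change run backwards from time `t`. -/
def backwardClock (t ε r : ℝ) : ℝ≥0 := ((t - r) / ε ^ 2).toNNReal

lemma isClock_forward (hstat : IsStationaryField P c) (T : ℝ) :
    IsClock P c (fieldCorrelation P c) T forwardClock where
  measurable ε := by unfold forwardClock; fun_prop
  dist ε hε r hr u hu := by
    have h2 : 0 < ε ^ 2 := by positivity
    unfold forwardClock
    rw [Real.coe_toNNReal _ (div_nonneg hr.1 h2.le), Real.coe_toNNReal _ (div_nonneg hu.1 h2.le),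
      ← sub_div, abs_div, abs_of_pos h2]
  cov ε hε u r hu hur hr y z := by
    have h2 : 0 < ε ^ 2 := by positivity
    unfold forwardClock
    rw [integral_mul_eq_fieldCorrelation hstat (Real.toNNReal_le_toNNReal (by gcongr)),
      Real.coe_toNNReal _ (div_nonneg (hu.trans hur) h2.le),
      Real.coe_toNNReal _ (div_nonneg hu h2.le), ← sub_div]

/-- Running backwards exchanges the earlier and the later point of the field, so the lag is kept
while the spatial difference changes sign. -/
lemma isClock_backward (hstat : IsStationaryField P c) (T : ℝ) :
    IsClock P c (fun v z => fieldCorrelation P c v (-z)) T (backwardClock T) where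
  measurable ε := by unfold backwardClock; fun_prop
  dist ε hε r hr u hu := by
    have h2 : 0 < ε ^ 2 := by positivity
    unfold backwardClock
    rw [Real.coe_toNNReal _ (div_nonneg (sub_nonneg.2 hr.2) h2.le),
      Real.coe_toNNReal _ (div_nonneg (sub_nonneg.2 hu.2) h2.le),
      ← sub_div, abs_div, abs_of_pos h2, sub_sub_sub_cancel_left, abs_sub_comm]
  cov ε hε u r hu hur hr y z := by
    have h2 : 0 < ε ^ 2 := by positivity
    unfold backwardClock
    simp_rw [mul_comm (c _ y _)]
    rw [integral_mul_eq_fieldCorrelation hstat (Real.toNNReal_le_toNNReal (by gcongr)),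
      Real.coe_toNNReal _ (div_nonneg (sub_nonneg.2 (hur.trans hr)) h2.le),
      Real.coe_toNNReal _ (div_nonneg (sub_nonneg.2 hr) h2.le), ← sub_div,
      sub_sub_sub_cancel_left, neg_sub]

lemma isCorrKernel_fieldCorrelation (hc : IsMixingField P c K C δ)
    (hcorr : Integrable (fun p : ℝ × ℝ => fieldCorrelation P c p.1 p.2)) :
    IsCorrKernel (fieldCorrelation P c) (2 * K ^ 2 * C) where
  measurable := measurable_fieldCorrelation hc.measurable
  bound _ hv z := abs_fieldCorrelation_le hc.pos hc.measurable hc.bound hc.centered hc.mixing hv z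
  integrable := hcorr

lemma IsCorrKernel.reflect (hΨ : IsCorrKernel Ψ D) : IsCorrKernel (fun v z => Ψ v (-z)) D where
  measurable := hΨ.measurable.comp (by fun_prop : Measurable fun p : ℝ × ℝ => (p.1, -p.2))
  bound v hv z := hΨ.bound v hv (-z)
  integrable := by
    have h := ((MeasurePreserving.id (volume : Measure ℝ)).prod
      (Measure.measurePreserving_neg (volume : Measure ℝ)))
    rw [← Measure.volume_eq_prod] at h
    exact h.integrable_comp_of_integrable hΨ.integrable

/-- Brownian motion is symmetric, so the backward clock has the same effective constant as the
forward one. -/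
lemma kernelConst_reflect (hB : IsPreBrownianReal B PB) (hΨ : Measurable (Function.uncurry Ψ)) :
    kernelConst PB B (fun v z => Ψ v (-z)) = kernelConst PB B Ψ := by
  unfold kernelConst kernelMean
  refine setIntegral_congr_fun measurableSet_Ioi fun v _ => ?_
  have hm : Measurable (Ψ v) := hΨ.comp (measurable_const.prodMk measurable_id)
  have h1 := (hB.neg.hasLaw_eval v.toNNReal).integral_comp (f := Ψ v) hm.aestronglyMeasurable
  have h2 := (hB.hasLaw_eval v.toNNReal).integral_comp (f := Ψ v) hm.aestronglyMeasurable
  exact h1.trans h2.symm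

lemma tendsto_eLpNorm_of_integral_sq {f : ℝ → S → ℝ} (hf : ∀ ε > 0, MemLp (f ε) 2 P)
    (h : Tendsto (fun ε => ∫ s, f ε s ^ 2 ∂P) (𝓝[>] 0) (𝓝 0)) :
    Tendsto (fun ε => eLpNorm (f ε) 2 P) (𝓝[>] 0) (𝓝 0) := by
  have := ENNReal.tendsto_ofReal h.sqrt
  rw [Real.sqrt_zero, ENNReal.ofReal_zero] at this
  refine this.congr' ?_
  filter_upwards [self_mem_nhdsWithin] with ε hε
  exact (eLpNorm_two_eq (hf ε hε)).symm

/-- Mean square homogenization of exponential Brownian functionals. -/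
lemma memLp_and_tendsto_expectation (hc : IsMixingField P c K C δ) (hτ : IsClock P c Ψ T τ)
    (hB : IsPreBrownianReal B PB) (hBm : Measurable (Function.uncurry B))
    (hΨ : IsCorrKernel Ψ D) (hT : 0 ≤ T) (hγ : MemLp γ 2 PB) (x : ℝ) :
    (∀ ε > 0, MemLp (fun s => ∫ ω, γ ω * Real.exp (fieldInt c (τ ε) B x T ε s ω) ∂PB) 2 P) ∧
    Tendsto (fun ε => eLpNorm (fun s => ∫ ω, γ ω * Real.exp (fieldInt c (τ ε) B x T ε s ω) ∂PB
      - (∫ ω, γ ω ∂PB) * Real.exp (T * kernelConst PB B Ψ)) 2 P) (𝓝[>] 0) (𝓝 0) := by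
  have hγi : Integrable γ PB := hγ.integrable (by simp)
  refine ⟨fun ε hε => ?_, ?_⟩
  · have := memLp_integral_mul_exp_fieldInt (x := x) hc hτ hBm hε hT hγi 0 2
    simpa only [sub_zero] using this
  · refine (tendsto_eLpNorm_of_integral_sq (fun ε hε => memLp_integral_mul_exp_fieldInt (x := x)
      hc hτ hBm hε hT hγi (Real.exp (T * kernelConst PB B Ψ)) 2)
      (tendsto_integral_sq_exp_fieldInt hc hτ hB hBm hΨ hT hγ)).congr' ?_
    filter_upwards [self_mem_nhdsWithin] with ε hε
    congr 1; ext s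
    have := integrable_mul_exp_fieldInt (x := x) hc hτ hBm hε hT hγi s 0
    simp only [sub_zero] at this
    simp_rw [mul_sub]
    rw [integral_sub this (hγi.mul_const _), integral_mul_const]

end Clocks

/-! ### Translation to the Feynman–Kac expressions, the limit function, and a measurable Brownian
motion. -/

section Homogenization

variable {S Ω : Type*} [mS : MeasurableSpace S] [mΩ : MeasurableSpace Ω] {P : Measure S}
  {PB : Measure Ω} {B : ℝ≥0 → Ω → ℝ} {c : ℝ≥0 → ℝ → S → ℝ} {g : ℝ → ℝ} {K ε t x : ℝ}

lemma expoY_eq_fieldInt {S Ω : Type*} (c : ℝ≥0 → ℝ → S → ℝ) (B : ℝ≥0 → Ω → ℝ) (ε t x : ℝ) (s : S)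
    (ω : Ω) : expoY c B ε t x s ω = fieldInt c (forwardClock ε) B x t ε s ω :=
  intervalIntegral.integral_const_mul _ _

/-- The Feynman–Kac exponent evaluates the potential at time `t - r`, which is the backward clock by
definition. -/
lemma fkSol_eq_fieldInt {S : Type*} (c : ℝ≥0 → ℝ → S → ℝ) (ε t x : ℝ) (s : S) :
    fkSol PB B (scaledPotential c ε s) g t x
      = ∫ ω, g (x + B t.toNNReal ω)
          * Real.exp (fieldInt c (backwardClock t ε) B x t ε s ω) ∂PB := by
  unfold fkSol fkPath
  congr 1; ext ω
  congr 2
  exact intervalIntegral.integral_const_mul _ _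

lemma measurable_scaledPotential (hc : Measurable (fun q : ℝ≥0 × ℝ × S => c q.1 q.2.1 q.2.2))
    (ε : ℝ) (s : S) : Measurable (Function.uncurry (scaledPotential c ε s)) := by
  unfold scaledPotential
  exact (measurable_field_comp hc (t := fun p : ℝ × ℝ => (p.1 / ε ^ 2).toNNReal)
    (x := fun p : ℝ × ℝ => p.2 / ε) (by fun_prop) (by fun_prop) measurable_const).const_mul _

lemma abs_scaledPotential_le {S : Type*} {c : ℝ≥0 → ℝ → S → ℝ} (hK : ∀ t x s, |c t x s| ≤ K)
    (hε : 0 < ε) (s : S) (t x : ℝ) : |scaledPotential c ε s t x| ≤ ε⁻¹ * K := by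
  unfold scaledPotential
  rw [abs_mul, abs_of_pos (inv_pos.2 hε)]
  have := hK (t / ε ^ 2).toNNReal (x / ε) s
  gcongr

variable [IsProbabilityMeasure PB]

lemma limitU_zero (hB : IsPreBrownianReal B PB) (x : ℝ) : limitU P PB c B g 0 x = g x := by
  unfold limitU
  have : ∀ᵐ ω ∂PB, g (x + B (0:ℝ).toNNReal ω) = g x := by
    filter_upwards [hB.eval_zero_ae_eq_zero] with ω hω
    rw [Real.toNNReal_zero, hω, add_zero]
  rw [integral_congr_ae this]
  simp

/-- The homogenized limit is a classical solution for positive times. -/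
lemma limitU_smooth (hB : IsPreBrownianReal B PB) (hg : Measurable g) (hg2 : MemLp g 2 volume)
    (ht : 0 < t) : ContDiff ℝ 2 (limitU P PB c B g t) ∧
      ∀ x, HasDerivAt (fun τ => limitU P PB c B g τ x)
        (1 / 2 * iteratedDeriv 2 (limitU P PB c B g t) x
          + effectiveConst P PB c B * limitU P PB c B g t x) t := by
  obtain ⟨h1, h2⟩ := heat_smooth hg hg2 ht
  have e : ∀ τ > 0, ∀ x, limitU P PB c B g τ x = (∫ y, gaussianPDFReal x τ.toNNReal y * g y)
      * Real.exp (τ * effectiveConst P PB c B) := fun τ hτ x => by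
    unfold limitU
    rw [integral_comp_brownian hB (Real.toNNReal_pos.2 hτ).ne' x hg]
  have et : limitU P PB c B g t = fun x => Real.exp (t * effectiveConst P PB c B)
      * ∫ y, gaussianPDFReal x t.toNNReal y * g y := funext fun x => by rw [e t ht, mul_comm]
  refine ⟨by rw [et]; exact contDiff_const.mul h1, fun x => ?_⟩
  have hexp : HasDerivAt (fun τ => Real.exp (τ * effectiveConst P PB c B))
      (Real.exp (t * effectiveConst P PB c B) * (1 * effectiveConst P PB c B)) t :=
    ((hasDerivAt_id t).mul_const _).exp
  refine (((h2 x).mul hexp).congr_of_eventuallyEq ?_).congr_deriv ?_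
  · filter_upwards [Ioi_mem_nhds ht] with τ hτ
    exact e τ hτ x
  · rw [et, iteratedDeriv_const_mul_field]
    ring

lemma continuous_limitU (hB : IsBrownianReal B PB) (hBm : ∀ t, Measurable (B t))
    (hg : Continuous g) (hg2 : MemLp g 2 volume) :
    Continuous fun p : ℝ × ℝ => limitU P PB c B g p.1 p.2 :=
  (continuous_integral_comp_brownian hB hBm hg hg2).mul (by fun_prop)

/-- Every pre-Brownian motion with continuous paths is indistinguishable from a jointly measurable
one. -/
lemma exists_measurable_indistinguishable (hB : IsBrownianReal B PB) :
    ∃ W : ℝ≥0 → Ω → ℝ, IsBrownianReal W PB ∧ Measurable (Function.uncurry W) ∧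
      ∀ᵐ ω ∂PB, (B · ω) = (W · ω) := by
  set A : ℝ≥0 → Ω → ℝ := fun u => (hB.aemeasurable u).mk (B u) with hA
  -- The measurable versions `A u` agree with `B` simultaneously at all dyadic times outside one
  -- null set, and continuity of `B` extends the agreement to all times.
  set W : ℝ≥0 → Ω → ℝ := fun u ω => dyadicReg (A · ω) u with hW
  have mA : ∀ u, Measurable (A u) := fun u => (hB.aemeasurable u).measurable_mk
  have mW : Measurable (Function.uncurry W) := by
    refine measurable_dyadicReg.comp (f := fun p : ℝ≥0 × Ω => ((A · p.2), p.1))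
      (Measurable.prodMk ?_ measurable_fst)
    exact measurable_pi_lambda _ fun u => (mA u).comp measurable_snd
  have hd : ∀ᵐ ω ∂PB, ∀ n k : ℕ, B ((k : ℝ≥0) / 2 ^ n) ω = A ((k : ℝ≥0) / 2 ^ n) ω := by
    rw [ae_all_iff]; intro n
    rw [ae_all_iff]; intro k
    exact (hB.aemeasurable _).ae_eq_mk
  have hBW : ∀ᵐ ω ∂PB, (B · ω) = (W · ω) := by
    filter_upwards [hd, hB.cont] with ω h1 h2
    exact funext fun u => (dyadicReg_eq h2 (fun n k => (h1 n k).symm) u).symm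
  refine ⟨W, ⟨hB.toIsPreBrownianReal.congr fun u => ?_, ?_⟩, mW, hBW⟩
  · filter_upwards [hBW] with ω hω
    exact congrFun hω u
  · filter_upwards [hBW, hB.cont] with ω hω h
    rwa [← hω]

end Homogenization

end

/-! ### Assembly of the main theorem. -/

theorem mainTheorem2
    {S Ω : Type*} [MeasurableSpace S] [MeasurableSpace Ω]
    (P : Measure S) [IsProbabilityMeasure P] (PB : Measure Ω) [IsProbabilityMeasure PB]
    (B : ℝ≥0 → Ω → ℝ) (hB : IsBrownianReal B PB)
    (c : ℝ≥0 → ℝ → S → ℝ)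
    (hc_meas : Measurable (fun q : ℝ≥0 × ℝ × S => c q.1 q.2.1 q.2.2))
    (hc_bdd : ∃ K : ℝ, ∀ t x s, |c t x s| ≤ K)
    (hc_stat : IsStationaryField P c)
    (hc_centered : ∀ t x, ∫ s, c t x s ∂P = 0)
    (hc_corr : Integrable (fun p : ℝ × ℝ => fieldCorrelation P c p.1 p.2))
    (hc_mix : UniformMixing P c)
    (g : ℝ → ℝ) (hg_cont : Continuous g) (hg_L2 : MemLp g 2 volume) :
    -- the effective constant is given by an absolutely convergent integral
    Integrable (fun p : ℝ × Ω => fieldCorrelation P c p.1 (B p.1.toNNReal p.2))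
      ((volume.restrict (Ioi (0 : ℝ))).prod PB) ∧
    -- the mean square convergence of the Feynman-Kac functional
    (∀ t ≥ (0 : ℝ), ∀ x : ℝ,
      (∀ ε > (0 : ℝ), ∀ s, Integrable (fun ω => g (x + B t.toNNReal ω) *
          (Real.exp (expoY c B ε t x s ω) - Real.exp (t * effectiveConst P PB c B))) PB) ∧
      (∀ ε > (0 : ℝ), MemLp (fun s => ∫ ω, g (x + B t.toNNReal ω) *
          (Real.exp (expoY c B ε t x s ω) - Real.exp (t * effectiveConst P PB c B)) ∂PB) 2 P) ∧
      Tendsto (fun ε : ℝ => ∫ s, (∫ ω, g (x + B t.toNNReal ω) *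
          (Real.exp (expoY c B ε t x s ω) - Real.exp (t * effectiveConst P PB c B)) ∂PB) ^ 2 ∂P)
        (𝓝[>] 0) (𝓝 0)) ∧
    (∀ t ≥ (0 : ℝ), ∀ x : ℝ,
      (∀ ε > (0 : ℝ), MemLp (feynmanKac PB c B g ε t x) 2 P) ∧
      Tendsto (fun ε : ℝ =>
          eLpNorm (fun s => feynmanKac PB c B g ε t x s - limitU P PB c B g t x) 2 P)
        (𝓝[>] 0) (𝓝 0)) ∧
    -- the oscillating problem has a solution, and its solutions converge to the same limit
    (∀ ε > (0 : ℝ), ∀ s, ∃ v, IsMildSolution (scaledPotential c ε s) g v) ∧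
    (∀ u : ℝ → ℝ → ℝ → S → ℝ,
      (∀ ε > (0 : ℝ), ∀ᵐ s ∂P,
        IsMildSolution (scaledPotential c ε s) g (fun t x => u ε t x s)) →
      ∀ t ≥ (0 : ℝ), ∀ x : ℝ,
        (∀ ε > (0 : ℝ), MemLp (u ε t x) 2 P) ∧
        Tendsto (fun ε : ℝ => eLpNorm (fun s => u ε t x s - limitU P PB c B g t x) 2 P)
          (𝓝[>] 0) (𝓝 0)) ∧
    -- the limit is a classical solution of the homogenized problem
    (ContinuousOn (fun p : ℝ × ℝ => limitU P PB c B g p.1 p.2) (Ici 0 ×ˢ univ) ∧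
      (∀ x, limitU P PB c B g 0 x = g x) ∧
      ∀ t > (0 : ℝ), ContDiff ℝ 2 (limitU P PB c B g t) ∧
        ∀ x, HasDerivAt (fun τ => limitU P PB c B g τ x)
          (1 / 2 * iteratedDeriv 2 (limitU P PB c B g t) x
            + effectiveConst P PB c B * limitU P PB c B g t x) t) := by
  obtain ⟨K, hK⟩ := hc_bdd
  obtain ⟨C, -, δ, hδ, hmix⟩ := hc_mix
  have hc : IsMixingField P c K C δ := ⟨hδ, hc_meas, hK, hc_centered, hmix⟩
  have hΨ := isCorrKernel_fieldCorrelation hc hc_corr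
  have hg := hg_cont.measurable
  -- `B` need not be jointly measurable. Every quantity in the conclusion is unchanged when `B` is
  -- replaced by an indistinguishable process.
  obtain ⟨W, hW, hWm, hBW⟩ := exists_measurable_indistinguishable hB
  have mW : ∀ t, Measurable (W t) := fun t => hWm.comp (measurable_const.prodMk measurable_id)
  have hBW' : ∀ᵐ ω ∂PB, ∀ u, B u ω = W u ω := by
    filter_upwards [hBW] with ω h u using congrFun h u
  have eConst : effectiveConst P PB c B = effectiveConst P PB c W := by
    unfold effectiveConst
    congr 1; ext r
    refine integral_congr_ae ?_
    filter_upwards [hBW'] with ω h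
    rw [h]
  have ekW : kernelConst PB W (fieldCorrelation P c) = effectiveConst P PB c W := rfl
  have eU : limitU P PB c B g = limitU P PB c W g := by
    ext t x
    unfold limitU
    rw [eConst]
    congr 1
    refine integral_congr_ae ?_
    filter_upwards [hBW'] with ω h
    rw [h]
  have eY : ∀ ε t x s, ∀ᵐ ω ∂PB, expoY c B ε t x s ω = fieldInt c (forwardClock ε) W x t ε s ω := by
    intro ε t x s
    filter_upwards [hBW'] with ω h
    rw [← expoY_eq_fieldInt]
    unfold expoY
    simp_rw [h]
  have eF : ∀ ε t x s, (fun ω => g (x + B t.toNNReal ω) *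
      (Real.exp (expoY c B ε t x s ω) - Real.exp (t * effectiveConst P PB c B))) =ᵐ[PB]
      fun ω => g (x + W t.toNNReal ω) * (Real.exp (fieldInt c (forwardClock ε) W x t ε s ω)
        - Real.exp (t * kernelConst PB W (fieldCorrelation P c))) := by
    intro ε t x s
    filter_upwards [hBW', eY ε t x s] with ω h h'
    rw [h, h', eConst, ekW]
  have eFK : ∀ ε t x, feynmanKac PB c B g ε t x = fun s => ∫ ω, g (x + W t.toNNReal ω)
      * Real.exp (fieldInt c (forwardClock ε) W x t ε s ω) ∂PB := by
    intro ε t x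
    ext s
    unfold feynmanKac
    refine integral_congr_ae ?_
    filter_upwards [hBW', eY ε t x s] with ω h h'
    rw [h, h']
  have hγ : ∀ t x, MemLp (fun ω => g (x + W t ω)) 2 PB := fun t x =>
    memLp_comp_brownian hW.toIsPreBrownianReal mW hg hg_L2 t x
  have hγi : ∀ t x, Integrable (fun ω => g (x + W t ω)) PB := fun t x =>
    (hγ t x).integrable (by simp)
  have fwd := fun t => isClock_forward hc_stat t
  have hV : ∀ ε s, Measurable (Function.uncurry (scaledPotential c ε s)) :=
    measurable_scaledPotential hc_meas
  rw [eU]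
  refine ⟨?_, fun t ht x => ⟨fun ε hε s => ?_, fun ε hε => ?_, ?_⟩, fun t ht x => ?_,
    fun ε hε s => ?_, fun u hu t ht x => ?_,
    ⟨(continuous_limitU hW mW hg_cont hg_L2).continuousOn,
      limitU_zero hW.toIsPreBrownianReal, fun t ht => ?_⟩⟩
  · have hm : Measurable fun p : ℝ × Ω => fieldCorrelation P c p.1 (W p.1.toNNReal p.2) :=
      hΨ.measurable.comp (measurable_fst.prodMk (hWm.comp
        (by fun_prop : Measurable fun p : ℝ × Ω => (p.1.toNNReal, p.2))))
    have hi : Integrable (fun p : ℝ × Ω => fieldCorrelation P c p.1 (W p.1.toNNReal p.2))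
        ((volume.restrict (Ioi (0 : ℝ))).prod PB) := by
      refine ((integrableOn_inv_sq (2 * K ^ 2 * C)).comp_fst PB).mono' hm.aestronglyMeasurable ?_
      have h0 : ∀ᵐ v ∂(volume.restrict (Ioi (0:ℝ))), v ∈ Ioi (0:ℝ) :=
        ae_restrict_mem measurableSet_Ioi
      filter_upwards [Measure.quasiMeasurePreserving_fst.ae h0] with p hp
      exact hΨ.bound p.1 (le_of_lt hp) _
    refine hi.congr ?_
    filter_upwards [Measure.quasiMeasurePreserving_snd.ae hBW'] with p hp
    rw [hp]
  · exact (integrable_mul_exp_fieldInt hc (fwd t) hWm hε ht (hγi _ x) s _).congr (eF ε t x s).symm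
  · simp_rw [integral_congr_ae (eF ε t x _)]
    exact memLp_integral_mul_exp_fieldInt hc (fwd t) hWm hε ht (hγi _ x) _ 2
  · simp_rw [integral_congr_ae (eF _ t x _)]
    exact tendsto_integral_sq_exp_fieldInt hc (fwd t) hW.toIsPreBrownianReal hWm hΨ ht (hγ _ x)
  · simp_rw [eFK]
    exact memLp_and_tendsto_expectation hc (fwd t) hW.toIsPreBrownianReal hWm hΨ ht (hγ _ x) x
  · exact ⟨_, isMildSolution_fkSol hW hWm (hV ε s) (abs_scaledPotential_le hK hε s) hg hg_L2⟩
  · obtain ⟨h1, h2⟩ := memLp_and_tendsto_expectation hc (isClock_backward hc_stat t)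
      hW.toIsPreBrownianReal hWm hΨ.reflect ht (hγ t.toNNReal x) x
    rw [kernelConst_reflect hW.toIsPreBrownianReal hΨ.measurable] at h2
    -- For almost every realization uniqueness identifies the given solution with the Feynman–Kac
    -- one, so measurability and square integrability in `s` are inherited from the latter.
    have eu : ∀ ε > 0, (fun s => ∫ ω, g (x + W t.toNNReal ω)
        * Real.exp (fieldInt c (backwardClock t ε) W x t ε s ω) ∂PB) =ᵐ[P] u ε t x := by
      intro ε hε
      filter_upwards [hu ε hε] with s hs
      rw [← fkSol_eq_fieldInt]
      exact (isMildSolution_fkSol hW hWm (hV ε s) (abs_scaledPotential_le hK hε s) hg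
        hg_L2).unique (hV ε s) (abs_scaledPotential_le hK hε s) hs ht x
    refine ⟨fun ε hε => (h1 ε hε).ae_eq (eu ε hε), h2.congr' ?_⟩
    filter_upwards [self_mem_nhdsWithin] with ε hε
    refine eLpNorm_congr_ae ?_
    filter_upwards [eu ε hε] with s hs
    rw [← hs]
    rfl
  · rw [eConst]
    exact limitU_smooth hW.toIsPreBrownianReal hg hg_L2 ht
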